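/- \textbf{Local conifold transition matrices.} Let $L_a(s)=\sum_{n\ge1}\left(\frac an\right)n^{-s}$ for $\operatorname{Re}s>1$, where $\left(\frac an\right)$ is the Kronecker symbol. For the six local Calabi–Yau threefolds $\mathrm{Tot}(\mathcal O(K_S)\to S)$ over the bases $S$ below, consider the Picard–Fuchs operator $L=\bigl(\theta^2-\mu^{-1}z(\theta+a_1)(\theta+a_2)\bigr)\theta$, $\theta=z\frac{d}{dz}$, with the data $$\begin{array}{c|ccccccccc} S&a_1,a_2&1/\mu&\kappa&\sigma&c_2\cdot J&s&l&h\\\hline \mathbb P^1\times\mathbb P^1&\frac12,\frac12&2^4&1&0&-2&0&32\pi L_{-4}(2)&2\\ \mathbb P^2&\frac13,\frac23&-3^3&\frac13&\frac16&-2&\frac12&27\sqrt3\,\pi L_{-3}(2)&3\\ B_5&\frac12,\frac12&-2^4&4&2&-20&\frac12&32\pi L_{-4}(2)&1\\ B_6&\frac13,\frac23&-3^3&3&\frac32&-18&\frac12&27\sqrt3\,\pi L_{-3}(2)&1\\ B_7&\frac14,\frac34&-2^6&2&1&-16&\frac12&32\sqrt2\,\pi L_{-8}(2)&1\\ B_8&\frac16,\frac56&-2^4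 3^3&1&\frac12&-14&\frac12&80\pi L_{-4}(2)&1 \end{array}$$ On the open interval between $0$ and $\mu$ let $\Pi_0$ be the solution vector of $Ly=0$ that near $z=0$ has the form $$\Pi_0=\bigl(1,\ \log z+f_0(z),\ \tfrac12\log^2 z+f_0(z)\log z+f_1(z)\bigr)^T$$ with power series $f_0,f_1=O(z)$, where $\log z=\log|z|+\pi i$ if $z<0$, and let the $\hat\Gamma$-class basis be $$\Pi=\begin{pmatrix}\Pi_{D_4}\\ \Pi_{D_0}\\ \Pi_{D_2}\end{pmatrix}=(2\pi i)^3\begin{pmatrix}\frac{c_2\cdot J}{24}&\frac{\sigma}{2\pi i}&-\frac{\kappa}{(2\pi i)^2}\\1&0&0\\0&\frac1{2\pi i}&0\end{pmatrix}\Pi_0 .$$ Let $\Pi_\mu$ be the solution vector on the same interval that near $z=\mu$ has the form $\bigl(1,\ \nu(\delta),\ \nu(\delta)\log\delta+O(\delta^2)\bigr)^T$ with $\delta=1-z/\mu$ and $\nu(\delta)=\delta+O(\delta^2)$, where $\nu$ and the last $O(\delta^2)$ are power series in $\delta$. Then $\Pi_0$ and $\Pi_\mu$ exist, and for each of the six models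 there is exactly one matrix $T_\mu$ with $\Pi=T_\mu\Pi_\mu$ on the interval, namely $$T_\mu=\begin{pmatrix}0&-4i\pi^2\frac{\sqrt\kappa}{h}&0\\(2\pi i)^3&0&0\\ l+s(2\pi i)^3&2\pi h\sqrt\kappa\,(1-\log|\mu|)&-2\pi h\sqrt\kappa\end{pmatrix}.$$ Moreover, for $a_1=a_2=\frac12$ and $\mu=\frac1{16}$ (the Legendre family, related to $B_5$ by $z\mapsto-z$), let $\omega_1(z)=\sum_{n\ge0}\binom{2n}n^2z^n$, and let $\omega_2$ be the function on $(0,\mu)$ annihilated by $\theta^2-\frac z\mu(\theta+\frac12)^2$ with $\omega_2(z)=\log(z)\,\omega_1(z)+O(z)$ near $z=0$, the $O(z)$ being a power series. Then $\omega_2$ exists, and on $(0,\mu)$ $$\Pi_0(z)=\int_\mu^z\begin{pmatrix}0\\ \omega_1(z')\\ \omega_2(z')\end{pmatrix}\frac{dz'}{z'}+\begin{pmatrix}1\\c_1\\c_2\end{pmatrix},$$ $$c_1=\log\mu+\int_0^\mu\frac{\omega_1(z)-1}{z}\,dz=-\frac8\pi L_{-4}(2),\qquad c_2=\tfrac12\log^2\mu+\int_0^\mu\frac{\omega_2(z)-\log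 z}{z}\,dz=\frac{\pi^2}3,$$ all these integrals being convergent. -/

import Mathlib

open Filter Topology Asymptotics

namespace LocalCY

noncomputable section

/-- The Kronecker symbol `(a / n)` for `n ≥ 1`: the symbol at the prime `2` is `0` for even `a`,
`1` for `a ≡ ±1 (mod 8)` and `-1` for `a ≡ ±3 (mod 8)` (this is `ZMod.χ₈`), and on odd `n`
it is the Jacobi symbol. -/
def kroneckerSymbol (a : ℤ) (n : ℕ) : ℤ :=
  ZMod.χ₈ (a : ZMod 8) ^ (n.factorization 2) * jacobiSym a (n / 2 ^ n.factorization 2)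

/-- `L_a(s) = ∑_{n ≥ 1} (a / n) n ^ (-s)`, for `1 < Re s`. -/
def dirichletL (a : ℤ) (s : ℂ) : ℂ :=
  LSeries (fun n => (kroneckerSymbol a n : ℂ)) s

/-! ### The Picard-Fuchs operator on the open interval between `0` and `μ` -/

/-- The open interval between `0` and `μ`, where `μ` may be negative. -/
def interval (μ : ℝ) : Set ℝ := Set.Ioo (min 0 μ) (max 0 μ)

/-- The logarithmic derivative operator `θ = z d/dz`. -/
def theta (y : ℝ → ℂ) : ℝ → ℂ := fun z => (z : ℂ) * deriv y z

/-- The operator `θ + a`. -/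
def thetaAdd (a : ℝ) (y : ℝ → ℂ) : ℝ → ℂ := fun z => theta y z + (a : ℂ) * y z

/-- The second order operator `θ² - μ⁻¹ z (θ + a₁) (θ + a₂)`. -/
def hypergeometricOp (a₁ a₂ μ : ℝ) (y : ℝ → ℂ) : ℝ → ℂ := fun z =>
  theta (theta y) z - (μ : ℂ)⁻¹ * (z : ℂ) * thetaAdd a₁ (thetaAdd a₂ y) z

/-- The Picard-Fuchs operator `L = (θ² - μ⁻¹ z (θ + a₁) (θ + a₂)) θ`. -/
def picardFuchsOp (a₁ a₂ μ : ℝ) (y : ℝ → ℂ) : ℝ → ℂ :=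
  hypergeometricOp a₁ a₂ μ (theta y)

/-- `y` solves the Picard-Fuchs equation `L y = 0` on the open interval between `0` and `μ`. -/
def IsPicardFuchsSolution (a₁ a₂ μ : ℝ) (y : ℝ → ℂ) : Prop :=
  ContDiffOn ℝ 3 y (interval μ) ∧ ∀ z ∈ interval μ, picardFuchsOp a₁ a₂ μ y z = 0

/-- `Φ` is the Frobenius basis `Π₀` at `z = 0`, continued along the interval between `0` and `μ`:
its components solve the Picard-Fuchs equation and near `z = 0` they are
`1`, `log z + f₀(z)`, `(log z)² / 2 + f₀(z) log z + f₁(z)` with power series `f₀`, `f₁` that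
are `O(z)`. The logarithm is the principal one: `log z = log |z| + π i` for `z < 0`. -/
structure IsFrobeniusBasisAtZero (a₁ a₂ μ : ℝ) (Φ : ℝ → Fin 3 → ℂ) : Prop where
  solution : ∀ i, IsPicardFuchsSolution a₁ a₂ μ (fun z => Φ z i)
  expansion : ∃ f₀ f₁ : ℂ → ℂ, AnalyticAt ℂ f₀ 0 ∧ AnalyticAt ℂ f₁ 0 ∧
    (f₀ =O[𝓝 0] fun z => z) ∧ (f₁ =O[𝓝 0] fun z => z) ∧
    ∀ᶠ z : ℝ in 𝓝[interval μ] 0,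
      Φ z = ![1,
        Complex.log z + f₀ z,
        1 / 2 * Complex.log z ^ 2 + f₀ z * Complex.log z + f₁ z]

/-- `Ψ` is the Frobenius basis `Π_μ` at the conifold point `z = μ`, continued along the interval
between `0` and `μ`: its components solve the Picard-Fuchs equation and near `z = μ` they are
`1`, `ν(δ)`, `ν(δ) log δ + O(δ²)` with `δ = 1 - z / μ` (a positive number) and
`ν(δ) = δ + O(δ²)`, where `ν` and the term `O(δ²)` are power series in `δ`. -/
structure IsFrobeniusBasisAtConifold (a₁ a₂ μ : ℝ) (Ψ : ℝ → Fin 3 → ℂ) : Prop where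
  solution : ∀ i, IsPicardFuchsSolution a₁ a₂ μ (fun z => Ψ z i)
  expansion : ∃ ν g : ℂ → ℂ, AnalyticAt ℂ ν 0 ∧ AnalyticAt ℂ g 0 ∧
    ((fun δ => ν δ - δ) =O[𝓝 0] fun δ => δ ^ 2) ∧ (g =O[𝓝 0] fun δ => δ ^ 2) ∧
    ∀ᶠ z : ℝ in 𝓝[interval μ] μ, ∀ δ : ℝ, δ = 1 - z / μ →
      Ψ z = ![1, ν δ, ν δ * Real.log δ + g δ]

/-! ### The six local geometries -/

/-- The base surface `S` of the local Calabi-Yau threefold `Tot(O(K_S) → S)`. -/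
inductive LocalDelPezzo
  | P1xP1
  | P2
  | B5
  | B6
  | B7
  | B8

/-- The numerical data of a local model: the exponents `a₁, a₂` and the conifold point `μ` of its
Picard-Fuchs operator, the topological invariants `κ`, `σ`, `c₂ · J`, the shift `s`, the
`L`-value `l`, and the integer `h`. -/
structure ModelData where
  a₁ : ℝ
  a₂ : ℝ
  μ : ℝ
  κ : ℝ
  σ : ℝ
  c₂J : ℝ
  s : ℝ
  l : ℂ
  h : ℕ

open Real in
/-- The table of the data of the six local models. -/
def LocalDelPezzo.data : LocalDelPezzo → ModelData
  | .P1xP1 =>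
    { a₁ := 1 / 2, a₂ := 1 / 2, μ := 1 / 2 ^ 4, κ := 1, σ := 0, c₂J := -2, s := 0,
      l := 32 * π * dirichletL (-4) 2, h := 2 }
  | .P2 =>
    { a₁ := 1 / 3, a₂ := 2 / 3, μ := -1 / 3 ^ 3, κ := 1 / 3, σ := 1 / 6, c₂J := -2, s := 1 / 2,
      l := 27 * √3 * π * dirichletL (-3) 2, h := 3 }
  | .B5 =>
    { a₁ := 1 / 2, a₂ := 1 / 2, μ := -1 / 2 ^ 4, κ := 4, σ := 2, c₂J := -20, s := 1 / 2,
      l := 32 * π * dirichletL (-4) 2, h := 1 }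
  | .B6 =>
    { a₁ := 1 / 3, a₂ := 2 / 3, μ := -1 / 3 ^ 3, κ := 3, σ := 3 / 2, c₂J := -18, s := 1 / 2,
      l := 27 * √3 * π * dirichletL (-3) 2, h := 1 }
  | .B7 =>
    { a₁ := 1 / 4, a₂ := 3 / 4, μ := -1 / 2 ^ 6, κ := 2, σ := 1, c₂J := -16, s := 1 / 2,
      l := 32 * √2 * π * dirichletL (-8) 2, h := 1 }
  | .B8 =>
    { a₁ := 1 / 6, a₂ := 5 / 6, μ := -1 / (2 ^ 4 * 3 ^ 3), κ := 1, σ := 1 / 2, c₂J := -14,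
      s := 1 / 2, l := 80 * π * dirichletL (-4) 2, h := 1 }

open Real Complex in
/-- The matrix that expresses the `Γ̂`-class basis `Π = (Π_{D4}, Π_{D0}, Π_{D2})` in the Frobenius
basis `Π₀` at `z = 0`. -/
def gammaClassMatrix (D : ModelData) : Matrix (Fin 3) (Fin 3) ℂ :=
  (2 * π * I) ^ 3 •
    !![(D.c₂J : ℂ) / 24, (D.σ : ℂ) / (2 * π * I), -(D.κ : ℂ) / (2 * π * I) ^ 2;
       1, 0, 0;
       0, 1 / (2 * π * I), 0]

open Real Complex in
/-- The transition matrix `T_μ`. -/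
def transitionMatrix (D : ModelData) : Matrix (Fin 3) (Fin 3) ℂ :=
  !![0, -4 * I * π ^ 2 * (√D.κ : ℝ) / D.h, 0;
     (2 * π * I) ^ 3, 0, 0;
     D.l + D.s * (2 * π * I) ^ 3,
       2 * π * D.h * (√D.κ : ℝ) * (1 - (Real.log |D.μ| : ℝ)),
       -2 * π * D.h * (√D.κ : ℝ)]

/-! ### The constants of the Legendre family, where `μ = 1 / 16` -/

/-- `ω₁(z) = ∑ binom(2n, n)² zⁿ`. -/
def omega₁ (z : ℝ) : ℂ := ∑' n : ℕ, (Nat.centralBinom n : ℂ) ^ 2 * (z : ℂ) ^ n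

/-- `ω₂` is annihilated by `θ² - (z / μ) (θ + 1/2)²` on `(0, μ)`, `μ = 1 / 16`, and is
`log(z) ω₁(z) + O(z)` near `z = 0`, where the term `O(z)` is a power series. -/
structure IsOmega₂ (ω₂ : ℝ → ℂ) : Prop where
  contDiffOn : ContDiffOn ℝ 2 ω₂ (interval (1 / 16))
  equation : ∀ z ∈ interval (1 / 16), hypergeometricOp (1 / 2) (1 / 2) (1 / 16) ω₂ z = 0
  expansion : ∃ g : ℂ → ℂ, AnalyticAt ℂ g 0 ∧ (g =O[𝓝 0] fun z => z) ∧
    ∀ᶠ z : ℝ in 𝓝[interval (1 / 16)] 0, ω₂ z = Real.log z * omega₁ z + g z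

/-- `c₁ = log μ + ∫_0^μ (ω₁(z) - 1) / z dz` with `μ = 1 / 16`. -/
def c₁ : ℂ := (Real.log (1 / 16) : ℂ) + ∫ z in (0 : ℝ)..(1 / 16), (omega₁ z - 1) / (z : ℂ)

/-- `c₂ = (log μ)² / 2 + ∫_0^μ (ω₂(z) - log z) / z dz` with `μ = 1 / 16`. -/
def c₂ (ω₂ : ℝ → ℂ) : ℂ :=
  1 / 2 * (Real.log (1 / 16) : ℂ) ^ 2 +
    ∫ z in (0 : ℝ)..(1 / 16), (ω₂ z - (Real.log z : ℂ)) / (z : ℂ)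

end

end LocalCY

namespace LocalCY

open Set

/-! In the coordinate x = z / μ all six models take one shape: since a₁ + a₂ = 1, the function w =
θy satisfies (x (1 - x) w')' = p w with p = a₁ a₂ = a (1 - a). Frobenius' method at 0 gives F = ∑ Aₙ
xⁿ with Aₙ = (a)ₙ (1 - a)ₙ / n!², and U = F log x + ∑ Aₙ Dₙ xⁿ. The reflection x ↦ 1 - x preserves
the equation, so F(1 - x) and U(1 - x) are the corresponding solutions at the conifold point, and
all periods are primitives of such functions with respect to dx / x. Hence T_μ consists of a
connection formula and of constants of integration.

The connection formula (`solF_one_sub`) is F(1 - x) = C (l F(x) - U(x)) with C = lim n Aₙ = sin(πa)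
/ π, by Euler's sine product, and l = lim Dₙ, which is -log |μ| in every model. It follows from
comparing Wronskians at 0 and sizes at 1. The nonconstant conifold periods vanish at x = 1, so the
constants of integration are the limits of Π₀ there. They involve two numbers.

The first is S = ∑ Aₙ / n. A Wallis integral turns it into an integral of cosines over sin y;
telescoping the kernel, the Riemann-Lebesgue lemma and symmetrisation in a ↔ 1 - a give l - S =
(sin(πa) / π) ∑ (-1)ᵏ ((k + a)⁻² + (k + 1 - a)⁻²), a rational-progression sum that is the L-value
(`tendsto_frobD_sub_alternating`, `sub_tsum_frobA_div`).

The second is R = ∑_{n ≥ 1} Aₙ ((Dₙ - l) / n - 1 / n²), the regular part at s = 0 of the Mellin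
transform of U - l F. The differential equation gives E(s) = -s² times this transform a first order
recurrence s → s + 1. Iterating it for s and -s together and using Euler's product yields E(s) E(-s)
in terms of sines (`mellinEntire_mul_neg`); the s² coefficient is R = (π² / sin²(πa) - π² / 3 - l²)
/ 2 (`mellinReg_zero`).

The table enters only through a few relations between κ, σ, c₂ · J, s, h and the sign of μ. For the
Legendre family, S and R are the content of c₁ and c₂. -/

/-! ### Power series with coefficients of polynomial growth -/

/-- The sequence `c` grows at most polynomially. -/
def PolyBdd (c : ℕ → ℝ) : Prop := ∃ C : ℝ, ∃ k : ℕ, ∀ n, |c n| ≤ C * ((n : ℝ) + 1) ^ k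

theorem PolyBdd.of_le {c : ℕ → ℝ} (C : ℝ) (h : ∀ n, |c n| ≤ C) : PolyBdd c :=
  ⟨C, 0, fun n => by simpa using h n⟩

theorem PolyBdd.mono {c e : ℕ → ℝ} (hc : PolyBdd c) (h : ∀ n, |e n| ≤ |c n|) : PolyBdd e := by
  obtain ⟨C, k, hC⟩ := hc
  exact ⟨C, k, fun n => (h n).trans (hC n)⟩

theorem PolyBdd.add {c e : ℕ → ℝ} (hc : PolyBdd c) (he : PolyBdd e) :
    PolyBdd (fun n => c n + e n) := by
  obtain ⟨C, k, hC⟩ := hc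
  obtain ⟨E, l, hE⟩ := he
  refine ⟨|C| + |E|, k + l, fun n => (abs_add_le _ _).trans ?_⟩
  have h1 : (1 : ℝ) ≤ (n : ℝ) + 1 := by linarith [n.cast_nonneg (α := ℝ)]
  have hk : ((n : ℝ) + 1) ^ k ≤ ((n : ℝ) + 1) ^ (k + l) := pow_le_pow_right₀ h1 (by omega)
  have hl : ((n : ℝ) + 1) ^ l ≤ ((n : ℝ) + 1) ^ (k + l) := pow_le_pow_right₀ h1 (by omega)
  calc |c n| + |e n| ≤ C * ((n : ℝ) + 1) ^ k + E * ((n : ℝ) + 1) ^ l := add_le_add (hC n) (hE n)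
    _ ≤ |C| * ((n : ℝ) + 1) ^ k + |E| * ((n : ℝ) + 1) ^ l := by
        gcongr <;> exact le_abs_self _
    _ ≤ |C| * ((n : ℝ) + 1) ^ (k + l) + |E| * ((n : ℝ) + 1) ^ (k + l) := by gcongr
    _ = _ := by ring

theorem PolyBdd.mul {c e : ℕ → ℝ} (hc : PolyBdd c) (he : PolyBdd e) :
    PolyBdd (fun n => c n * e n) := by
  obtain ⟨C, k, hC⟩ := hc
  obtain ⟨E, l, hE⟩ := he
  refine ⟨C * E, k + l, fun n => ?_⟩
  rw [abs_mul]
  calc |c n| * |e n| ≤ (C * ((n : ℝ) + 1) ^ k) * (E * ((n : ℝ) + 1) ^ l) :=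
        mul_le_mul (hC n) (hE n) (abs_nonneg _) ((abs_nonneg _).trans (hC n))
    _ = _ := by ring

theorem PolyBdd.const (r : ℝ) : PolyBdd (fun _ => r) := .of_le |r| fun _ => le_rfl

theorem PolyBdd.natCast : PolyBdd (fun n => (n : ℝ)) :=
  ⟨1, 1, fun n => by simp⟩

theorem PolyBdd.nat_mul {c : ℕ → ℝ} (hc : PolyBdd c) : PolyBdd (fun n => n * c n) :=
  PolyBdd.natCast.mul hc

theorem PolyBdd.const_mul {c : ℕ → ℝ} (r : ℝ) (hc : PolyBdd c) : PolyBdd (fun n => r * c n) :=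
  (PolyBdd.const r).mul hc

theorem PolyBdd.sub {c e : ℕ → ℝ} (hc : PolyBdd c) (he : PolyBdd e) :
    PolyBdd (fun n => c n - e n) := by
  simpa [sub_eq_add_neg] using hc.add (he.const_mul (-1))

theorem PolyBdd.div_nat {c : ℕ → ℝ} (hc : PolyBdd c) : PolyBdd (fun n => c n / n) := by
  refine hc.mono fun n => ?_
  rcases Nat.eq_zero_or_pos n with rfl | hn
  · simp
  · rw [abs_div]
    have : (1 : ℝ) ≤ |(n : ℝ)| := by rw [Nat.abs_cast]; exact_mod_cast hn
    exact div_le_self (abs_nonneg _) this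

theorem PolyBdd.succ {c : ℕ → ℝ} (hc : PolyBdd c) : PolyBdd (fun n => c (n + 1)) := by
  obtain ⟨C, k, hC⟩ := hc
  have hC0 : 0 ≤ C := by simpa using (abs_nonneg _).trans (hC 0)
  refine ⟨C * 2 ^ k, k, fun n => (hC _).trans ?_⟩
  rw [mul_assoc, ← mul_pow]
  have : (0 : ℝ) ≤ n := n.cast_nonneg
  gcongr
  push_cast; linarith

theorem PolyBdd.sum_range {c : ℕ → ℝ} (hc : PolyBdd c) :
    PolyBdd (fun n => ∑ k ∈ Finset.range n, c k) := by
  obtain ⟨C, k, hC⟩ := hc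
  have hC0 : 0 ≤ C := by simpa using (abs_nonneg _).trans (hC 0)
  refine ⟨C, k + 1, fun n => (Finset.abs_sum_le_sum_abs _ _).trans ?_⟩
  calc ∑ i ∈ Finset.range n, |c i| ≤ ∑ i ∈ Finset.range n, C * ((n : ℝ) + 1) ^ k := by
        refine Finset.sum_le_sum fun i hi => (hC i).trans ?_
        have : (i : ℝ) ≤ n := by exact_mod_cast (Finset.mem_range.1 hi).le
        gcongr
    _ = n * (C * ((n : ℝ) + 1) ^ k) := by simp
    _ ≤ ((n : ℝ) + 1) * (C * ((n : ℝ) + 1) ^ k) := by gcongr; linarith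
    _ = _ := by ring

/-- The coefficients of `z` times the power series with coefficients `c`. -/
def shift (c : ℕ → ℝ) : ℕ → ℝ
  | 0 => 0
  | n + 1 => c n

section
variable {𝕜 : Type*} [RCLike 𝕜]

/-- The sum of the power series with coefficients `c`. -/
noncomputable def psum (c : ℕ → ℝ) (z : 𝕜) : 𝕜 := ∑' n, c n • z ^ n

theorem PolyBdd.summable_norm {c : ℕ → ℝ} (hc : PolyBdd c) {z : 𝕜} (hz : ‖z‖ < 1) :
    Summable fun n => ‖c n • z ^ n‖ := by
  obtain ⟨C, k, hC⟩ := hc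
  have hC0 : 0 ≤ C := by simpa using (abs_nonneg _).trans (hC 0)
  have hz' : ‖(‖z‖ : ℝ)‖ < 1 := by rwa [norm_norm]
  have h1 : Summable fun n : ℕ => (n : ℝ) ^ k * ‖z‖ ^ n :=
    summable_pow_mul_geometric_of_norm_lt_one k hz'
  have h2 : Summable fun n : ℕ => ‖z‖ ^ n := summable_geometric_of_lt_one (norm_nonneg z) hz
  have hs : Summable fun n : ℕ => (2 ^ k * C) * ((n : ℝ) ^ k * ‖z‖ ^ n) + C * ‖z‖ ^ n :=
    (h1.mul_left _).add (h2.mul_left _)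
  refine Summable.of_nonneg_of_le (fun _ => norm_nonneg _) (fun n => ?_) hs
  rw [norm_smul, norm_pow, Real.norm_eq_abs]
  have : ((n : ℝ) + 1) ^ k ≤ 2 ^ k * (n : ℝ) ^ k + 1 := by
    rcases Nat.eq_zero_or_pos n with rfl | hn
    · simp
    · have h1 : (1 : ℝ) ≤ n := by exact_mod_cast hn
      rw [← mul_pow]
      have : ((n : ℝ) + 1) ^ k ≤ (2 * (n : ℝ)) ^ k := by gcongr; linarith
      linarith
  calc |c n| * ‖z‖ ^ n ≤ (C * (2 ^ k * (n : ℝ) ^ k + 1)) * ‖z‖ ^ n := by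
        gcongr
        exact (hC n).trans (by gcongr)
    _ = _ := by ring

theorem PolyBdd.hasSum {c : ℕ → ℝ} (hc : PolyBdd c) {z : 𝕜} (hz : ‖z‖ < 1) :
    HasSum (fun n => c n • z ^ n) (psum c z) :=
  (hc.summable_norm hz).of_norm.hasSum

theorem psum_zero (c : ℕ → ℝ) : psum c (0 : 𝕜) = c 0 • 1 := by
  rw [psum, tsum_eq_single 0 (fun n hn => by simp [hn])]
  simp

theorem psum_add {c e : ℕ → ℝ} (hc : PolyBdd c) (he : PolyBdd e) {z : 𝕜} (hz : ‖z‖ < 1) :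
    psum (fun n => c n + e n) z = psum c z + psum e z := by
  refine HasSum.tsum_eq ?_
  simpa [add_smul] using (hc.hasSum hz).add (he.hasSum hz)

theorem psum_sub {c e : ℕ → ℝ} (hc : PolyBdd c) (he : PolyBdd e) {z : 𝕜} (hz : ‖z‖ < 1) :
    psum (fun n => c n - e n) z = psum c z - psum e z := by
  refine HasSum.tsum_eq ?_
  simpa [sub_smul] using (hc.hasSum hz).sub (he.hasSum hz)

theorem psum_const_mul (r : ℝ) (c : ℕ → ℝ) (z : 𝕜) :
    psum (fun n => r * c n) z = r • psum c z := by
  simp only [psum, mul_smul]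
  exact tsum_const_smul'' r

theorem psum_shift {c : ℕ → ℝ} (hc : PolyBdd c) {z : 𝕜} (hz : ‖z‖ < 1) :
    psum (shift c) z = z * psum c z := by
  refine HasSum.tsum_eq ?_
  rw [← hasSum_nat_add_iff' 1]
  simpa [shift, pow_succ', mul_smul_comm] using (hc.hasSum hz).mul_left z

theorem hasDerivAt_psum {c : ℕ → ℝ} (hc : PolyBdd c) {z : 𝕜} (hz : ‖z‖ < 1) :
    HasDerivAt (psum c) (psum (fun n => ((n : ℝ) + 1) * c (n + 1)) z) z := by
  obtain ⟨r, hr1, hr2⟩ := exists_between hz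
  have hr0 : 0 ≤ r := (norm_nonneg z).trans hr1.le
  have hr : ‖(r : 𝕜)‖ = r := by simp [abs_of_nonneg hr0]
  have hb : PolyBdd (fun n => ((n : ℝ) + 1) * c (n + 1)) := by
    simpa using hc.nat_mul.succ
  have hu := hb.summable_norm (z := (r : 𝕜)) (by rwa [hr])
  have hu' : Summable fun n : ℕ => ‖(n * c n) • (r : 𝕜) ^ (n - 1)‖ := by
    rw [← summable_nat_add_iff 1]
    simpa using hu
  have key : HasDerivAt (fun z : 𝕜 => ∑' n, c n • z ^ n) (∑' n : ℕ, (n * c n) • z ^ (n - 1)) z := by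
    refine hasDerivAt_tsum_of_isPreconnected (t := Metric.ball 0 r) (y₀ := 0)
      (g' := fun (n : ℕ) (z : 𝕜) => ((n : ℝ) * c n) • z ^ (n - 1)) hu' Metric.isOpen_ball
      (convex_ball (0 : 𝕜) r).isPreconnected (fun n y _ => ?_) (fun n y hy => ?_) ?_ ?_ ?_
    · have := (hasDerivAt_pow n y).const_smul (c n)
      refine this.congr_deriv ?_
      simp only [RCLike.real_smul_eq_coe_mul]; push_cast; ring
    · have hy : ‖y‖ < r := by simpa using hy
      rw [norm_smul, norm_smul, norm_pow, norm_pow, hr]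
      gcongr
    · simpa using (norm_nonneg z).trans_lt hr1
    · exact (hc.summable_norm (z := (0 : 𝕜)) (by simp)).of_norm
    · simpa using hr1
  refine key.congr_deriv (HasSum.tsum_eq ?_)
  rw [← hasSum_nat_add_iff' 1]
  simpa using hb.hasSum hz

theorem mul_psum_deriv {c : ℕ → ℝ} (hc : PolyBdd c) {z : 𝕜} (hz : ‖z‖ < 1) :
    z * psum (fun n => ((n : ℝ) + 1) * c (n + 1)) z = psum (fun n => n * c n) z := by
  rw [← psum_shift (by simpa using hc.nat_mul.succ) hz]
  congr 1
  funext n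
  cases n <;> simp [shift]

/-- In this form θ acts on coefficients as multiplication by n, which turns differential equations
into recurrences. -/
theorem hasDerivAt_psum' {c : ℕ → ℝ} (hc : PolyBdd c) {z : 𝕜} (hz : ‖z‖ < 1) (h0 : z ≠ 0) :
    HasDerivAt (psum c) (psum (fun n => n * c n) z / z) z := by
  convert hasDerivAt_psum hc hz using 1
  rw [← mul_psum_deriv hc hz]
  field_simp

theorem continuousAt_psum {c : ℕ → ℝ} (hc : PolyBdd c) {z : 𝕜} (hz : ‖z‖ < 1) :
    ContinuousAt (psum c) z := (hasDerivAt_psum hc hz).continuousAt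

end

theorem psum_ofReal (c : ℕ → ℝ) (x : ℝ) : psum c (x : ℂ) = ((psum c x : ℝ) : ℂ) := by
  simp only [psum, Complex.ofReal_tsum]
  congr 1; funext n; simp

theorem analyticAt_psum {c : ℕ → ℝ} (hc : PolyBdd c) {z : ℂ} (hz : ‖z‖ < 1) :
    AnalyticAt ℂ (psum c) z := by
  have : DifferentiableOn ℂ (psum c : ℂ → ℂ) (Metric.ball 0 1) := fun w hw =>
    (hasDerivAt_psum hc (by simpa using hw)).differentiableAt.differentiableWithinAt
  exact this.analyticAt (Metric.isOpen_ball.mem_nhds (by simpa using hz))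

theorem psum_isBigO {c : ℕ → ℝ} (hc : PolyBdd c) (h0 : c 0 = 0) :
    (psum c : ℂ → ℂ) =O[𝓝 0] fun z => z := by
  have h := (hasDerivAt_psum hc (z := (0 : ℂ)) (by simp)).isBigO_sub
  simpa [psum_zero, h0] using h

theorem psum_isBigO_sq {c : ℕ → ℝ} (hc : PolyBdd c) (h0 : c 0 = 0) (h1 : c 1 = 0) :
    (psum c : ℂ → ℂ) =O[𝓝 0] fun z => z ^ 2 := by
  have e : c = shift (fun n => c (n + 1)) := by
    funext n; cases n <;> simp [shift, h0]
  have h := (Asymptotics.isBigO_refl (fun z : ℂ => z) (𝓝 0)).mul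
    (psum_isBigO hc.succ (by simpa using h1))
  refine Asymptotics.IsBigO.congr' h ?_ (by filter_upwards with z; ring)
  filter_upwards [Metric.ball_mem_nhds (0 : ℂ) one_pos] with z hz
  rw [← psum_shift hc.succ (by simpa using hz), ← e]

/-! ### Abelian theorems at x = 1 -/

/-- Abel's theorem for absolutely convergent series. -/
theorem tendsto_psum_one {c : ℕ → ℝ} (hc : Summable c) :
    Tendsto (psum c : ℝ → ℝ) (𝓝[<] 1) (𝓝 (∑' n, c n)) := by
  have e : (psum c : ℝ → ℝ) = fun x => ∑' n, c n * x ^ n := rfl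
  rw [e]
  exact Real.tendsto_tsum_powerSeries_nhdsWithin_lt hc.hasSum.tendsto_sum_nat

/-- Weighted Abelian theorem: averages of a convergent sequence against a divergent positive
power series converge. -/
theorem tendsto_psum_div_psum {w b : ℕ → ℝ} {l : ℝ} (hw : PolyBdd w) (hw0 : ∀ n, 0 ≤ w n)
    (hdiv : Tendsto (psum w : ℝ → ℝ) (𝓝[<] 1) atTop) (hb : Tendsto b atTop (𝓝 l)) :
    Tendsto (fun x : ℝ => psum (fun n => w n * b n) x / psum w x) (𝓝[<] 1) (𝓝 l) := by
  obtain ⟨B, hB⟩ : ∃ B, ∀ n, |b n - l| ≤ B := by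
    obtain ⟨B, hB⟩ := (hb.sub_const l).abs.bddAbove_range
    exact ⟨B, fun n => hB ⟨n, rfl⟩⟩
  have hbb : PolyBdd (fun n => b n - l) := .of_le B hB
  rw [Metric.tendsto_nhds]
  intro ε hε
  obtain ⟨N, hN⟩ := (Metric.tendsto_atTop.1 hb) (ε / 2) (by positivity)
  set C := ∑ n ∈ Finset.range N, w n * B with hC
  have hx0 : ∀ᶠ x : ℝ in 𝓝[<] 1, x ∈ Ioo (0 : ℝ) 1 := Ioo_mem_nhdsLT one_pos
  -- The first N terms contribute at most C because xⁿ ≤ 1, and the divergence of the weights makes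
  -- C smaller than half of ε times their sum.
  filter_upwards [hx0, hdiv.eventually_gt_atTop (2 * C / ε), hdiv.eventually_gt_atTop 0]
    with x hx h1 h2
  have hx' : ‖x‖ < 1 := by rw [Real.norm_eq_abs, abs_of_pos hx.1]; exact hx.2
  have e1 : psum (fun n => w n * b n) x / psum w x - l
      = psum (fun n => w n * (b n - l)) x / psum w x := by
    have : psum (fun n => w n * b n) x = psum (fun n => w n * (b n - l)) x + l * psum w x := by
      rw [← smul_eq_mul l, ← psum_const_mul, ← psum_add (hw.mul hbb) (hw.const_mul l) hx']
      congr 1; funext n; ring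
    rw [this]; field_simp; ring
  rw [Real.dist_eq, e1, abs_div, abs_of_pos h2, div_lt_iff₀ h2]
  have hs := (hw.mul hbb).summable_norm hx'
  have hs2 := (hw.hasSum hx').mul_left (ε / 2)
  have hfin : HasSum (fun n => if n ∈ Finset.range N then w n * B else 0) C := by
    have : HasSum (fun n => if n ∈ Finset.range N then w n * B else 0) _ :=
      hasSum_sum_of_ne_finset_zero (s := Finset.range N) (fun n hn => by simp only [hn, if_false])
    convert this using 1
    exact Finset.sum_congr rfl fun n hn => by simp only [hn, if_true]
  have hle : |psum (fun n => w n * (b n - l)) x| ≤ C + ε / 2 * psum w x := by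
    refine (norm_tsum_le_tsum_norm hs).trans ?_
    refine hasSum_le (fun n => ?_) hs.hasSum (hfin.add hs2)
    have hxn : 0 ≤ x ^ n := pow_nonneg hx.1.le n
    have hxn1 : x ^ n ≤ 1 := pow_le_one₀ hx.1.le hx.2.le
    rw [norm_smul, norm_mul, Real.norm_eq_abs, Real.norm_eq_abs, Real.norm_eq_abs,
      abs_of_nonneg (hw0 n), abs_of_nonneg hxn, smul_eq_mul]
    have hwn := mul_nonneg (hw0 n) hxn
    by_cases hn : n ∈ Finset.range N
    · simp only [hn, if_true]
      have := mul_le_mul (mul_le_mul_of_nonneg_left (hB n) (hw0 n)) hxn1 hxn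
        (mul_nonneg (hw0 n) ((abs_nonneg _).trans (hB n)))
      nlinarith
    · simp only [hn, if_false]
      have h3 := (hN n (by simpa using hn)).le
      rw [Real.dist_eq] at h3
      nlinarith
  rw [div_lt_iff₀ hε] at h1
  nlinarith

theorem psum_one_eq {x : ℝ} (hx : ‖x‖ < 1) : psum (fun _ => 1) x = (1 - x)⁻¹ := by
  simpa [psum] using tsum_geometric_of_norm_lt_one hx

/-- The weighted theorem with all weights 1, whose power series is 1 / (1 - x). It reads the growth
of F and θF at 1 off Aₙ and n Aₙ. -/
theorem tendsto_one_sub_mul_psum {b : ℕ → ℝ} {l : ℝ} (hb : Tendsto b atTop (𝓝 l)) :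
    Tendsto (fun x : ℝ => (1 - x) * psum b x) (𝓝[<] 1) (𝓝 l) := by
  have hx0 : ∀ᶠ x : ℝ in 𝓝[<] 1, x ∈ Ioo (0 : ℝ) 1 := Ioo_mem_nhdsLT one_pos
  have hn : ∀ x ∈ Ioo (0 : ℝ) 1, ‖x‖ < 1 := fun x hx => by
    rw [Real.norm_eq_abs, abs_of_pos hx.1]; exact hx.2
  have hdiv : Tendsto (psum (fun _ => 1) : ℝ → ℝ) (𝓝[<] 1) atTop := by
    have h1 : Tendsto (fun x : ℝ => 1 - x) (𝓝[<] 1) (𝓝[>] 0) := by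
      refine tendsto_nhdsWithin_iff.2 ⟨?_, ?_⟩
      · have : Tendsto (fun x : ℝ => 1 - x) (𝓝 1) (𝓝 (1 - 1)) := by
          exact (continuous_const.sub continuous_id).tendsto _
        simpa using this.mono_left nhdsWithin_le_nhds
      · filter_upwards [hx0] with x hx using by simpa using hx.2
    refine (tendsto_inv_nhdsGT_zero.comp h1).congr' ?_
    filter_upwards [hx0] with x hx using (psum_one_eq (hn x hx)).symm
  refine (tendsto_psum_div_psum (.const 1) (fun _ => zero_le_one) hdiv hb).congr' ?_
  filter_upwards [hx0] with x hx
  rw [psum_one_eq (hn x hx)]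
  simp only [one_mul, div_inv_eq_mul]
  ring

/-! ### The coefficients of the Frobenius solutions -/

/-- The coefficients `(a)ₙ (1 - a)ₙ / n!²` of the hypergeometric series, as a function of
`p = a (1 - a)`. -/
noncomputable def frobA (p : ℝ) : ℕ → ℝ
  | 0 => 1
  | n + 1 => (n * (n + 1) + p) / ((n : ℝ) + 1) ^ 2 * frobA p n

/-- The logarithmic derivative of the coefficients in the Frobenius method. -/
noncomputable def frobD (p : ℝ) (n : ℕ) : ℝ :=
  ∑ j ∈ Finset.range n, ((2 * j + 1) / (j * (j + 1) + p) - 2 / ((j : ℝ) + 1))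

/-- The coefficients of the regular part of the logarithmic solution. -/
noncomputable def frobG (p : ℝ) (n : ℕ) : ℝ := frobA p n * frobD p n

theorem frobA_zero (p : ℝ) : frobA p 0 = 1 := rfl
theorem frobD_zero (p : ℝ) : frobD p 0 = 0 := by simp [frobD]
theorem frobG_zero (p : ℝ) : frobG p 0 = 0 := by simp [frobG, frobD_zero]

theorem frobA_succ (p : ℝ) (n : ℕ) :
    ((n : ℝ) + 1) ^ 2 * frobA p (n + 1) = (n * (n + 1) + p) * frobA p n := by
  have : (n : ℝ) + 1 ≠ 0 := by positivity
  rw [frobA]; field_simp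

theorem frobD_succ (p : ℝ) (n : ℕ) :
    frobD p (n + 1) = frobD p n + ((2 * n + 1) / (n * (n + 1) + p) - 2 / ((n : ℝ) + 1)) := by
  rw [frobD, Finset.sum_range_succ, ← frobD]

section
variable {p : ℝ}

theorem frobA_pos (hp : 0 < p) (n : ℕ) : 0 < frobA p n := by
  induction n with
  | zero => exact one_pos
  | succ n ih => rw [frobA]; positivity

theorem frobA_le (hp : 0 < p) (hp' : p ≤ 1 / 4) (n : ℕ) : frobA p n ≤ 1 / ((n : ℝ) + 1) := by
  induction n with
  | zero => simp [frobA]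
  | succ n ih =>
    have hn : (0 : ℝ) ≤ n := n.cast_nonneg
    rw [frobA]
    calc _ ≤ (n * (n + 1) + p) / ((n : ℝ) + 1) ^ 2 * (1 / ((n : ℝ) + 1)) := by gcongr
      _ ≤ _ := by
        push_cast
        rw [div_mul_div_comm, div_le_div_iff₀ (by positivity) (by positivity)]
        nlinarith [mul_nonneg hn hn, mul_nonneg hn hp.le, mul_nonneg hn (sub_nonneg.2 hp')]

theorem abs_frobA_le_one (hp : 0 < p) (hp' : p ≤ 1 / 4) (n : ℕ) : |frobA p n| ≤ 1 := by
  rw [abs_of_pos (frobA_pos hp n)]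
  refine (frobA_le hp hp' n).trans ?_
  rw [div_le_one (by positivity)]
  linarith [n.cast_nonneg (α := ℝ)]

theorem polyBdd_frobA (hp : 0 < p) (hp' : p ≤ 1 / 4) : PolyBdd (frobA p) :=
  .of_le 1 (abs_frobA_le_one hp hp')

theorem frobD_step_eq (hp : 0 < p) (n : ℕ) :
    (2 * n + 1) / (n * (n + 1) + p) - 2 / ((n : ℝ) + 1)
      = ((n : ℝ) + 1 - 2 * p) / ((n + 1) * (n * (n + 1) + p)) := by
  have : (n : ℝ) * (n + 1) + p ≠ 0 := by positivity
  have : (n : ℝ) + 1 ≠ 0 := by positivity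
  field_simp
  ring

theorem frobD_mono (hp : 0 < p) (hp' : p ≤ 1 / 4) : Monotone (frobD p) := by
  refine monotone_nat_of_le_succ fun n => ?_
  rw [frobD_succ, frobD_step_eq hp]
  have : 0 ≤ ((n : ℝ) + 1 - 2 * p) / ((n + 1) * (n * (n + 1) + p)) :=
    div_nonneg (by linarith [n.cast_nonneg (α := ℝ)]) (by positivity)
  linarith

/-- Each increment of Dₙ is at most 1 / (n + 1) - 1 / (n + 2). Together with monotonicity this traps
the limit and gives the rate |Dₙ - l| ≤ 1 / n, on which the convergence of the Mellin series rests.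
-/
theorem frobD_add_inv_anti (hp : 0 < p) : Antitone fun n : ℕ => frobD p (n + 1) + 1 / ((n : ℝ) + 1) := by
  refine antitone_nat_of_succ_le fun n => ?_
  rw [frobD_succ p (n + 1), frobD_step_eq hp]
  push_cast
  have hn : (0 : ℝ) ≤ n := n.cast_nonneg
  have : ((n : ℝ) + 1 + 1 - 2 * p) / ((n + 1 + 1) * ((n + 1) * (n + 1 + 1) + p))
      ≤ 1 / (n + 1) - 1 / (n + 1 + 1) := by
    rw [div_sub_div _ _ (by positivity) (by positivity), div_le_div_iff₀ (by positivity) (by positivity)]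
    nlinarith [mul_nonneg hn hn, mul_nonneg hn hp.le, mul_nonneg (mul_nonneg hn hn) hp.le,
      mul_nonneg (mul_nonneg (mul_nonneg hn hn) hn) hp.le]
  linarith

theorem frobD_le {l : ℝ} (hp : 0 < p) (hp' : p ≤ 1 / 4) (hl : Tendsto (frobD p) atTop (𝓝 l))
    (n : ℕ) : frobD p n ≤ l := (frobD_mono hp hp').ge_of_tendsto hl n

theorem le_frobD_add {l : ℝ} (hp : 0 < p) (hl : Tendsto (frobD p) atTop (𝓝 l)) (n : ℕ) :
    l ≤ frobD p (n + 1) + 1 / ((n : ℝ) + 1) := by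
  refine (frobD_add_inv_anti hp).le_of_tendsto ?_ n
  simpa using (hl.comp (tendsto_add_atTop_nat 1)).add tendsto_one_div_add_atTop_nhds_zero_nat

theorem abs_frobD_sub_le {l : ℝ} (hp : 0 < p) (hp' : p ≤ 1 / 4)
    (hl : Tendsto (frobD p) atTop (𝓝 l)) (n : ℕ) :
    |frobD p (n + 1) - l| ≤ 1 / ((n : ℝ) + 1) := by
  rw [abs_of_nonpos (by linarith [frobD_le hp hp' hl (n + 1)])]
  linarith [le_frobD_add hp hl n]

theorem polyBdd_frobD (hp : 0 < p) (hp' : p ≤ 1 / 4) : PolyBdd (frobD p) := by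
  refine .of_le (frobD p 1 + 1) fun n => ?_
  rw [abs_of_nonneg (by simpa [frobD_zero] using frobD_mono hp hp' n.zero_le)]
  cases n with
  | zero =>
    have := frobD_mono hp hp' (Nat.zero_le 1)
    linarith
  | succ n =>
    have h := frobD_add_inv_anti hp n.zero_le
    have : (0 : ℝ) ≤ 1 / ((n : ℝ) + 1) := by positivity
    simp only [Nat.cast_zero, zero_add, div_one] at h
    linarith

theorem polyBdd_frobG (hp : 0 < p) (hp' : p ≤ 1 / 4) : PolyBdd (frobG p) :=
  (polyBdd_frobA hp hp').mul (polyBdd_frobD hp hp')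

/-- The ρ-derivative at ρ = 0 of (n + 1 + ρ)² Aₙ₊₁(ρ) = ((n + ρ)(n + ρ + 1) + p) Aₙ(ρ), where Gₙ =
Aₙ Dₙ is the derivative of Aₙ(ρ). -/
theorem frobG_recurrence (hp : 0 < p) (n : ℕ) :
    ((n : ℝ) + 1) ^ 2 * frobG p (n + 1) = (n * (n + 1) + p) * frobG p n
      + (2 * n + 1) * frobA p n - 2 * (n + 1) * frobA p (n + 1) := by
  have h := frobA_succ p n
  have h1 : (n : ℝ) * (n + 1) + p ≠ 0 := by positivity
  have h2 : (n : ℝ) + 1 ≠ 0 := by positivity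
  have e : frobA p (n + 1) = (n * (n + 1) + p) * frobA p n / ((n : ℝ) + 1) ^ 2 := by
    rw [← h]; field_simp
  rw [frobG, frobG, frobD_succ, e]
  field_simp
  ring

end

/-- Pairing the Pochhammer factors with a shift of one gives (a + j + 1)(1 - a + j) = (j + 1)² - a²,
so the coefficients are partial products of Euler's formula for the sine. -/
theorem frobA_eq_prod (a : ℝ) (n : ℕ) :
    frobA (a * (1 - a)) (n + 1) * ((n : ℝ) + 1) ^ 2
      = a * ((n : ℝ) + 1 - a) * ∏ j ∈ Finset.range n, (1 - a ^ 2 / ((j : ℝ) + 1) ^ 2) := by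
  induction n with
  | zero => simp [frobA]
  | succ n ih =>
    have h := frobA_succ (a * (1 - a)) (n + 1)
    have h1 : (n : ℝ) + 1 ≠ 0 := by positivity
    rw [Finset.prod_range_succ]
    push_cast at h ⊢
    rw [mul_comm, h]
    have e : frobA (a * (1 - a)) (n + 1) = a * ((n : ℝ) + 1 - a) *
        (∏ j ∈ Finset.range n, (1 - a ^ 2 / ((j : ℝ) + 1) ^ 2)) / ((n : ℝ) + 1) ^ 2 := by
      rw [← ih]; field_simp
    rw [e]
    field_simp
    ring

/-- No restriction on a is imposed: the reflection formula needs this limit at a + s and a - s,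
which may leave (0, 1). -/
theorem tendsto_nat_mul_frobA (a : ℝ) :
    Tendsto (fun n : ℕ => (n : ℝ) * frobA (a * (1 - a)) n) atTop
      (𝓝 (Real.sin (Real.pi * a) / Real.pi)) := by
  rw [← tendsto_add_atTop_iff_nat 1]
  have h1 := (Real.tendsto_euler_sin_prod a).div_const Real.pi
  have h2 : Tendsto (fun n : ℕ => 1 - a * (1 / ((n : ℝ) + 1))) atTop (𝓝 (1 - a * 0)) :=
    tendsto_const_nhds.sub (tendsto_one_div_add_atTop_nhds_zero_nat.const_mul a)
  have h3 := h2.mul h1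
  simp only [mul_zero, sub_zero, one_mul] at h3
  refine h3.congr fun n => ?_
  have h4 := frobA_eq_prod a n
  have h5 : (n : ℝ) + 1 ≠ 0 := by positivity
  have hpi := Real.pi_ne_zero
  have e : frobA (a * (1 - a)) (n + 1) = a * ((n : ℝ) + 1 - a) *
      (∏ j ∈ Finset.range n, (1 - a ^ 2 / ((j : ℝ) + 1) ^ 2)) / ((n : ℝ) + 1) ^ 2 := by
    rw [← h4]; field_simp
  rw [e]
  push_cast
  field_simp

/-! ### The hypergeometric equation as a first order system on `(0, 1)` -/

theorem norm_lt_one_of_mem {x : ℝ} (hx : x ∈ Ioo (0 : ℝ) 1) : ‖x‖ < 1 := by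
  rw [Real.norm_eq_abs, abs_of_pos hx.1]; exact hx.2

theorem one_sub_mem {x : ℝ} (hx : x ∈ Ioo (0 : ℝ) 1) : 1 - x ∈ Ioo (0 : ℝ) 1 :=
  ⟨sub_pos.2 hx.2, by linarith [hx.1]⟩

theorem tendsto_one_sub_zero : Tendsto (fun x : ℝ => 1 - x) (𝓝[>] 0) (𝓝[<] 1) := by
  refine tendsto_nhdsWithin_iff.2 ⟨?_, ?_⟩
  · have : Tendsto (fun x : ℝ => 1 - x) (𝓝 0) (𝓝 (1 - 0)) :=
      (continuous_const.sub continuous_id).tendsto _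
    simpa using this.mono_left nhdsWithin_le_nhds
  · filter_upwards [self_mem_nhdsWithin] with x hx
    simpa using hx

theorem tendsto_one_sub_one : Tendsto (fun x : ℝ => 1 - x) (𝓝[<] 1) (𝓝[>] 0) := by
  refine tendsto_nhdsWithin_iff.2 ⟨?_, ?_⟩
  · have : Tendsto (fun x : ℝ => 1 - x) (𝓝 1) (𝓝 (1 - 1)) :=
      (continuous_const.sub continuous_id).tendsto _
    simpa using this.mono_left nhdsWithin_le_nhds
  · filter_upwards [self_mem_nhdsWithin] with x hx
    simpa using hx

section
variable {E : Type*} [NormedAddCommGroup E] [NormedSpace ℝ E]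

theorem exists_const_of_hasDerivAt_zero {h : ℝ → E}
    (hh : ∀ x ∈ Ioo (0 : ℝ) 1, HasDerivAt h 0 x) : ∃ c, ∀ x ∈ Ioo (0 : ℝ) 1, h x = c :=
  ⟨h (1 / 2), fun _ hx => isOpen_Ioo.is_const_of_deriv_eq_zero isPreconnected_Ioo
    (fun y hy => (hh y hy).differentiableAt.differentiableWithinAt)
    (fun y hy => (hh y hy).deriv) hx (by norm_num)⟩

/-- `w` solves `(x (1 - x) w')' = p w` on `(0, 1)` and `q = x (1 - x) w'`. -/
structure IsSol (p : ℝ) (w q : ℝ → E) : Prop where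
  deriv_w : ∀ x ∈ Ioo (0 : ℝ) 1, HasDerivAt w ((x * (1 - x))⁻¹ • q x) x
  deriv_q : ∀ x ∈ Ioo (0 : ℝ) 1, HasDerivAt q (p • w x) x

variable {p : ℝ} {w q w' q' : ℝ → E}

theorem IsSol.add (h : IsSol p w q) (h' : IsSol p w' q') :
    IsSol p (fun x => w x + w' x) (fun x => q x + q' x) :=
  ⟨fun x hx => ((h.deriv_w x hx).add (h'.deriv_w x hx)).congr_deriv (smul_add _ _ _).symm,
   fun x hx => ((h.deriv_q x hx).add (h'.deriv_q x hx)).congr_deriv (smul_add _ _ _).symm⟩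

theorem IsSol.const_smul {R : Type*} [NormedField R] [NormedAlgebra ℝ R] [NormedSpace R E]
    [IsScalarTower ℝ R E] (r : R) (h : IsSol p w q) :
    IsSol p (fun x => r • w x) (fun x => r • q x) :=
  ⟨fun x hx => by
      have := (h.deriv_w x hx).const_smul r
      rwa [smul_comm] at this,
   fun x hx => by
      have := (h.deriv_q x hx).const_smul r
      rwa [smul_comm] at this⟩

theorem IsSol.sub (h : IsSol p w q) (h' : IsSol p w' q') :
    IsSol p (fun x => w x - w' x) (fun x => q x - q' x) :=
  ⟨fun x hx => ((h.deriv_w x hx).sub (h'.deriv_w x hx)).congr_deriv (smul_sub _ _ _).symm,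
   fun x hx => ((h.deriv_q x hx).sub (h'.deriv_q x hx)).congr_deriv (smul_sub _ _ _).symm⟩

/-- The factor x (1 - x) is symmetric, so the equation is; q changes sign because it contains one
derivative. This makes the conifold point a copy of 0. -/
theorem IsSol.reflect (h : IsSol p w q) : IsSol p (fun x => w (1 - x)) (fun x => -q (1 - x)) := by
  have hd : ∀ x : ℝ, HasDerivAt (fun x : ℝ => 1 - x) (-1) x := fun x => by
    simpa using (hasDerivAt_id x).const_sub 1
  refine ⟨fun x hx => ?_, fun x hx => ?_⟩
  · have := (h.deriv_w _ (one_sub_mem hx)).scomp x (hd x)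
    refine this.congr_deriv ?_
    rw [sub_sub_cancel, mul_comm (1 - x)]
    simp
  · have := ((h.deriv_q _ (one_sub_mem hx)).scomp x (hd x)).neg
    refine this.congr_deriv ?_
    simp

theorem IsSol.ofReal {w q : ℝ → ℝ} (h : IsSol p w q) :
    IsSol p (fun x => (w x : ℂ)) (fun x => (q x : ℂ)) :=
  ⟨fun x hx => (h.deriv_w x hx).ofReal_comp.congr_deriv (by simp),
   fun x hx => (h.deriv_q x hx).ofReal_comp.congr_deriv (by simp)⟩

/-- In self-adjoint form the Wronskian needs no integrating factor: the p f w terms cancel, and so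
do the terms in k and q. -/
theorem IsSol.wronskian_const {f k : ℝ → ℝ} (hf : IsSol p f k) (hw : IsSol p w q) :
    ∃ C, ∀ x ∈ Ioo (0 : ℝ) 1, f x • q x - k x • w x = C := by
  refine exists_const_of_hasDerivAt_zero fun x hx => ?_
  have := ((hf.deriv_w x hx).smul (hw.deriv_q x hx)).sub ((hf.deriv_q x hx).smul (hw.deriv_w x hx))
  refine this.congr_deriv ?_
  simp only [smul_eq_mul]
  module

/-- The derivative of w / f is the Wronskian divided by x (1 - x) f². -/
theorem IsSol.eq_smul_of_wronskian {f k : ℝ → ℝ} (hf : IsSol p f k) (hw : IsSol p w q)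
    (hpos : ∀ x ∈ Ioo (0 : ℝ) 1, 0 < f x)
    (h0 : ∀ x ∈ Ioo (0 : ℝ) 1, f x • q x - k x • w x = 0) :
    ∃ c : E, ∀ x ∈ Ioo (0 : ℝ) 1, w x = f x • c := by
  obtain ⟨c, hc⟩ : ∃ c, ∀ x ∈ Ioo (0 : ℝ) 1, (f x)⁻¹ • w x = c := by
    refine exists_const_of_hasDerivAt_zero fun x hx => ?_
    have hne := (hpos x hx).ne'
    have := ((hf.deriv_w x hx).inv hne).smul (hw.deriv_w x hx)
    refine this.congr_deriv ?_
    have e := congrArg (fun v => ((x * (1 - x))⁻¹ * (f x ^ 2)⁻¹) • v) (h0 x hx)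
    simp only [smul_zero, smul_sub, smul_smul] at e
    rw [smul_smul, ← e]
    have e1 : (f x)⁻¹ * (x * (1 - x))⁻¹ = (x * (1 - x))⁻¹ * (f x ^ 2)⁻¹ * f x := by
      field_simp
    have e2 : -((x * (1 - x))⁻¹ • k x) / f x ^ 2 = -((x * (1 - x))⁻¹ * (f x ^ 2)⁻¹ * k x) := by
      rw [smul_eq_mul, div_eq_mul_inv]; ring
    simp only [Pi.inv_apply, e1, e2, neg_smul]
    abel
  refine ⟨c, fun x hx => ?_⟩
  rw [← hc x hx, smul_smul, mul_inv_cancel₀ (hpos x hx).ne', one_smul]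

end

/-! ### The Frobenius solutions at `0` and the connection formula -/

/-- The holomorphic Frobenius solution on `(0, 1)`. -/
noncomputable def solF (p x : ℝ) : ℝ := psum (frobA p) x

/-- `x (1 - x)` times the derivative of `solF`. -/
noncomputable def solF' (p x : ℝ) : ℝ := (1 - x) * psum (fun n => n * frobA p n) x

/-- The logarithmic Frobenius solution on `(0, 1)`. -/
noncomputable def solU (p x : ℝ) : ℝ := Real.log x * psum (frobA p) x + psum (frobG p) x

/-- `x (1 - x)` times the derivative of `solU`. -/
noncomputable def solU' (p x : ℝ) : ℝ :=
  (1 - x) * (psum (frobA p) x + Real.log x * psum (fun n => n * frobA p n) x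
    + psum (fun n => n * frobG p n) x)

section
variable {p : ℝ}

theorem PolyBdd.shift {c : ℕ → ℝ} (hc : PolyBdd c) : PolyBdd (shift c) := by
  obtain ⟨C, k, hC⟩ := hc
  have hC0 : 0 ≤ C := by simpa using (abs_nonneg _).trans (hC 0)
  refine ⟨C, k, fun n => ?_⟩
  cases n with
  | zero => simpa [LocalCY.shift] using hC0
  | succ n =>
    refine (hC n).trans ?_
    gcongr
    simp

theorem psum_frobA_ode (hp : 0 < p) (hp' : p ≤ 1 / 4) {x : ℝ} (hx : ‖x‖ < 1) :
    psum (fun n => n * (n * frobA p n)) x = x * (psum (fun n => n * (n * frobA p n)) x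
      + psum (fun n => n * frobA p n) x + p * psum (frobA p) x) := by
  have hA := polyBdd_frobA hp hp'
  rw [← smul_eq_mul (a := p), ← psum_const_mul, ← psum_add hA.nat_mul.nat_mul hA.nat_mul hx,
    ← psum_add (hA.nat_mul.nat_mul.add hA.nat_mul) (hA.const_mul p) hx,
    ← psum_shift ((hA.nat_mul.nat_mul.add hA.nat_mul).add (hA.const_mul p)) hx]
  congr 1
  funext n
  cases n with
  | zero => simp [shift]
  | succ n =>
    have := frobA_succ p n
    simp only [shift]; push_cast
    linear_combination this

theorem psum_frobG_ode (hp : 0 < p) (hp' : p ≤ 1 / 4) {x : ℝ} (hx : ‖x‖ < 1) :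
    psum (fun n => n * (n * frobG p n)) x = x * (psum (fun n => n * (n * frobG p n)) x
      + psum (fun n => n * frobG p n) x + p * psum (frobG p) x
      + (2 * psum (fun n => n * frobA p n) x + psum (frobA p) x))
      - 2 * psum (fun n => n * frobA p n) x := by
  have hA := polyBdd_frobA hp hp'
  have hG := polyBdd_frobG hp hp'
  have h1 := (hG.nat_mul.nat_mul.add hG.nat_mul).add (hG.const_mul p)
  have h2 := (hA.nat_mul.const_mul 2).add hA
  rw [← smul_eq_mul (a := p), ← psum_const_mul, ← psum_add hG.nat_mul.nat_mul hG.nat_mul hx,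
    ← psum_add (hG.nat_mul.nat_mul.add hG.nat_mul) (hG.const_mul p) hx,
    ← smul_eq_mul (a := (2 : ℝ)), ← psum_const_mul, ← psum_add (hA.nat_mul.const_mul 2) hA hx,
    ← psum_add h1 h2 hx, ← psum_shift (h1.add h2) hx,
    ← psum_sub (h1.add h2).shift (hA.nat_mul.const_mul 2) hx]
  congr 1
  funext n
  cases n with
  | zero => simp [shift]
  | succ n =>
    have := frobG_recurrence hp n
    simp only [shift]; push_cast
    linear_combination this

theorem isSol_solF (hp : 0 < p) (hp' : p ≤ 1 / 4) : IsSol p (solF p) (solF' p) := by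
  have hA := polyBdd_frobA hp hp'
  refine ⟨fun x hx => ?_, fun x hx => ?_⟩
  · refine (hasDerivAt_psum' hA (norm_lt_one_of_mem hx) hx.1.ne').congr_deriv ?_
    have := hx.1.ne'
    have := (one_sub_mem hx).1.ne'
    simp only [solF', smul_eq_mul]; field_simp
  · have h1 := hasDerivAt_psum' hA.nat_mul (norm_lt_one_of_mem hx) hx.1.ne'
    have h2 := ((hasDerivAt_id x).const_sub 1).mul h1
    refine h2.congr_deriv ?_
    have e := psum_frobA_ode hp hp' (norm_lt_one_of_mem hx)
    have := hx.1.ne'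
    simp only [solF, smul_eq_mul, id]
    generalize psum (fun n => n * (n * frobA p n)) x = X at *
    field_simp
    linear_combination e

theorem isSol_solU (hp : 0 < p) (hp' : p ≤ 1 / 4) : IsSol p (solU p) (solU' p) := by
  have hA := polyBdd_frobA hp hp'
  have hG := polyBdd_frobG hp hp'
  refine ⟨fun x hx => ?_, fun x hx => ?_⟩
  · have h0 := hx.1.ne'
    have h1 := (one_sub_mem hx).1.ne'
    have hn := norm_lt_one_of_mem hx
    have h := ((Real.hasDerivAt_log h0).mul (hasDerivAt_psum' hA hn h0)).add (hasDerivAt_psum' hG hn h0)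
    refine h.congr_deriv ?_
    simp only [solU', smul_eq_mul]; field_simp
  · have h0 := hx.1.ne'
    have hn := norm_lt_one_of_mem hx
    have h := ((hasDerivAt_id x).const_sub 1).mul (((hasDerivAt_psum' hA hn h0).add
      ((Real.hasDerivAt_log h0).mul (hasDerivAt_psum' hA.nat_mul hn h0))).add
      (hasDerivAt_psum' hG.nat_mul hn h0))
    refine h.congr_deriv ?_
    simp only [solU, smul_eq_mul, id, Pi.add_apply, Pi.mul_apply]
    have e1 := psum_frobA_ode hp hp' hn
    have e2 := psum_frobG_ode hp hp' hn
    generalize psum (fun n => n * (n * frobA p n)) x = X at *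
    generalize psum (fun n => n * (n * frobG p n)) x = Y at *
    field_simp
    linear_combination Real.log x * e1 + e2

theorem solF_pos (hp : 0 < p) (hp' : p ≤ 1 / 4) {x : ℝ} (hx : x ∈ Ioo (0 : ℝ) 1) :
    0 < solF p x := by
  have h := (polyBdd_frobA hp hp').hasSum (norm_lt_one_of_mem hx)
  have h1 : frobA p 0 • x ^ 0 ≤ solF p x := le_hasSum h 0 fun n _ =>
    smul_nonneg (frobA_pos hp n).le (pow_nonneg hx.1.le n)
  simp only [frobA_zero, pow_zero, smul_eq_mul, mul_one] at h1
  linarith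

theorem tendsto_psum_zero {c : ℕ → ℝ} (hc : PolyBdd c) :
    Tendsto (psum c : ℝ → ℝ) (𝓝[>] 0) (𝓝 (c 0)) := by
  have := (continuousAt_psum hc (z := (0 : ℝ)) (by simp)).tendsto.mono_left
    (nhdsWithin_le_nhds (s := Ioi 0))
  simpa [psum_zero] using this

theorem tendsto_log_mul_psum_zero {c : ℕ → ℝ} (hc : PolyBdd c) (h0 : c 0 = 0) :
    Tendsto (fun x : ℝ => Real.log x * psum c x) (𝓝[>] 0) (𝓝 0) := by
  have e : c = shift (fun n => c (n + 1)) := by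
    funext n; cases n <;> simp [shift, h0]
  have h1 := tendsto_log_mul_rpow_nhdsGT_zero one_pos
  have h2 := h1.mul (tendsto_psum_zero hc.succ)
  rw [zero_mul] at h2
  refine h2.congr' ?_
  filter_upwards [Ioo_mem_nhdsGT one_pos] with x hx
  conv_rhs => rw [e, psum_shift hc.succ (norm_lt_one_of_mem hx)]
  rw [Real.rpow_one]; ring

theorem tendsto_solF_zero (hp : 0 < p) (hp' : p ≤ 1 / 4) :
    Tendsto (solF p) (𝓝[>] 0) (𝓝 1) := tendsto_psum_zero (polyBdd_frobA hp hp')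

theorem tendsto_one_sub : Tendsto (fun x : ℝ => 1 - x) (𝓝[>] 0) (𝓝 1) :=
  tendsto_one_sub_zero.mono_right nhdsWithin_le_nhds

theorem tendsto_solF'_zero (hp : 0 < p) (hp' : p ≤ 1 / 4) :
    Tendsto (solF' p) (𝓝[>] 0) (𝓝 0) := by
  have h := tendsto_one_sub.mul (tendsto_psum_zero (polyBdd_frobA hp hp').nat_mul)
  simp only [Nat.cast_zero, zero_mul, mul_zero] at h
  exact h

theorem tendsto_solU'_zero (hp : 0 < p) (hp' : p ≤ 1 / 4) :
    Tendsto (solU' p) (𝓝[>] 0) (𝓝 1) := by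
  have hA := polyBdd_frobA hp hp'
  have hG := polyBdd_frobG hp hp'
  have h := tendsto_one_sub.mul (((tendsto_psum_zero hA).add
    (tendsto_log_mul_psum_zero hA.nat_mul (by simp))).add (tendsto_psum_zero hG.nat_mul))
  simp only [Nat.cast_zero, zero_mul, add_zero, frobA_zero, one_mul] at h
  exact h

/-- A solution that vanishes at `0` together with its derivative along `θ` is zero. -/
theorem IsSol.eq_zero {w q : ℝ → ℂ} (hp : 0 < p) (hp' : p ≤ 1 / 4) (h : IsSol p w q)
    (hw : Tendsto w (𝓝[>] 0) (𝓝 0)) (hq : Tendsto q (𝓝[>] 0) (𝓝 0)) :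
    ∀ x ∈ Ioo (0 : ℝ) 1, w x = 0 := by
  have hF := isSol_solF hp hp'
  have hmem : ∀ᶠ x : ℝ in 𝓝[>] 0, x ∈ Ioo (0 : ℝ) 1 := Ioo_mem_nhdsGT one_pos
  obtain ⟨C, hC⟩ := hF.wronskian_const h
  have hC0 : C = 0 := by
    have h1 := ((tendsto_solF_zero hp hp').smul hq).sub ((tendsto_solF'_zero hp hp').smul hw)
    simp only [smul_zero, sub_zero] at h1
    refine tendsto_nhds_unique (tendsto_const_nhds.congr' ?_) h1
    filter_upwards [hmem] with x hx using (hC x hx).symm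
  subst hC0
  obtain ⟨c, hc⟩ := hF.eq_smul_of_wronskian h (fun x hx => solF_pos hp hp' hx) hC
  have hc0 : c = 0 := by
    have h1 := (tendsto_solF_zero hp hp').smul_const c
    rw [one_smul] at h1
    refine tendsto_nhds_unique (h1.congr' ?_) hw
    filter_upwards [hmem] with x hx using (hc x hx).symm
  intro x hx
  rw [hc x hx, hc0, smul_zero]

theorem not_summable_frobA {C : ℝ} (hC : 0 < C)
    (hA : Tendsto (fun n : ℕ => (n : ℝ) * frobA p n) atTop (𝓝 C)) : ¬ Summable (frobA p) := by
  intro hs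
  obtain ⟨N, hN⟩ := eventually_atTop.1 (hA.eventually (eventually_ge_nhds (half_lt_self hC)))
  have h2 : Summable fun n : ℕ => C / 2 * (1 / ((n + (N + 1) : ℕ) : ℝ)) := by
    refine Summable.of_nonneg_of_le (fun n => by positivity) (fun n => ?_)
      ((summable_nat_add_iff (N + 1)).2 hs)
    have h1 := hN (n + (N + 1)) (by omega)
    have : (0 : ℝ) < ((n + (N + 1) : ℕ) : ℝ) := by positivity
    rw [mul_one_div, div_le_iff₀ this]
    linarith
  exact Real.not_summable_one_div_natCast ((summable_nat_add_iff (N + 1)).1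
    ((summable_mul_left_iff (half_pos hC).ne').1 h2))

theorem tendsto_solF_one {C : ℝ} (hp : 0 < p) (hp' : p ≤ 1 / 4) (hC : 0 < C)
    (hA : Tendsto (fun n : ℕ => (n : ℝ) * frobA p n) atTop (𝓝 C)) :
    Tendsto (solF p) (𝓝[<] 1) atTop := by
  have hpos := fun n => (frobA_pos hp n).le
  have h1 := (not_summable_iff_tendsto_nat_atTop_of_nonneg hpos).1 (not_summable_frobA hC hA)
  refine tendsto_atTop.2 fun M => ?_
  obtain ⟨N, hN⟩ := (h1.eventually_gt_atTop M).exists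
  have h2 : Continuous fun x : ℝ => ∑ n ∈ Finset.range N, frobA p n • x ^ n := by fun_prop
  have h3 : ∀ᶠ x : ℝ in 𝓝[<] 1, M < ∑ n ∈ Finset.range N, frobA p n • x ^ n :=
    nhdsWithin_le_nhds ((h2.tendsto 1).eventually (eventually_gt_nhds (by simpa using hN)))
  have hmem : ∀ᶠ x : ℝ in 𝓝[<] 1, x ∈ Ioo (0 : ℝ) 1 := Ioo_mem_nhdsLT one_pos
  filter_upwards [h3, hmem] with x hx hx'
  refine hx.le.trans (sum_le_hasSum _ (fun n _ => ?_)
    ((polyBdd_frobA hp hp').hasSum (norm_lt_one_of_mem hx')))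
  exact mul_nonneg (hpos n) (pow_nonneg hx'.1.le n)

/-- The connection formula between the points `0` and `1`. -/
theorem solF_one_sub {C l : ℝ} (hp : 0 < p) (hp' : p ≤ 1 / 4) (hC : 0 < C)
    (hA : Tendsto (fun n : ℕ => (n : ℝ) * frobA p n) atTop (𝓝 C))
    (hl : Tendsto (frobD p) atTop (𝓝 l)) {x : ℝ} (hx : x ∈ Ioo (0 : ℝ) 1) :
    solF p (1 - x) = C * (l * solF p x - solU p x) := by
  have hAb := polyBdd_frobA hp hp'
  have hGb := polyBdd_frobG hp hp'
  have hF := isSol_solF hp hp'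
  have hU := isSol_solU hp hp'
  have hmem : ∀ᶠ x : ℝ in 𝓝[>] 0, x ∈ Ioo (0 : ℝ) 1 := Ioo_mem_nhdsGT one_pos
  have hmem1 : ∀ᶠ x : ℝ in 𝓝[<] 1, x ∈ Ioo (0 : ℝ) 1 := Ioo_mem_nhdsLT one_pos
  -- At x = 0 the function F(1 - x) behaves like -C log x, so adding C U should leave a multiple of
  -- F. This is proved by showing that its Wronskian with F is zero.
  have hV := hF.reflect.add (hU.const_smul C)
  obtain ⟨W, hW⟩ := hF.wronskian_const hV
  have hA0 : Tendsto (frobA p) atTop (𝓝 0) :=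
    squeeze_zero (fun n => (frobA_pos hp n).le) (frobA_le hp hp')
      tendsto_one_div_add_atTop_nhds_zero_nat
  -- The product θF(x) · F(1 - x) carries a factor x, which beats the growth of F(1 - x) because Aₙ
  -- → 0.
  have hzF : Tendsto (fun x : ℝ => x * solF p (1 - x)) (𝓝[>] 0) (𝓝 0) := by
    refine ((tendsto_one_sub_mul_psum hA0).comp tendsto_one_sub_zero).congr fun x => ?_
    simp [solF]
  have hzF' : Tendsto (fun x : ℝ => solF' p (1 - x)) (𝓝[>] 0) (𝓝 C) :=
    (tendsto_one_sub_mul_psum hA).comp tendsto_one_sub_zero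
  have hnA : ∀ᶠ x : ℝ in 𝓝[>] 0, solF' p x
      = x * ((1 - x) * psum (fun n : ℕ => ((n : ℝ) + 1) * frobA p (n + 1)) x) := by
    filter_upwards [hmem] with x hx
    rw [solF', ← mul_psum_deriv hAb (norm_lt_one_of_mem hx)]; ring
  have hb : PolyBdd fun n : ℕ => ((n : ℝ) + 1) * frobA p (n + 1) := by
    simpa using hAb.nat_mul.succ
  have hk1 : Tendsto (fun x => solF' p x * solF p (1 - x)) (𝓝[>] 0) (𝓝 0) := by
    have := (tendsto_one_sub.mul (tendsto_psum_zero hb)).mul hzF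
    rw [mul_zero] at this
    refine this.congr' ?_
    filter_upwards [hnA] with x hx
    rw [hx]; ring
  have hk2 : Tendsto (fun x => solF' p x * solU p x) (𝓝[>] 0) (𝓝 0) := by
    have h1 := tendsto_one_sub.mul ((tendsto_log_mul_psum_zero hAb.nat_mul (by simp)).mul
      (tendsto_solF_zero hp hp'))
    have h2 := (tendsto_solF'_zero hp hp').mul (tendsto_psum_zero hGb)
    have h3 := h1.add h2
    simp only [zero_mul, mul_zero, add_zero] at h3
    refine h3.congr fun x => ?_
    simp only [solF', solU, solF]; ring
  -- The Wronskian tends to -C + C at 0: the first term from n Aₙ → C applied to the reflected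
  -- solution, the second from θU → 1.
  have hW0 : W = 0 := by
    have h1 := ((tendsto_solF_zero hp hp').mul
      (hzF'.neg.add ((tendsto_solU'_zero hp hp').const_mul C))).sub
      (hk1.add (hk2.const_mul C))
    have h2 : (1 : ℝ) * (-C + C * 1) - (0 + C * 0) = 0 := by ring
    rw [h2] at h1
    refine tendsto_nhds_unique (tendsto_const_nhds.congr' ?_) h1
    filter_upwards [hmem] with x hx
    rw [← hW x hx]
    simp only [smul_eq_mul]; ring
  subst hW0
  obtain ⟨c, hc⟩ := hF.eq_smul_of_wronskian hV (fun x hx => solF_pos hp hp' hx) hW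
  -- Divide by F and let x → 1. As F diverges, F(1 - x) / F tends to 0, while the regular part of U
  -- divided by F is the Aₙ xⁿ-weighted average of Dₙ, hence tends to l.
  have hcl : c = C * l := by
    have hFt := tendsto_solF_one hp hp' hC hA
    have h1 : Tendsto (fun x => solF p (1 - x) / solF p x) (𝓝[<] 1) (𝓝 0) :=
      ((tendsto_solF_zero hp hp').comp tendsto_one_sub_one).div_atTop hFt
    have h2 := tendsto_psum_div_psum hAb (fun n => (frobA_pos hp n).le) hFt hl
    have h3 : Tendsto Real.log (𝓝[<] 1) (𝓝 0) := by
      have := (Real.continuousAt_log one_ne_zero).tendsto.mono_left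
        (nhdsWithin_le_nhds (s := Iio 1))
      simpa using this
    have h4 := h1.add ((h3.add h2).const_mul C)
    rw [zero_add, zero_add] at h4
    refine tendsto_nhds_unique (tendsto_const_nhds.congr' ?_) h4
    filter_upwards [hmem1] with x hx
    have hne := (solF_pos hp hp' hx).ne'
    have e := hc x hx
    have e2 : psum (fun n => frobA p n * frobD p n) x = psum (frobG p) x := rfl
    simp only [smul_eq_mul, solU] at e
    rw [e2, ← solF]
    rw [← solF] at e
    field_simp
    linear_combination -e
  have e := hc x hx
  rw [hcl] at e
  simp only [smul_eq_mul] at e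
  linear_combination e

end

/-! ### The regularised integral of the logarithmic solution -/

/-- The terms of the Mellin transform of the solution that is regular at `1`. -/
noncomputable def mellinTerm (p l s : ℝ) (n : ℕ) : ℝ :=
  frobA p n * ((frobD p n - l) / (n + s) - 1 / ((n : ℝ) + s) ^ 2)

/-- The Mellin transform without its polar part at `0`. -/
noncomputable def mellinReg (p l s : ℝ) : ℝ := ∑' n, mellinTerm p l s (n + 1)

/-- The entire normalisation of the Mellin transform. -/
noncomputable def mellinEntire (p l s : ℝ) : ℝ := 1 + l * s - s ^ 2 * mellinReg p l s

section
variable {p l : ℝ}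

/-- Both parts of the term are O(1 / n²), the first by the rate of convergence of Dₙ. The bound s ≥
-1/2 keeps n + 1 + s above (n + 1) / 2, so the estimate is uniform on both sides of s = 0. -/
theorem abs_mellinTerm_le (hp : 0 < p) (hp' : p ≤ 1 / 4) (hl : Tendsto (frobD p) atTop (𝓝 l))
    {s : ℝ} (hs : -(1 / 2) ≤ s) (n : ℕ) :
    |mellinTerm p l s (n + 1)| ≤ 6 * (1 / ((n : ℝ) + 1) ^ 2) := by
  have hn : (0 : ℝ) ≤ n := n.cast_nonneg
  have h1 : ((n : ℝ) + 1) / 2 ≤ n + 1 + s := by linarith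
  have h0 : (0 : ℝ) < n + 1 + s := by linarith
  rw [mellinTerm, abs_mul]
  push_cast
  calc _ ≤ 1 * |(frobD p (n + 1) - l) / ((n : ℝ) + 1 + s) - 1 / ((n : ℝ) + 1 + s) ^ 2| := by
        gcongr; exact abs_frobA_le_one hp hp' _
    _ ≤ |(frobD p (n + 1) - l) / ((n : ℝ) + 1 + s)| + |1 / ((n : ℝ) + 1 + s) ^ 2| := by
        rw [one_mul]; exact abs_sub _ _
    _ ≤ 1 / ((n : ℝ) + 1) / (((n : ℝ) + 1) / 2) + 1 / (((n : ℝ) + 1) / 2) ^ 2 := by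
        rw [abs_div, abs_of_pos h0, abs_of_pos (by positivity : 0 < 1 / ((n : ℝ) + 1 + s) ^ 2)]
        gcongr
        exact abs_frobD_sub_le hp hp' hl n
    _ = _ := by field_simp; ring

theorem summable_inv_sq_succ : Summable fun n : ℕ => 1 / ((n : ℝ) + 1) ^ 2 := by
  simpa using (summable_nat_add_iff 1).2 (Real.summable_one_div_nat_pow.2 one_lt_two)

theorem summable_mellinTerm (hp : 0 < p) (hp' : p ≤ 1 / 4) (hl : Tendsto (frobD p) atTop (𝓝 l))
    {s : ℝ} (hs : -(1 / 2) ≤ s) : Summable fun n => mellinTerm p l s (n + 1) :=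
  .of_norm_bounded (summable_inv_sq_succ.mul_left 6)
    fun n => by simpa using abs_mellinTerm_le hp hp' hl hs n

theorem tendsto_mellinReg_zero (hp : 0 < p) (hp' : p ≤ 1 / 4)
    (hl : Tendsto (frobD p) atTop (𝓝 l)) :
    Tendsto (mellinReg p l) (𝓝 0) (𝓝 (mellinReg p l 0)) := by
  refine tendsto_tsum_of_dominated_convergence (summable_inv_sq_succ.mul_left 6) (fun n => ?_) ?_
  · have : ((n + 1 : ℕ) : ℝ) + 0 ≠ 0 := by positivity
    have : ContinuousAt (fun s => mellinTerm p l s (n + 1)) 0 := by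
      unfold mellinTerm
      fun_prop (disch := first | assumption | positivity)
    exact this.tendsto
  · filter_upwards [Ioi_mem_nhds (show -(1 / 2 : ℝ) < 0 by norm_num)] with s hs n
    simpa using abs_mellinTerm_le hp hp' hl (le_of_lt hs) n

/-- The certificate that telescopes the functional equation of the Mellin transform. -/
noncomputable def mellinCert (p l s : ℝ) (n : ℕ) : ℝ :=
  frobA p n * ((2 * n + n ^ 2 * (frobD p n - l)) / (n + s) - (n : ℝ) ^ 2 / ((n : ℝ) + s) ^ 2)

/-- Termwise version of s² M(s) = (s² + s + p) M(s + 1), which is the differential equation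
integrated by parts against a power of x. The recurrences for Aₙ and Aₙ Dₙ rewrite the next
certificate in terms of the current coefficients; what remains is a rational identity. -/
theorem mellinTerm_telescope (hp : 0 < p) {s : ℝ} (hs : -(1 / 2) ≤ s) (n : ℕ) :
    s ^ 2 * mellinTerm p l s (n + 1) - (s ^ 2 + s + p) * mellinTerm p l (s + 1) (n + 1)
      = mellinCert p l s (n + 1) - mellinCert p l s (n + 2) := by
  have hn : (0 : ℝ) ≤ n := n.cast_nonneg
  have hA := frobA_succ p (n + 1)
  have hG := frobG_recurrence hp (n + 1)
  have h1 : (n : ℝ) + 1 + s ≠ 0 := by linarith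
  have h2 : (n : ℝ) + 1 + 1 + s ≠ 0 := by linarith
  have h2' : (n : ℝ) + 1 + (s + 1) ≠ 0 := by linarith
  have h2'' : (n : ℝ) + 2 + s ≠ 0 := by linarith
  simp only [frobG] at hG
  simp only [mellinTerm, mellinCert]
  push_cast at hA hG ⊢
  have e : frobA p (n + 2) * ((2 * ((n : ℝ) + 2) + ((n : ℝ) + 2) ^ 2 * (frobD p (n + 2) - l))
      / ((n : ℝ) + 2 + s) - ((n : ℝ) + 2) ^ 2 / ((n : ℝ) + 2 + s) ^ 2)
      = frobA p (n + 1) * (((((n : ℝ) + 1) * (n + 1 + 1) + p) * (frobD p (n + 1) - l)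
        + (2 * ((n : ℝ) + 1) + 1)) / (n + 2 + s)
        - ((n + 1) * (n + 1 + 1) + p) / (n + 2 + s) ^ 2) := by
    simp only [mul_sub, mul_div_assoc']
    rw [div_sub_div _ _ h2'' (pow_ne_zero 2 h2''), div_sub_div _ _ h2'' (pow_ne_zero 2 h2'')]
    congr 1
    linear_combination ((n : ℝ) + 2 + s) ^ 2 * (hG - l * hA) - (n + 2 + s) * hA
  rw [e]
  have e3 : (n : ℝ) + 1 + (s + 1) = n + 2 + s := by ring
  rw [e3]
  field_simp
  ring

theorem tendsto_mellinCert {C : ℝ} (hA : Tendsto (fun n : ℕ => (n : ℝ) * frobA p n) atTop (𝓝 C))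
    (hl : Tendsto (frobD p) atTop (𝓝 l)) (s : ℝ) :
    Tendsto (mellinCert p l s) atTop (𝓝 0) := by
  have h1 : Tendsto (fun n : ℕ => 1 / ((n : ℝ) + s)) atTop (𝓝 0) := by
    simp only [one_div]
    exact tendsto_inv_atTop_zero.comp (tendsto_atTop_add_const_right _ s tendsto_natCast_atTop_atTop)
  have hne : ∀ᶠ n : ℕ in atTop, (n : ℝ) + s ≠ 0 :=
    ((tendsto_atTop_add_const_right _ s tendsto_natCast_atTop_atTop).eventually_gt_atTop 0).mono
      fun n hn => hn.ne'
  have h2 : Tendsto (fun n : ℕ => (n : ℝ) / ((n : ℝ) + s)) atTop (𝓝 1) := by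
    have := (h1.const_mul s).const_sub 1
    rw [mul_zero, sub_zero] at this
    refine this.congr' ?_
    filter_upwards [hne] with n hn
    field_simp; ring
  have hb : Tendsto (fun n => frobD p n - l) atTop (𝓝 0) := by simpa using hl.sub_const l
  have h := hA.mul (((h1.const_mul 2).add (h2.mul hb)).sub (h1.mul h2))
  simp only [mul_zero, zero_mul, add_zero, sub_zero] at h
  refine h.congr fun n => ?_
  simp only [mellinCert, div_eq_mul_inv, one_mul, pow_two, mul_inv]; ring

/-- Summing the telescoped identity over n ≥ 1 leaves the certificate at 1. It is exactly what the
polar term n = 0, that is 1 + l s, contributes to the equation. -/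
theorem mellinEntire_functional {C : ℝ} (hp : 0 < p) (hp' : p ≤ 1 / 4)
    (hA : Tendsto (fun n : ℕ => (n : ℝ) * frobA p n) atTop (𝓝 C))
    (hl : Tendsto (frobD p) atTop (𝓝 l)) {s : ℝ} (hs : -(1 / 2) ≤ s) :
    (s + 1) ^ 2 * mellinEntire p l s = (s ^ 2 + s + p) * mellinEntire p l (s + 1) := by
  have h1 := summable_mellinTerm hp hp' hl hs
  have h2 := summable_mellinTerm hp hp' hl (by linarith : -(1 / 2) ≤ s + 1)
  have hs1 : s + 1 ≠ 0 := by linarith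
  have e : s ^ 2 * mellinReg p l s - (s ^ 2 + s + p) * mellinReg p l (s + 1)
      = mellinCert p l s 1 := by
    have h3 := (h1.hasSum.mul_left (s ^ 2)).sub (h2.hasSum.mul_left (s ^ 2 + s + p))
    refine tendsto_nhds_unique h3.tendsto_sum_nat ?_
    have h4 := ((tendsto_mellinCert hA hl s).comp (tendsto_add_atTop_nat 1)).const_sub
      (mellinCert p l s 1)
    rw [sub_zero] at h4
    refine h4.congr fun N => ?_
    rw [Finset.sum_congr rfl fun n _ => mellinTerm_telescope hp hs n]
    exact (Finset.sum_range_sub' (fun n => mellinCert p l s (n + 1)) N).symm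
  have eA : frobA p 1 = p := by simp [frobA]
  have eD : frobD p 1 = 1 / p - 2 := by simp [frobD]
  simp only [mellinCert, eA, eD, Nat.cast_one] at e
  simp only [mellinEntire]
  have hp0 := hp.ne'
  have hs1' : 1 + s ≠ 0 := by rwa [add_comm]
  have e' : s ^ 2 * mellinReg p l s = (s ^ 2 + s + p) * mellinReg p l (s + 1)
     + ((1 - p * l) / (s + 1) - p / (s + 1) ^ 2) := by
    rw [← sub_eq_iff_eq_add', e, add_comm 1 s]
    field_simp
    ring
  rw [e']
  field_simp
  ring

theorem mellinEntire_prod {C : ℝ} (hp : 0 < p) (hp' : p ≤ 1 / 4)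
    (hA : Tendsto (fun n : ℕ => (n : ℝ) * frobA p n) atTop (𝓝 C))
    (hl : Tendsto (frobD p) atTop (𝓝 l)) {s : ℝ} (hs : -(1 / 2) ≤ s) (N : ℕ) :
    mellinEntire p l s = (∏ k ∈ Finset.range N, ((s + k) ^ 2 + (s + k) + p) / (s + k + 1) ^ 2)
      * mellinEntire p l (s + N) := by
  induction N with
  | zero => simp
  | succ N ih =>
    have hN : (0 : ℝ) ≤ N := N.cast_nonneg
    have h := mellinEntire_functional hp hp' hA hl (by linarith : -(1 / 2) ≤ s + N)
    have h0 : s + N + 1 ≠ 0 := by linarith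
    rw [ih, Finset.prod_range_succ, mul_assoc]
    congr 1
    rw [Nat.cast_succ, ← add_assoc s, div_mul_eq_mul_div, eq_div_iff (pow_ne_zero 2 h0), ← h]
    ring

/-- Here E(s) / s = 1 / s + l - s R(s), and s times each Mellin term converges as s → ∞ under the
bound 2 / (n + 1)². Linear growth selects the solution of the recurrence; the value of the limit is
found afterwards by normalisation at s = 0. -/
theorem exists_tendsto_mellinEntire_div (hp : 0 < p) (hp' : p ≤ 1 / 4)
    (hl : Tendsto (frobD p) atTop (𝓝 l)) :
    ∃ h : ℝ, Tendsto (fun s => mellinEntire p l s / s) atTop (𝓝 h) := by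
  have key : Tendsto (fun s : ℝ => ∑' n, s * mellinTerm p l s (n + 1)) atTop
      (𝓝 (∑' n, frobA p (n + 1) * (frobD p (n + 1) - l))) := by
    refine tendsto_tsum_of_dominated_convergence (summable_inv_sq_succ.mul_left 2) (fun n => ?_) ?_
    · have h1 : Tendsto (fun s : ℝ => 1 / ((n + 1 : ℕ) + s)) atTop (𝓝 0) := by
        simp only [one_div]
        exact tendsto_inv_atTop_zero.comp (tendsto_atTop_add_const_left _ _ tendsto_id)
      have h2 : Tendsto (fun s : ℝ => s / ((n + 1 : ℕ) + s)) atTop (𝓝 1) := by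
        have := (h1.const_mul ((n + 1 : ℕ) : ℝ)).const_sub 1
        rw [mul_zero, sub_zero] at this
        refine this.congr' ?_
        filter_upwards [eventually_gt_atTop 0] with s hs
        have : ((n + 1 : ℕ) : ℝ) + s ≠ 0 := by positivity
        field_simp; ring
      have h := ((h2.const_mul (frobD p (n + 1) - l)).sub (h2.mul h1)).const_mul (frobA p (n + 1))
      simp only [mul_zero, mul_one, sub_zero] at h
      refine h.congr fun s => ?_
      simp only [mellinTerm, div_eq_mul_inv, one_mul, pow_two, mul_inv]; ring
    · filter_upwards [eventually_gt_atTop 0] with s hs n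
      have hn : (0 : ℝ) ≤ n := n.cast_nonneg
      have hq : (0 : ℝ) < n + 1 + s := by linarith
      have hAn := frobA_le hp hp' (n + 1)
      have hA0 := frobA_pos hp (n + 1)
      have hA2 : frobA p (n + 1) ≤ 1 / ((n : ℝ) + 1) := by
        refine hAn.trans ?_
        push_cast
        gcongr
        linarith
      rw [mellinTerm, Real.norm_eq_abs]
      push_cast
      have e : s * (frobA p (n + 1) * ((frobD p (n + 1) - l) / ((n : ℝ) + 1 + s)
          - 1 / ((n : ℝ) + 1 + s) ^ 2)) = frobA p (n + 1) * ((frobD p (n + 1) - l) *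
          (s / ((n : ℝ) + 1 + s)) - (s / ((n : ℝ) + 1 + s)) * (1 / ((n : ℝ) + 1 + s))) := by
        field_simp
      rw [e, abs_mul, abs_of_pos hA0]
      have h1 : s / ((n : ℝ) + 1 + s) ≤ 1 := by rw [div_le_one hq]; linarith
      have h1' : 0 ≤ s / ((n : ℝ) + 1 + s) := by positivity
      have h2 : 1 / ((n : ℝ) + 1 + s) ≤ 1 / ((n : ℝ) + 1) :=
        one_div_le_one_div_of_le (by positivity) (by linarith)
      calc _ ≤ 1 / ((n : ℝ) + 1) * (1 / ((n : ℝ) + 1) * 1 + 1 * (1 / ((n : ℝ) + 1))) := by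
            gcongr
            refine (abs_sub _ _).trans ?_
            rw [abs_mul, abs_of_nonneg h1', abs_of_nonneg (by positivity :
              0 ≤ s / ((n : ℝ) + 1 + s) * (1 / ((n : ℝ) + 1 + s)))]
            gcongr
            exact abs_frobD_sub_le hp hp' hl n
        _ = _ := by field_simp; ring
  refine ⟨_, ((tendsto_inv_atTop_zero.add_const l).sub key).congr' ?_⟩
  filter_upwards [eventually_gt_atTop 0] with s hs
  rw [tsum_mul_left, ← mellinReg, mellinEntire]
  field_simp

end

theorem prod_frobA (p : ℝ) (N : ℕ) :
    ∏ k ∈ Finset.range N, ((k : ℝ) * (k + 1) + p) / ((k : ℝ) + 1) ^ 2 = frobA p N := by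
  induction N with
  | zero => rfl
  | succ N ih => rw [Finset.prod_range_succ, ih, frobA, mul_comm]

/-- The reflection formula for the Mellin transform. -/
theorem mellinEntire_mul_neg {a l : ℝ} (ha : a ∈ Ioo (0 : ℝ) 1)
    (hl : Tendsto (frobD (a * (1 - a))) atTop (𝓝 l)) {s : ℝ} (hs : |s| ≤ 1 / 2) :
    mellinEntire (a * (1 - a)) l s * mellinEntire (a * (1 - a)) l (-s)
      * (Real.sin (Real.pi * s) * Real.sin (Real.pi * a)) ^ 2
      = (Real.pi * s) ^ 2 * (Real.sin (Real.pi * (a + s)) * Real.sin (Real.pi * (a - s))) := by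
  set p := a * (1 - a) with hpdef
  have hp : 0 < p := mul_pos ha.1 (sub_pos.2 ha.2)
  have hp' : p ≤ 1 / 4 := by nlinarith [sq_nonneg (a - 1 / 2)]
  have hA := tendsto_nat_mul_frobA a
  rw [← hpdef] at hA
  have hpi := Real.pi_pos
  have hsin : 0 < Real.sin (Real.pi * a) :=
    Real.sin_pos_of_pos_of_lt_pi (mul_pos hpi ha.1) (by nlinarith [ha.2])
  obtain ⟨hs1, hs2⟩ := abs_le.1 hs
  obtain ⟨h, hh⟩ := exists_tendsto_mellinEntire_div hp hp' hl
  have hE : ∀ s : ℝ, Tendsto (fun N : ℕ => mellinEntire p l (s + N) / (N : ℝ)) atTop (𝓝 h) := by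
    intro s
    have ht : Tendsto (fun N : ℕ => s + (N : ℝ)) atTop atTop :=
      tendsto_atTop_add_const_left _ _ tendsto_natCast_atTop_atTop
    have h1 := hh.comp ht
    have h2 : Tendsto (fun N : ℕ => s * (1 / (N : ℝ)) + 1) atTop (𝓝 1) := by
      simpa using (tendsto_one_div_atTop_nhds_zero_nat.const_mul s).add_const 1
    have h3 := h1.mul h2
    rw [mul_one] at h3
    refine h3.congr' ?_
    filter_upwards [ht.eventually_gt_atTop 0, eventually_gt_atTop 0] with N hN hN'
    have : (N : ℝ) ≠ 0 := by positivity
    have := hN.ne'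
    simp only [Function.comp_apply]
    field_simp
  -- At s = 0 the iterated recurrence reads 1 = A_N E(N), while N A_N → sin(πa) / π and E(N) / N →
  -- h.
  have hh1 : Real.sin (Real.pi * a) / Real.pi * h = 1 := by
    refine tendsto_nhds_unique (hA.mul (hE 0)) ?_
    refine tendsto_const_nhds.congr' ?_
    filter_upwards [eventually_gt_atTop 0] with N hN
    have hN0 : (N : ℝ) ≠ 0 := by positivity
    have e := mellinEntire_prod hp hp' hA hl (by norm_num : -(1 / 2) ≤ (0 : ℝ)) N
    have e0 : mellinEntire p l 0 = 1 := by simp [mellinEntire]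
    have e1 : ∏ k ∈ Finset.range N, ((0 + (k : ℝ)) ^ 2 + (0 + k) + p) / (0 + (k : ℝ) + 1) ^ 2
        = frobA p N := by
      rw [← prod_frobA]
      refine Finset.prod_congr rfl fun k _ => ?_
      congr 1 <;> ring
    rw [e1, e0] at e
    rw [e]
    field_simp
  have hlim : Tendsto (fun N : ℕ => (((N : ℝ) * frobA ((a + s) * (1 - (a + s))) N)
      * ((N : ℝ) * frobA ((a - s) * (1 - (a - s))) N))
      * ((mellinEntire p l (s + N) / N) * (mellinEntire p l (-s + N) / N))
      * (Real.pi * s) ^ 2) atTop (𝓝 _) :=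
    (((tendsto_nat_mul_frobA (a + s)).mul (tendsto_nat_mul_frobA (a - s))).mul
      ((hE s).mul (hE (-s)))).mul_const _
  have hsinprod := ((Real.tendsto_euler_sin_prod s).pow 2).const_mul
    (mellinEntire p l s * mellinEntire p l (-s))
  have key := tendsto_nhds_unique (hlim.congr' ?_) hsinprod
  · have e : h = Real.pi / Real.sin (Real.pi * a) := by
      field_simp at hh1 ⊢; linarith
    rw [e] at key
    field_simp at key
    linear_combination -key
  · filter_upwards [eventually_gt_atTop 0] with N hN
    have hN0 : (N : ℝ) ≠ 0 := by positivity
    rw [mellinEntire_prod hp hp' hA hl (by linarith : -(1 / 2) ≤ s) N,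
      mellinEntire_prod hp hp' hA hl (by linarith : -(1 / 2) ≤ -s) N, ← prod_frobA, ← prod_frobA]
    -- The four linear factors for s and -s regroup as (k + a + s)(k + 1 - a - s) and (k + a - s)(k
    -- + 1 - a + s), the coefficient ratios for the parameters a + s and a - s. The denominators
    -- form the squared Euler product for sin(πs).
    have e : (∏ k ∈ Finset.range N, ((s + (k : ℝ)) ^ 2 + (s + k) + p) / (s + (k : ℝ) + 1) ^ 2)
        * (∏ k ∈ Finset.range N, ((-s + (k : ℝ)) ^ 2 + (-s + k) + p) / (-s + (k : ℝ) + 1) ^ 2)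
        * (∏ k ∈ Finset.range N, (1 - s ^ 2 / ((k : ℝ) + 1) ^ 2)) ^ 2
        = (∏ k ∈ Finset.range N, ((k : ℝ) * (k + 1) + (a + s) * (1 - (a + s))) / ((k : ℝ) + 1) ^ 2)
        * ∏ k ∈ Finset.range N, ((k : ℝ) * (k + 1) + (a - s) * (1 - (a - s))) / ((k : ℝ) + 1) ^ 2 := by
      rw [← Finset.prod_pow, ← Finset.prod_mul_distrib, ← Finset.prod_mul_distrib,
        ← Finset.prod_mul_distrib]
      refine Finset.prod_congr rfl fun k _ => ?_
      have hk : (0 : ℝ) ≤ k := k.cast_nonneg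
      have h1 : s + k + 1 ≠ 0 := by linarith
      have h2 : -s + k + 1 ≠ 0 := by linarith
      rw [hpdef]
      field_simp
      ring
    rw [mul_mul_mul_comm (N : ℝ), ← e]
    field_simp

/-- The quotient factors as (u - sin u) / u³ times 1 + sin u / u times (u / sin u)², with limits
1/6, 2 and 1. -/
theorem tendsto_sq_div_sin_sq :
    Tendsto (fun u : ℝ => (u ^ 2 / Real.sin u ^ 2 - 1) / u ^ 2) (𝓝[≠] 0) (𝓝 (1 / 3)) := by
  have hne : ∀ᶠ u : ℝ in 𝓝[≠] 0, u ≠ 0 := self_mem_nhdsWithin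
  have hsmall : ∀ᶠ u : ℝ in 𝓝[≠] 0, |u| < 1 :=
    nhdsWithin_le_nhds ((continuous_abs.tendsto (0 : ℝ)).eventually (eventually_lt_nhds (by simp)))
  have hc : Tendsto (fun u : ℝ => Real.sin u / u) (𝓝[≠] 0) (𝓝 1) := by
    have := (hasDerivAt_iff_tendsto_slope.1 (Real.hasDerivAt_sin 0))
    simp only [Real.cos_zero] at this
    refine this.congr fun u => ?_
    simp [slope, div_eq_inv_mul]
  have hd : Tendsto (fun u : ℝ => (u - Real.sin u) / u ^ 3) (𝓝[≠] 0) (𝓝 (1 / 6)) := by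
    rw [tendsto_iff_norm_sub_tendsto_zero]
    have h0 : Tendsto (fun u : ℝ => |u| ^ 2 / 100) (𝓝[≠] 0) (𝓝 0) := by
      have : Tendsto (fun u : ℝ => |u| ^ 2 / 100) (𝓝 0) (𝓝 (|0| ^ 2 / 100)) :=
        ((continuous_abs.pow 2).div_const _).tendsto _
      simpa using this.mono_left nhdsWithin_le_nhds
    refine squeeze_zero' (.of_forall fun _ => norm_nonneg _) ?_ h0
    filter_upwards [hne, hsmall] with u hu hu1
    have := Real.sin_bound hu1.le
    have e : (u - Real.sin u) / u ^ 3 - 1 / 6 = -(Real.sin u - (u - u ^ 3 / 6)) / u ^ 3 := by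
      field_simp; ring
    rw [e, Real.norm_eq_abs, abs_div, abs_neg, abs_pow, div_le_iff₀ (by positivity)]
    calc _ ≤ |u| ^ 5 / 100 := this
      _ = _ := by ring
  have h := (hd.mul (hc.const_add 1)).mul ((hc.inv₀ one_ne_zero).pow 2)
  have e : (1 / 6 : ℝ) * (1 + 1) * (1⁻¹) ^ 2 = 1 / 3 := by norm_num
  rw [e] at h
  refine h.congr' ?_
  filter_upwards [hne, hc.eventually_ne one_ne_zero] with u hu hs
  have : Real.sin u ≠ 0 := fun h => hs (by simp [h])
  field_simp
  ring

/-- Compare the s² coefficients in the reflection formula. On the left, (1 + l s - s² R(s))(1 - l s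
- s² R(-s)) contributes -l² - 2 R(0). On the right, sin π(a + s) sin π(a - s) = sin²(πa) - sin²(πs)
leaves π² / 3 - π² / sin²(πa). -/
theorem mellinReg_zero {a l : ℝ} (ha : a ∈ Ioo (0 : ℝ) 1)
    (hl : Tendsto (frobD (a * (1 - a))) atTop (𝓝 l)) :
    mellinReg (a * (1 - a)) l 0
      = (Real.pi ^ 2 / Real.sin (Real.pi * a) ^ 2 - Real.pi ^ 2 / 3 - l ^ 2) / 2 := by
  have hrefl := fun {s : ℝ} => mellinEntire_mul_neg (s := s) ha hl
  set p := a * (1 - a) with hpdef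
  have hp : 0 < p := mul_pos ha.1 (sub_pos.2 ha.2)
  have hp' : p ≤ 1 / 4 := by nlinarith [sq_nonneg (a - 1 / 2)]
  have hpi := Real.pi_pos
  have hsin : 0 < Real.sin (Real.pi * a) :=
    Real.sin_pos_of_pos_of_lt_pi (mul_pos hpi ha.1) (by nlinarith [ha.2])
  have hne : ∀ᶠ u : ℝ in 𝓝[≠] 0, u ≠ 0 := self_mem_nhdsWithin
  have hsmall : ∀ᶠ u : ℝ in 𝓝[≠] 0, |u| < 1 / 2 :=
    nhdsWithin_le_nhds ((continuous_abs.tendsto (0 : ℝ)).eventually (eventually_lt_nhds (by simp)))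
  have hid : Tendsto (fun s : ℝ => s) (𝓝[≠] 0) (𝓝 0) := nhdsWithin_le_nhds
  have hr : Tendsto (mellinReg p l) (𝓝[≠] 0) (𝓝 (mellinReg p l 0)) :=
    (tendsto_mellinReg_zero hp hp' hl).mono_left nhdsWithin_le_nhds
  have hr' : Tendsto (fun s => mellinReg p l (-s)) (𝓝[≠] 0) (𝓝 (mellinReg p l 0)) := by
    refine (tendsto_mellinReg_zero hp hp' hl).comp ?_
    simpa using hid.neg
  have hL : Tendsto (fun s => (mellinEntire p l s * mellinEntire p l (-s) - 1) / s ^ 2) (𝓝[≠] 0)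
      (𝓝 (-l ^ 2 - 2 * mellinReg p l 0)) := by
    have h := ((hr.add hr').const_sub (-l ^ 2)).add (hid.mul (((hr.sub hr').const_mul l).add
      (hid.mul (hr.mul hr'))))
    rw [zero_mul, add_zero] at h
    have e : -l ^ 2 - (mellinReg p l 0 + mellinReg p l 0) = -l ^ 2 - 2 * mellinReg p l 0 := by ring
    rw [e] at h
    refine h.congr' ?_
    filter_upwards [hne] with s hs
    simp only [mellinEntire]
    field_simp
    ring
  have hR : Tendsto (fun s => (mellinEntire p l s * mellinEntire p l (-s) - 1) / s ^ 2) (𝓝[≠] 0)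
      (𝓝 (Real.pi ^ 2 * (1 / 3) - Real.pi ^ 2 / Real.sin (Real.pi * a) ^ 2)) := by
    have hcomp : Tendsto (fun s : ℝ => Real.pi * s) (𝓝[≠] 0) (𝓝[≠] 0) := by
      refine tendsto_nhdsWithin_iff.2 ⟨by simpa using hid.const_mul Real.pi, ?_⟩
      filter_upwards [hne] with s hs using mul_ne_zero hpi.ne' hs
    have h := ((tendsto_sq_div_sin_sq.comp hcomp).const_mul (Real.pi ^ 2)).sub_const
      (Real.pi ^ 2 / Real.sin (Real.pi * a) ^ 2)
    refine h.congr' ?_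
    filter_upwards [hne, hsmall] with s hs hs'
    have e := hrefl hs'.le
    have hsin' : Real.sin (Real.pi * s) ≠ 0 := by
      rcases lt_or_gt_of_ne hs with h | h
      · refine (Real.sin_neg_of_neg_of_neg_pi_lt (mul_neg_of_pos_of_neg hpi h) ?_).ne
        nlinarith [(abs_lt.1 hs').1]
      · refine (Real.sin_pos_of_pos_of_lt_pi (mul_pos hpi h) ?_).ne'
        nlinarith [(abs_lt.1 hs').2]
    have e2 : Real.sin (Real.pi * (a + s)) * Real.sin (Real.pi * (a - s))
        = Real.sin (Real.pi * a) ^ 2 - Real.sin (Real.pi * s) ^ 2 := by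
      rw [mul_add, mul_sub, Real.sin_add, Real.sin_sub]
      linear_combination Real.sin (Real.pi * a) ^ 2 * Real.cos_sq' (Real.pi * s)
        - Real.sin (Real.pi * s) ^ 2 * Real.cos_sq' (Real.pi * a)
    rw [e2] at e
    have e3 : mellinEntire p l s * mellinEntire p l (-s) = (Real.pi * s) ^ 2 *
        (Real.sin (Real.pi * a) ^ 2 - Real.sin (Real.pi * s) ^ 2)
        / (Real.sin (Real.pi * s) * Real.sin (Real.pi * a)) ^ 2 := by
      rw [← e, mul_div_assoc, div_self (pow_ne_zero 2 (mul_ne_zero hsin' hsin.ne')), mul_one]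
    simp only [Function.comp_apply, e3]
    field_simp
    ring
  linarith [tendsto_nhds_unique hL hR]

/-! ### The series `∑ Aₙ / n` -/

/-- The coefficients `(a)ₙ (1 - a)ₙ / ((1/2)ₙ n!)`, as a function of `p = a (1 - a)`. -/
noncomputable def cosCoeff (p : ℝ) : ℕ → ℝ
  | 0 => 1
  | n + 1 => (n * (n + 1) + p) / (((n : ℝ) + 1) * (n + 1 / 2)) * cosCoeff p n

theorem cosCoeff_succ (p : ℝ) (n : ℕ) :
    ((n : ℝ) + 1) * (n + 1 / 2) * cosCoeff p (n + 1) = (n * (n + 1) + p) * cosCoeff p n := by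
  have : (n : ℝ) + 1 ≠ 0 := by positivity
  have : (n : ℝ) + 1 / 2 ≠ 0 := by positivity
  rw [cosCoeff]; field_simp

section
variable {p : ℝ}

theorem cosCoeff_pos (hp : 0 < p) (n : ℕ) : 0 < cosCoeff p n := by
  induction n with
  | zero => exact one_pos
  | succ n ih => rw [cosCoeff]; positivity

theorem cosCoeff_le_one (hp : 0 < p) (hp' : p ≤ 1 / 4) (n : ℕ) : cosCoeff p n ≤ 1 := by
  induction n with
  | zero => exact le_rfl
  | succ n ih =>
    have hn : (0 : ℝ) ≤ n := n.cast_nonneg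
    rw [cosCoeff]
    refine mul_le_one₀ ?_ (cosCoeff_pos hp n).le ih
    rw [div_le_one (by positivity)]
    nlinarith

theorem polyBdd_cosCoeff (hp : 0 < p) (hp' : p ≤ 1 / 4) : PolyBdd (cosCoeff p) :=
  .of_le 1 fun n => by rw [abs_of_pos (cosCoeff_pos hp n)]; exact cosCoeff_le_one hp hp' n

theorem psum_cosCoeff_ode (hp : 0 < p) (hp' : p ≤ 1 / 4) {x : ℝ} (hx : ‖x‖ < 1) :
    psum (fun n => n * (n * cosCoeff p n)) x = x * (psum (fun n => n * (n * cosCoeff p n)) x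
      + psum (fun n => n * cosCoeff p n) x + p * psum (cosCoeff p) x)
      + 1 / 2 * psum (fun n => n * cosCoeff p n) x := by
  have hA := polyBdd_cosCoeff hp hp'
  have h1 := (hA.nat_mul.nat_mul.add hA.nat_mul).add (hA.const_mul p)
  rw [← smul_eq_mul (a := p), ← psum_const_mul, ← psum_add hA.nat_mul.nat_mul hA.nat_mul hx,
    ← psum_add (hA.nat_mul.nat_mul.add hA.nat_mul) (hA.const_mul p) hx,
    ← psum_shift h1 hx, ← smul_eq_mul (a := (1 / 2 : ℝ)), ← psum_const_mul,
    ← psum_add h1.shift (hA.nat_mul.const_mul _) hx]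
  congr 1
  funext n
  cases n with
  | zero => simp [shift]
  | succ n =>
    have := cosCoeff_succ p n
    simp only [shift]; push_cast
    linear_combination this

theorem sin_cos_pos {y : ℝ} (hy : y ∈ Ioo 0 (Real.pi / 2)) : 0 < Real.sin y ∧ 0 < Real.cos y :=
  ⟨Real.sin_pos_of_pos_of_lt_pi hy.1 (by linarith [hy.2, Real.pi_pos]),
   Real.cos_pos_of_mem_Ioo ⟨by linarith [hy.1, Real.pi_pos], hy.2⟩⟩

theorem sin_sq_mem {y : ℝ} (hy : y ∈ Ioo 0 (Real.pi / 2)) : Real.sin y ^ 2 ∈ Ioo (0 : ℝ) 1 := by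
  obtain ⟨h1, h2⟩ := sin_cos_pos hy
  refine ⟨by positivity, ?_⟩
  nlinarith [Real.sin_sq_add_cos_sq y, pow_pos h2 2]

/-- Two functions with `u' = v`, `v' = -m² u` that vanish at `0` are zero. -/
theorem eq_zero_of_harmonic {u v : ℝ → ℝ} {m b : ℝ}
    (hu : ∀ y ∈ Ioo 0 b, HasDerivAt u (v y) y)
    (hv : ∀ y ∈ Ioo 0 b, HasDerivAt v (-m ^ 2 * u y) y)
    (hu0 : Tendsto u (𝓝[>] 0) (𝓝 0)) (hv0 : Tendsto v (𝓝[>] 0) (𝓝 0)) :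
    ∀ y ∈ Ioo 0 b, u y = 0 := by
  have key : ∀ f : ℝ → ℝ, (∀ y ∈ Ioo 0 b, HasDerivAt f 0 y) → Tendsto f (𝓝[>] 0) (𝓝 0) →
      ∀ y ∈ Ioo 0 b, f y = 0 := by
    intro f hf hf0 y hy
    refine tendsto_nhds_unique (tendsto_const_nhds.congr' ?_) hf0
    filter_upwards [Ioo_mem_nhdsGT (hy.1.trans hy.2)] with z hz
    exact isOpen_Ioo.is_const_of_deriv_eq_zero isPreconnected_Ioo
      (fun y hy => (hf y hy).differentiableAt.differentiableWithinAt)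
      (fun y hy => (hf y hy).deriv) hy hz
  have hE := key (fun y => v y ^ 2 + m ^ 2 * u y ^ 2) (fun y hy => by
    refine (((hv y hy).pow 2).add (((hu y hy).pow 2).const_mul (m ^ 2))).congr_deriv ?_
    simp; ring) (by simpa using (hv0.pow 2).add ((hu0.pow 2).const_mul (m ^ 2)))
  -- The energy v² + m² u² vanishes, but m may be 0 (for a = 1/2), so only v = 0 is taken from it; u
  -- is then constant with limit 0.
  refine key u (fun y hy => ?_) hu0
  have h0 : v y = 0 := by
    have := hE y hy
    have h1 : v y ^ 2 = 0 := by nlinarith [sq_nonneg (v y), sq_nonneg (m * u y)]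
    exact pow_eq_zero_iff two_ne_zero |>.1 h1
  simpa [h0] using hu y hy

/-- Under x = sin² y the hypergeometric equation of the series becomes, after multiplication by cos
y, the oscillator u'' = -(2a - 1)² u. Both sides have value 1 and slope 0 at y = 0. -/
theorem cos_mul_psum_cosCoeff {a : ℝ} (ha : a ∈ Ioo (0 : ℝ) 1) {y : ℝ}
    (hy : y ∈ Ioo 0 (Real.pi / 2)) :
    Real.cos y * psum (cosCoeff (a * (1 - a))) (Real.sin y ^ 2) = Real.cos ((2 * a - 1) * y) := by
  set p := a * (1 - a) with hpdef
  have hp : 0 < p := mul_pos ha.1 (sub_pos.2 ha.2)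
  have hp' : p ≤ 1 / 4 := by nlinarith [sq_nonneg (a - 1 / 2)]
  have hB := polyBdd_cosCoeff hp hp'
  set m := 2 * a - 1 with hm
  have hds : ∀ y : ℝ, HasDerivAt (fun y => Real.sin y ^ 2) (2 * Real.sin y * Real.cos y) y :=
    fun y => ((Real.hasDerivAt_sin y).pow 2).congr_deriv (by simp)
  have hcomp : ∀ c : ℕ → ℝ, PolyBdd c → ∀ y ∈ Ioo 0 (Real.pi / 2),
      HasDerivAt (fun y => psum c (Real.sin y ^ 2))
        (2 * Real.cos y * psum (fun n => n * c n) (Real.sin y ^ 2) / Real.sin y) y := by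
    intro c hc y hy
    have hs := (sin_cos_pos hy).1
    have h := (hasDerivAt_psum' hc (norm_lt_one_of_mem (sin_sq_mem hy)) (by positivity)).comp y
      (hds y)
    refine h.congr_deriv ?_
    field_simp
  have hsin0 : Tendsto (fun y : ℝ => Real.sin y ^ 2) (𝓝[>] 0) (𝓝 0) := by
    have : Tendsto (fun y : ℝ => Real.sin y ^ 2) (𝓝 0) (𝓝 (Real.sin 0 ^ 2)) :=
      (Real.continuous_sin.pow 2).tendsto 0
    simpa using this.mono_left nhdsWithin_le_nhds
  have hps : ∀ c : ℕ → ℝ, PolyBdd c →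
      Tendsto (fun y => psum c (Real.sin y ^ 2)) (𝓝[>] 0) (𝓝 (c 0)) := by
    intro c hc
    have h := (continuousAt_psum hc (z := (0 : ℝ)) (by simp)).tendsto
    rw [psum_zero, smul_eq_mul, mul_one] at h
    exact h.comp hsin0
  have hlim : ∀ f : ℝ → ℝ, Continuous f → Tendsto f (𝓝[>] 0) (𝓝 (f 0)) :=
    fun f hf => (hf.tendsto 0).mono_left nhdsWithin_le_nhds
  have key := eq_zero_of_harmonic (m := m) (b := Real.pi / 2)
    (u := fun y => Real.cos y * psum (cosCoeff p) (Real.sin y ^ 2) - Real.cos (m * y))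
    (v := fun y => -Real.sin y * psum (cosCoeff p) (Real.sin y ^ 2)
      + 2 * Real.cos y ^ 2 * psum (fun n => n * cosCoeff p n) (Real.sin y ^ 2) / Real.sin y
      + m * Real.sin (m * y)) (fun y hy => ?_) (fun y hy => ?_) ?_ ?_ y hy
  · exact sub_eq_zero.1 key
  · have hs := (sin_cos_pos hy).1
    have h1 := ((Real.hasDerivAt_cos y).mul (hcomp _ hB y hy)).sub
      (((hasDerivAt_id y).const_mul m).cos)
    refine h1.congr_deriv ?_
    simp only [id]
    field_simp
    ring
  · have hs := (sin_cos_pos hy).1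
    have h1 := (((Real.hasDerivAt_sin y).neg.mul (hcomp _ hB y hy)).add
      ((((((Real.hasDerivAt_cos y).pow 2).const_mul 2).mul (hcomp _ hB.nat_mul y hy))).div
        (Real.hasDerivAt_sin y) hs.ne')).add ((((hasDerivAt_id y).const_mul m).sin).const_mul m)
    refine h1.congr_deriv ?_
    have e := psum_cosCoeff_ode hp hp' (norm_lt_one_of_mem (sin_sq_mem hy))
    have hc2 := Real.sin_sq_add_cos_sq y
    have hmp : m ^ 2 = 1 - 4 * p := by rw [hm, hpdef]; ring
    simp only [id, Pi.neg_apply, Pi.pow_apply, Pi.mul_apply, Nat.cast_ofNat, Nat.add_one_sub_one, pow_one]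
    generalize psum (fun n => n * (n * cosCoeff p n)) (Real.sin y ^ 2) = X at *
    generalize psum (fun n => n * cosCoeff p n) (Real.sin y ^ 2) = Y at *
    generalize psum (cosCoeff p) (Real.sin y ^ 2) = Z at *
    generalize Real.sin (m * y) = T at *
    generalize Real.cos (m * y) = R at *
    generalize Real.sin y = S at *
    generalize Real.cos y = D at *
    field_simp
    linear_combination 4 * D * e + (4 * D * X - 2 * D * Y) * hc2 + D * S ^ 2 * Z * hmp
  · have h := ((hlim Real.cos Real.continuous_cos).mul (hps _ hB)).sub
      (hlim (fun y => Real.cos (m * y)) (by fun_prop))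
    simpa [cosCoeff] using h
  -- The division by sin y in v is harmless at 0: the series without constant term supplies a factor
  -- sin² y.
  · have hb : PolyBdd fun n : ℕ => ((n : ℝ) + 1) * cosCoeff p (n + 1) := by
      simpa using hB.nat_mul.succ
    have h := (((hlim (fun y => -Real.sin y) (by fun_prop)).mul (hps _ hB)).add
      ((hlim (fun y => 2 * Real.cos y ^ 2 * Real.sin y) (by fun_prop)).mul (hps _ hb))).add
      (hlim (fun y => m * Real.sin (m * y)) (by fun_prop))
    simp only [Real.sin_zero, mul_zero, neg_zero, zero_mul, add_zero] at h
    refine h.congr' ?_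
    filter_upwards [Ioo_mem_nhdsGT (by positivity : (0 : ℝ) < Real.pi / 2)] with y hy
    have hs := (sin_cos_pos hy).1
    rw [← mul_psum_deriv hB (norm_lt_one_of_mem (sin_sq_mem hy))]
    field_simp

theorem PolyBdd.hasSum_succ {c : ℕ → ℝ} (hc : PolyBdd c) {x : ℝ} (hx : ‖x‖ < 1) :
    HasSum (fun n => c (n + 1) * x ^ (n + 1)) (psum c x - c 0) := by
  have h := (hasSum_nat_add_iff' (f := fun n => c n • x ^ n) 1).2 (hc.hasSum hx)
  simpa using h

/-- Wallis' ratio (2n + 1) / (2n + 2) trades the factor (1/2)ₙ in the denominator of the cosine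
coefficients for n!. -/
theorem integral_sin_pow_two_mul (p : ℝ) (n : ℕ) :
    cosCoeff p n * ∫ y in (0 : ℝ)..(Real.pi / 2), Real.sin y ^ (2 * n)
      = Real.pi / 2 * frobA p n := by
  induction n with
  | zero => simp [cosCoeff, frobA]
  | succ n ih =>
    rw [show 2 * (n + 1) = 2 * n + 2 by ring, integral_sin_pow, cosCoeff, frobA]
    simp only [Real.sin_zero, Real.cos_pi_div_two, mul_zero, sub_zero, zero_pow (Nat.succ_ne_zero _),
      zero_mul, zero_div, zero_add]
    push_cast
    have : (n : ℝ) + 1 ≠ 0 := by positivity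
    have : (n : ℝ) + 1 / 2 ≠ 0 := by positivity
    have : (2 * n : ℝ) + 2 ≠ 0 := by positivity
    have : (2 * n : ℝ) + 1 ≠ 0 := by positivity
    calc _ = ((n : ℝ) * (n + 1) + p) / ((n + 1) * (n + 1 / 2)) * ((2 * n + 1) / (2 * n + 2)) *
        (cosCoeff p n * ∫ y in (0 : ℝ)..(Real.pi / 2), Real.sin y ^ (2 * n)) := by ring
      _ = _ := by
        rw [ih]
        field_simp
        try ring

/-- Integration by parts: (π/2 - y) sin^(2n+2) y vanishes at both ends. The weight produces the
denominator needed for ∑ Aₙ / n. -/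
theorem integral_weight (n : ℕ) :
    ∫ y in (0 : ℝ)..(Real.pi / 2), (Real.pi / 2 - y) * Real.cos y * Real.sin y ^ (2 * n + 1)
      = (∫ y in (0 : ℝ)..(Real.pi / 2), Real.sin y ^ (2 * (n + 1))) / (2 * n + 2) := by
  have hd : ∀ y ∈ uIcc 0 (Real.pi / 2), HasDerivAt
      (fun y => (Real.pi / 2 - y) * Real.sin y ^ (2 * (n + 1)) / (2 * n + 2))
      ((Real.pi / 2 - y) * Real.cos y * Real.sin y ^ (2 * n + 1)
        - Real.sin y ^ (2 * (n + 1)) / (2 * n + 2)) y := by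
    intro y _
    have h := ((((hasDerivAt_id y).const_sub (Real.pi / 2)).mul
      ((Real.hasDerivAt_sin y).pow (2 * (n + 1)))).div_const (2 * n + 2))
    refine h.congr_deriv ?_
    have : (2 * n : ℝ) + 2 ≠ 0 := by positivity
    simp only [id, Pi.pow_apply, show 2 * (n + 1) - 1 = 2 * n + 1 by omega]
    push_cast
    field_simp
    ring
  have h := intervalIntegral.integral_eq_sub_of_hasDerivAt hd
    (Continuous.intervalIntegrable (by fun_prop) _ _)
  rw [intervalIntegral.integral_sub (Continuous.intervalIntegrable (by fun_prop) _ _)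
    (Continuous.intervalIntegrable (by fun_prop) _ _), intervalIntegral.integral_div] at h
  simpa [sub_eq_zero] using h

theorem integral_sub_mul_sin {b : ℝ} (hb : b ≠ 0) :
    ∫ y in (0 : ℝ)..(Real.pi / 2), (Real.pi / 2 - y) * (2 * Real.sin (2 * b * y))
      = Real.pi / 4 * (2 / b - 2 / Real.pi * Real.sin (Real.pi * b) / b ^ 2) := by
  have hpi := Real.pi_ne_zero
  have hd : ∀ y ∈ uIcc 0 (Real.pi / 2), HasDerivAt
      (fun y => -((Real.pi / 2 - y) * Real.cos (2 * b * y)) / b - Real.sin (2 * b * y) / (2 * b ^ 2))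
      ((Real.pi / 2 - y) * (2 * Real.sin (2 * b * y))) y := by
    intro y _
    have h := ((((hasDerivAt_id y).const_sub (Real.pi / 2)).mul
      (((hasDerivAt_id y).const_mul (2 * b)).cos)).neg.div_const b).sub
      ((((hasDerivAt_id y).const_mul (2 * b)).sin).div_const (2 * b ^ 2))
    refine h.congr_deriv ?_
    simp only [id]
    field_simp
    ring
  rw [intervalIntegral.integral_eq_sub_of_hasDerivAt hd
    (Continuous.intervalIntegrable (by fun_prop) _ _)]
  have e : 2 * b * (Real.pi / 2) = Real.pi * b := by ring
  rw [e]
  simp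
  field_simp
  ring

theorem summable_frobA_div (hp : 0 < p) (hp' : p ≤ 1 / 4) :
    Summable fun n : ℕ => frobA p n / n := by
  rw [← summable_nat_add_iff 1]
  refine .of_nonneg_of_le (fun n => div_nonneg (frobA_pos hp _).le (by positivity)) (fun n => ?_)
    summable_inv_sq_succ
  rw [pow_two, ← div_div]
  push_cast
  gcongr
  refine (frobA_le hp hp' _).trans ?_
  push_cast
  gcongr
  linarith

/-- Each Aₙ / n with n ≥ 1 is 4 / π times a weighted integral of sin^(2n-1) y, by the two preceding
integrals. The integrands are nonnegative and their integrals summable, so the sum moves inside,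
where it is the cosine series without its constant term. -/
theorem tsum_frobA_div_eq_integral {a : ℝ} (ha : a ∈ Ioo (0 : ℝ) 1) :
    ∑' n : ℕ, frobA (a * (1 - a)) n / n = 4 / Real.pi * ∫ y in (0 : ℝ)..(Real.pi / 2),
      (Real.pi / 2 - y) * ((Real.cos ((2 * a - 1) * y) - Real.cos y) / Real.sin y) := by
  have hcos := fun {y : ℝ} => cos_mul_psum_cosCoeff ha (y := y)
  set p := a * (1 - a) with hpdef
  have hp : 0 < p := mul_pos ha.1 (sub_pos.2 ha.2)
  have hp' : p ≤ 1 / 4 := by nlinarith [sq_nonneg (a - 1 / 2)]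
  have hB := polyBdd_cosCoeff hp hp'
  have hpi := Real.pi_pos
  have hs := summable_frobA_div hp hp'
  set f : ℕ → ℝ → ℝ := fun n y =>
    cosCoeff p (n + 1) * ((Real.pi / 2 - y) * Real.cos y * Real.sin y ^ (2 * n + 1)) with hf
  have hint : ∀ n, ∫ y in (0 : ℝ)..(Real.pi / 2), f n y
      = Real.pi / 4 * (frobA p (n + 1) / ((n + 1 : ℕ) : ℝ)) := by
    intro n
    rw [intervalIntegral.integral_const_mul, integral_weight, ← mul_div_assoc,
      integral_sin_pow_two_mul]
    push_cast
    field_simp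
    try ring
  have hle : (0 : ℝ) ≤ Real.pi / 2 := by positivity
  have hmeas : ∀ n, MeasureTheory.Integrable (f n)
      (MeasureTheory.volume.restrict (Ioc 0 (Real.pi / 2))) := fun n =>
    (intervalIntegrable_iff_integrableOn_Ioc_of_le hle).1
      (Continuous.intervalIntegrable (by fun_prop) _ _)
  have hnonneg : ∀ n, ∀ y ∈ Ioc 0 (Real.pi / 2), 0 ≤ f n y := by
    intro n y hy
    have h1 : 0 ≤ Real.sin y := Real.sin_nonneg_of_nonneg_of_le_pi hy.1.le (by linarith [hy.2])
    have h2 : 0 ≤ Real.cos y := Real.cos_nonneg_of_mem_Icc ⟨by linarith [hy.1], hy.2⟩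
    have h3 := (cosCoeff_pos hp (n + 1)).le
    have h4 := sub_nonneg.2 hy.2
    positivity
  have hnorm : ∀ n, ∫ y in Ioc 0 (Real.pi / 2), ‖f n y‖
      = Real.pi / 4 * (frobA p (n + 1) / ((n + 1 : ℕ) : ℝ)) := by
    intro n
    rw [← hint, intervalIntegral.integral_of_le hle]
    refine MeasureTheory.setIntegral_congr_fun measurableSet_Ioc fun y hy => ?_
    exact Real.norm_of_nonneg (hnonneg n y hy)
  have hsum := MeasureTheory.hasSum_integral_of_summable_integral_norm hmeas (by
    simp only [hnorm]
    exact ((summable_nat_add_iff 1).2 hs).mul_left _)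
  simp only [← intervalIntegral.integral_of_le hle, hint] at hsum
  have e1 : ∫ y in (0 : ℝ)..(Real.pi / 2), ∑' n, f n y = ∫ y in (0 : ℝ)..(Real.pi / 2),
      (Real.pi / 2 - y) * ((Real.cos ((2 * a - 1) * y) - Real.cos y) / Real.sin y) := by
    rw [intervalIntegral.integral_of_le hle, intervalIntegral.integral_of_le hle]
    refine MeasureTheory.setIntegral_congr_fun measurableSet_Ioc fun y hy => ?_
    rcases hy.2.lt_or_eq with h | h
    · have hy' : y ∈ Ioo 0 (Real.pi / 2) := ⟨hy.1, h⟩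
      have hsn := (sin_cos_pos hy').1
      have h2 := (hB.hasSum_succ (norm_lt_one_of_mem (sin_sq_mem hy'))).mul_left ((Real.pi / 2 - y) * Real.cos y / Real.sin y)
      refine (HasSum.tsum_eq ?_).trans (b := (Real.pi / 2 - y) * Real.cos y / Real.sin y *
        (psum (cosCoeff p) (Real.sin y ^ 2) - cosCoeff p 0)) ?_
      · refine h2.congr_fun fun n => ?_
        have e2 : Real.sin y ^ (2 * n + 1) = (Real.sin y ^ 2) ^ (n + 1) / Real.sin y := by
          rw [eq_div_iff hsn.ne', ← pow_mul, ← pow_succ]; rfl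
        simp only [hf, e2]
        ring
      · rw [← hcos hy', show cosCoeff p 0 = 1 from rfl]
        ring
    -- At y = π/2 the argument sin² y leaves the open unit disc, but the weight π/2 - y makes both
    -- sides zero.
    · simp [hf, h]
  rw [← e1, ← hsum.tsum_eq, tsum_mul_left, hs.tsum_eq_zero_add, Nat.cast_zero, div_zero, zero_add,
    ← mul_assoc, div_mul_div_cancel₀ hpi.ne', div_self four_ne_zero, one_mul]

/-- Jordan's inequality sin y ≥ 2y / π cancels the zero of the denominator against the linear bound
on h, so the kernel is bounded. -/
theorem integrableOn_kernel {h : ℝ → ℝ} {C : ℝ} (hh : Continuous h)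
    (hC : ∀ y ∈ Ioc 0 (Real.pi / 2), |h y| ≤ C * y) :
    MeasureTheory.IntegrableOn (fun y => (Real.pi / 2 - y) * (h y / Real.sin y))
      (Ioc 0 (Real.pi / 2)) := by
  have hpi := Real.pi_pos
  refine MeasureTheory.Measure.integrableOn_of_bounded
    (M := Real.pi / 2 * (C * (Real.pi / 2))) (by simp) (by
      refine Measurable.aestronglyMeasurable ?_
      have := hh.measurable
      fun_prop) ?_
  filter_upwards [MeasureTheory.ae_restrict_mem measurableSet_Ioc] with y hy
  have hs : 2 / Real.pi * y ≤ Real.sin y := Real.mul_le_sin hy.1.le hy.2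
  have hy0 := hy.1
  have hs0 : 0 < Real.sin y := lt_of_lt_of_le (by positivity) hs
  have hC' := hC y hy
  have hC0 : 0 ≤ C := by
    by_contra hneg
    have := (abs_nonneg _).trans hC'
    nlinarith
  rw [Real.norm_eq_abs, abs_mul, abs_div, abs_of_pos hs0, ← mul_div_assoc, div_le_iff₀ hs0,
    abs_of_nonneg (sub_nonneg.2 hy.2)]
  calc _ ≤ Real.pi / 2 * (C * y) := by gcongr; linarith
    _ = Real.pi / 2 * (C * (Real.pi / 2)) * (2 / Real.pi * y) := by field_simp
    _ ≤ _ := by gcongr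

theorem intervalIntegrable_cos_kernel (α β : ℝ) :
    IntervalIntegrable (fun y => (Real.pi / 2 - y) *
      ((Real.cos (α * y) - Real.cos (β * y)) / Real.sin y)) MeasureTheory.volume 0 (Real.pi / 2) := by
  rw [intervalIntegrable_iff_integrableOn_Ioc_of_le (by positivity)]
  refine integrableOn_kernel (C := |α - β|) (by fun_prop) fun y hy => ?_
  have h := Real.abs_sin_le_abs (x := (α * y - β * y) / 2)
  rw [Real.cos_sub_cos, abs_mul, abs_mul, abs_neg, abs_two]
  have h1 := Real.abs_sin_le_one ((α * y + β * y) / 2)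
  have e : |(α * y - β * y) / 2| = |α - β| * y / 2 := by
    rw [← sub_mul, abs_div, abs_mul, abs_of_pos hy.1, abs_two]
  rw [e] at h
  calc _ ≤ 2 * 1 * (|α - β| * y / 2) := by gcongr
    _ = _ := by ring

/-- The Riemann-Lebesgue lemma for the kernel that remains after telescoping. -/
theorem tendsto_integral_remainder (a : ℝ) :
    Tendsto (fun K : ℕ => ∫ y in (0 : ℝ)..(Real.pi / 2), (Real.pi / 2 - y) *
      ((Real.cos ((2 * (a + K) - 1) * y) - Real.cos ((2 * K + 1) * y)) / Real.sin y))
      atTop (𝓝 0) := by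
  have hpi := Real.pi_pos
  have hle : (0 : ℝ) ≤ Real.pi / 2 := by positivity
  -- The difference of cosines is 2 sin((2K + a) y) sin((1 - a) y): a fixed amplitude g times an
  -- oscillation of frequency (2K + a) / (2π), recovered below as minus the imaginary part of a
  -- Fourier integral.
  set g : ℝ → ℝ := fun y => (Real.pi / 2 - y) * (2 * Real.sin ((1 - a) * y)) / Real.sin y with hg
  have hgi : MeasureTheory.IntegrableOn g (Ioc 0 (Real.pi / 2)) := by
    refine (integrableOn_kernel (C := 2 * |1 - a|) (h := fun y => 2 * Real.sin ((1 - a) * y))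
      (by fun_prop) fun y hy => ?_).congr_fun (fun y _ => by simp only [hg, mul_div_assoc])
      measurableSet_Ioc
    have h1 : |Real.sin ((1 - a) * y)| ≤ |1 - a| * y := by
      refine Real.abs_sin_le_abs.trans ?_
      rw [abs_mul, abs_of_pos hy.1]
    rw [abs_mul, abs_two, mul_assoc]
    gcongr
  set f : ℝ → ℂ := (Ioc 0 (Real.pi / 2)).indicator (fun y => (g y : ℂ)) with hf
  have hfi : MeasureTheory.Integrable f :=
    (MeasureTheory.integrable_indicator_iff measurableSet_Ioc).2 hgi.ofReal
  have hw : Tendsto (fun K : ℕ => (2 * (K : ℝ) + a) / (2 * Real.pi)) atTop (cocompact ℝ) := by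
    refine Tendsto.mono_right ?_ atTop_le_cocompact
    refine Tendsto.atTop_div_const (by positivity) (tendsto_atTop_add_const_right _ _ ?_)
    exact tendsto_natCast_atTop_atTop.const_mul_atTop two_pos
  have hRL := (Complex.continuous_im.tendsto 0).comp
    ((Real.tendsto_integral_exp_smul_cocompact f).comp hw)
  have hRL' := hRL.neg
  simp only [Complex.zero_im, neg_zero] at hRL'
  refine hRL'.congr fun K => ?_
  simp only [Function.comp_apply]
  set w := (2 * (K : ℝ) + a) / (2 * Real.pi) with hwdef
  have hint : MeasureTheory.Integrable (fun v => Real.fourierChar (-(v * w)) • f v) := by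
    have := (Real.fourierIntegral_convergent_iff (μ := MeasureTheory.volume) (f := f) w).2 hfi
    simpa [mul_comm] using this
  rw [← Complex.imCLM_apply, ← ContinuousLinearMap.integral_comp_comm _ hint,
    ← MeasureTheory.integral_neg, intervalIntegral.integral_of_le hle,
    ← MeasureTheory.integral_indicator measurableSet_Ioc]
  congr 1
  funext y
  by_cases hy : y ∈ Ioc 0 (Real.pi / 2)
  · simp only [hf, indicator_of_mem hy, Circle.smul_def, Real.fourierChar_apply]
    have e : 2 * Real.pi * -(y * w) = -((2 * K + a) * y) := by
      rw [hwdef]; field_simp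
    rw [e, smul_eq_mul, Complex.imCLM_apply, Complex.im_mul_ofReal, Complex.exp_ofReal_mul_I_im,
      Real.sin_neg, Real.cos_sub_cos, hg]
    have e1 : ((2 * (a + K) - 1) * y + (2 * K + 1) * y) / 2 = (2 * K + a) * y := by ring
    have e2 : ((2 * (a + K) - 1) * y - (2 * K + 1) * y) / 2 = -((1 - a) * y) := by ring
    rw [e1, e2, Real.sin_neg]
    ring
  · simp [hf, indicator_of_notMem hy]

/-- The identity 2 sin(2by) sin y = cos((2b - 1) y) - cos((2b + 1) y), used for b = a + k and for b
= k + 1, telescopes the kernel into elementary integrals. Only the remainder covered by the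
Riemann-Lebesgue lemma is left. -/
theorem tendsto_tsum_frobA_div {a : ℝ} (ha : a ∈ Ioo (0 : ℝ) 1) :
    Tendsto (fun K : ℕ => ∑ k ∈ Finset.range K, ((2 / (a + k)
      - 2 / Real.pi * Real.sin (Real.pi * (a + k)) / (a + k) ^ 2) - 2 / ((k : ℝ) + 1)))
      atTop (𝓝 (∑' n : ℕ, frobA (a * (1 - a)) n / n)) := by
  have hpi := Real.pi_pos
  have h := ((tendsto_integral_remainder a).const_mul (4 / Real.pi)).const_sub
    (∑' n : ℕ, frobA (a * (1 - a)) n / n)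
  rw [mul_zero, sub_zero] at h
  refine h.congr fun K => ?_
  have e : ∀ y ∈ uIoc 0 (Real.pi / 2), (Real.pi / 2 - y) *
      ((Real.cos ((2 * a - 1) * y) - Real.cos y) / Real.sin y)
      = (Real.pi / 2 - y) * ((Real.cos ((2 * (a + K) - 1) * y)
        - Real.cos ((2 * K + 1) * y)) / Real.sin y)
      + ∑ k ∈ Finset.range K, ((Real.pi / 2 - y) * (2 * Real.sin (2 * (a + k) * y))
        - (Real.pi / 2 - y) * (2 * Real.sin (2 * ((k : ℝ) + 1) * y))) := by
    intro y hy
    rw [uIoc_of_le (by positivity)] at hy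
    have hs : Real.sin y ≠ 0 := by
      refine (Real.sin_pos_of_pos_of_lt_pi hy.1 (by linarith [hy.2])).ne'
    have e1 : ∀ b : ℝ, 2 * Real.sin (2 * b * y)
        = (Real.cos ((2 * b - 1) * y) - Real.cos ((2 * b + 1) * y)) / Real.sin y := by
      intro b
      rw [eq_div_iff hs, Real.cos_sub_cos, show ((2 * b - 1) * y + (2 * b + 1) * y) / 2 = 2 * b * y
        by ring, show ((2 * b - 1) * y - (2 * b + 1) * y) / 2 = -y by ring, Real.sin_neg]
      ring
    induction K with
    | zero => simp
    | succ K ih =>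
      rw [Finset.sum_range_succ, ih, e1, e1]
      push_cast
      have e2 : 2 * (a + (K : ℝ)) + 1 = 2 * (a + (K + 1)) - 1 := by ring
      have e3 : 2 * ((K : ℝ) + 1) - 1 = 2 * K + 1 := by ring
      rw [e2, e3]
      ring
  have ha0 := ha.1
  rw [tsum_frobA_div_eq_integral ha, ← mul_sub, intervalIntegral.integral_congr_ae (.of_forall e),
    intervalIntegral.integral_add (intervalIntegrable_cos_kernel _ _)
      (Continuous.intervalIntegrable (by fun_prop) _ _), add_sub_cancel_left,
    intervalIntegral.integral_finsetSum (fun k _ => Continuous.intervalIntegrable (by fun_prop) _ _),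
    Finset.mul_sum]
  refine Finset.sum_congr rfl fun k _ => ?_
  rw [intervalIntegral.integral_sub (Continuous.intervalIntegrable (by fun_prop) _ _)
    (Continuous.intervalIntegrable (by fun_prop) _ _), integral_sub_mul_sin (by positivity),
    integral_sub_mul_sin (by positivity)]
  have e4 : Real.sin (Real.pi * ((k : ℝ) + 1)) = 0 := by
    rw [mul_comm]; exact_mod_cast Real.sin_nat_mul_pi (k + 1)
  rw [e4, ← mul_sub, ← mul_assoc, div_mul_div_cancel₀ hpi.ne', div_self four_ne_zero]
  ring

/-- The value of `∑ Aₙ / n` in terms of an alternating series. -/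
theorem tendsto_frobD_sub_alternating {a : ℝ} (ha : a ∈ Ioo (0 : ℝ) 1) :
    Tendsto (fun K : ℕ => frobD (a * (1 - a)) K - Real.sin (Real.pi * a) / Real.pi *
      ∑ k ∈ Finset.range K, (-1 : ℝ) ^ k * (1 / ((k : ℝ) + a) ^ 2 + 1 / ((k : ℝ) + (1 - a)) ^ 2))
      atTop (𝓝 (∑' n : ℕ, frobA (a * (1 - a)) n / n)) := by
  have ha' := one_sub_mem ha
  -- The sum depends only on a (1 - a). Averaging the formulas for a and 1 - a turns the
  -- harmonic-type terms into exactly `frobD`.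
  have h2 := tendsto_tsum_frobA_div ha'
  rw [show (1 - a) * (1 - (1 - a)) = a * (1 - a) by ring] at h2
  have h := ((tendsto_tsum_frobA_div ha).add h2).div_const 2
  rw [add_self_div_two] at h
  refine h.congr fun K => ?_
  rw [frobD, Finset.mul_sum, ← Finset.sum_sub_distrib, ← Finset.sum_add_distrib, Finset.sum_div]
  refine Finset.sum_congr rfl fun k _ => ?_
  have h1 : (0 : ℝ) < a + k := by have := ha.1; positivity
  have h2 : (0 : ℝ) < 1 - a + k := by have := ha'.1; positivity
  have e1 : Real.sin (Real.pi * (a + k)) = (-1) ^ k * Real.sin (Real.pi * a) := by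
    rw [mul_add, mul_comm Real.pi (k : ℝ), Real.sin_add_nat_mul_pi]
  have e2 : Real.sin (Real.pi * (1 - a + k)) = (-1) ^ k * Real.sin (Real.pi * a) := by
    rw [mul_add, mul_comm Real.pi (k : ℝ), Real.sin_add_nat_mul_pi, mul_sub, mul_one,
      Real.sin_pi_sub]
  have e3 : (2 * (k : ℝ) + 1) / (k * (k + 1) + a * (1 - a)) = 1 / (a + k) + 1 / (1 - a + k) := by
    rw [div_add_div _ _ h1.ne' h2.ne']
    congr 1 <;> ring
  rw [e1, e2, e3, add_comm (k : ℝ) a, add_comm (k : ℝ) (1 - a)]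
  ring

end

/-! ### The values of the logarithmic constants -/

theorem tendsto_harmonic_mul_sub {m : ℕ} (hm : 0 < m) :
    Tendsto (fun n : ℕ => (harmonic (m * n) : ℝ) - harmonic n) atTop (𝓝 (Real.log m)) := by
  have h1 := Real.tendsto_harmonic_sub_log
  have h2 := h1.comp (tendsto_id.const_mul_atTop' hm)
  have h3 := (h2.sub h1).add_const (Real.log m)
  rw [sub_self, zero_add] at h3
  refine h3.congr' ?_
  filter_upwards [eventually_gt_atTop 0] with n hn
  have hm' : (m : ℝ) ≠ 0 := by positivity
  have hn' : (n : ℝ) ≠ 0 := by positivity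
  simp only [Function.comp_apply, id, Nat.cast_mul, Real.log_mul hm' hn']
  ring

/-- Here Dₙ = 4 (H₂ₙ - Hₙ): the fractions with denominator j + 1/2 are the odd reciprocals. The
limit is -log |μ|, as it is for each of the other three parameters. -/
theorem tendsto_frobD_half : Tendsto (frobD (1 / 4)) atTop (𝓝 (4 * Real.log 2)) := by
  refine ((tendsto_harmonic_mul_sub two_pos).const_mul 4).congr fun n => ?_
  induction n with
  | zero => simp [frobD_zero]
  | succ n ih =>
    rw [frobD_succ, ← ih, show 2 * (n + 1) = 2 * n + 1 + 1 by ring]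
    simp only [harmonic_succ]
    push_cast
    have h : (n : ℝ) * (n + 1) + 1 / 4 = (2 * n + 1) ^ 2 / 4 := by ring
    rw [h]
    field_simp
    ring

theorem tendsto_frobD_third : Tendsto (frobD (2 / 9)) atTop (𝓝 (3 * Real.log 3)) := by
  refine ((tendsto_harmonic_mul_sub three_pos).const_mul 3).congr fun n => ?_
  induction n with
  | zero => simp [frobD_zero]
  | succ n ih =>
    rw [frobD_succ, ← ih, show 3 * (n + 1) = 3 * n + 1 + 1 + 1 by ring]
    simp only [harmonic_succ]
    push_cast
    have h : (n : ℝ) * (n + 1) + 2 / 9 = (3 * n + 1) * (3 * n + 1 + 1) / 9 := by ring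
    rw [h]
    field_simp
    ring

/-- The terms 4 / (4j + 1) + 4 / (4j + 3) run over the odd denominators below 4n, so Dₙ = 4 H₄ₙ - 2
H₂ₙ - 2 Hₙ. -/
theorem tendsto_frobD_quarter : Tendsto (frobD (3 / 16)) atTop (𝓝 (6 * Real.log 2)) := by
  have h := ((tendsto_harmonic_mul_sub four_pos).const_mul 4).sub
    ((tendsto_harmonic_mul_sub two_pos).const_mul 2)
  have e : 4 * Real.log (4 : ℕ) - 2 * Real.log (2 : ℕ) = 6 * Real.log 2 := by
    have : ((4 : ℕ) : ℝ) = 2 ^ 2 := by norm_num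
    rw [this, Real.log_pow]; push_cast; ring
  rw [e] at h
  refine h.congr fun n => ?_
  clear h e
  induction n with
  | zero => simp [frobD_zero]
  | succ n ih =>
    rw [frobD_succ, ← ih, show 4 * (n + 1) = 4 * n + 1 + 1 + 1 + 1 by ring,
      show 2 * (n + 1) = 2 * n + 1 + 1 by ring]
    simp only [harmonic_succ]
    push_cast
    have h : (n : ℝ) * (n + 1) + 3 / 16 = (4 * n + 1) * (4 * n + 1 + 1 + 1) / 16 := by ring
    rw [h]
    field_simp
    ring

/-- Inclusion-exclusion over the denominators prime to 6 gives Dₙ = 6 H₆ₙ - 3 H₃ₙ - 2 H₂ₙ - Hₙ. -/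
theorem tendsto_frobD_sixth :
    Tendsto (frobD (5 / 36)) atTop (𝓝 (4 * Real.log 2 + 3 * Real.log 3)) := by
  have h := (((tendsto_harmonic_mul_sub (show 0 < 6 by norm_num)).const_mul 6).sub
    ((tendsto_harmonic_mul_sub three_pos).const_mul 3)).sub
    ((tendsto_harmonic_mul_sub two_pos).const_mul 2)
  have e : 6 * Real.log (6 : ℕ) - 3 * Real.log (3 : ℕ) - 2 * Real.log (2 : ℕ)
      = 4 * Real.log 2 + 3 * Real.log 3 := by
    have : ((6 : ℕ) : ℝ) = 2 * 3 := by norm_num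
    rw [this, Real.log_mul (by norm_num) (by norm_num)]; push_cast; ring
  rw [e] at h
  refine h.congr fun n => ?_
  clear h e
  induction n with
  | zero => simp [frobD_zero]
  | succ n ih =>
    rw [frobD_succ, ← ih, show 6 * (n + 1) = 6 * n + 1 + 1 + 1 + 1 + 1 + 1 by ring,
      show 3 * (n + 1) = 3 * n + 1 + 1 + 1 by ring, show 2 * (n + 1) = 2 * n + 1 + 1 by ring]
    simp only [harmonic_succ]
    push_cast
    have h : (n : ℝ) * (n + 1) + 5 / 36 = (6 * n + 1) * (6 * n + 1 + 1 + 1 + 1 + 1) / 36 := by ring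
    rw [h]
    field_simp
    ring

/-! ### Values of `L`-functions at `2` -/

/-- `∑_{k ≥ 0} 1 / (m k + r)²`. -/
noncomputable def progSum (m r : ℕ) : ℝ := ∑' k : ℕ, 1 / ((m : ℝ) * k + r) ^ 2

theorem hasSum_progSum {m : ℕ} (hm : 0 < m) (r : ℕ) :
    HasSum (fun k : ℕ => 1 / ((m : ℝ) * k + r) ^ 2) (progSum m r) := by
  refine Summable.hasSum ?_
  have hinj : Function.Injective fun k : ℕ => m * k + r := fun a b h => by
    simpa [hm.ne'] using h
  have := (Real.summable_one_div_nat_pow.2 one_lt_two).comp_injective hinj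
  refine this.congr fun k => ?_
  simp

theorem progSum_split_two {m : ℕ} (hm : 0 < m) (r : ℕ) :
    progSum m r = progSum (2 * m) r + progSum (2 * m) (r + m) := by
  have h1 := hasSum_progSum (m := 2 * m) (by omega) r
  have h2 := hasSum_progSum (m := 2 * m) (by omega) (r + m)
  refine (HasSum.even_add_odd (f := fun k : ℕ => 1 / ((m : ℝ) * k + r) ^ 2) ?_ ?_).tsum_eq
  · refine h1.congr_fun fun k => ?_
    push_cast; ring
  · refine h2.congr_fun fun k => ?_
    push_cast; ring

theorem progSum_split_three {m : ℕ} (hm : 0 < m) (r : ℕ) :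
    progSum m r = progSum (3 * m) r + progSum (3 * m) (r + m) + progSum (3 * m) (r + 2 * m) := by
  rw [progSum, Nat.sumByResidueClasses (hasSum_progSum hm r).summable 3]
  have e : ∀ j : ZMod 3, ∑' k : ℕ, 1 / ((m : ℝ) * ((j.val + 3 * k : ℕ) : ℝ) + r) ^ 2
      = progSum (3 * m) (r + j.val * m) := by
    intro j
    unfold progSum
    congr 1; funext k; push_cast; ring
  simp only [e]
  have := Fin.sum_univ_three (fun j : ZMod 3 => progSum (3 * m) (r + j.val * m))
  refine this.trans ?_
  simp [ZMod.val]

theorem progSum_scale {q : ℕ} (hq : 0 < q) (m r : ℕ) :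
    progSum (q * m) (q * r) = progSum m r / q ^ 2 := by
  have hq' : (q : ℝ) ≠ 0 := by positivity
  rw [progSum, progSum, ← tsum_div_const]
  congr 1; funext k
  push_cast
  rw [show (q : ℝ) * m * k + q * r = q * (m * k + r) by ring, mul_pow]
  rw [div_div, mul_comm]

/-- Even and odd k are the residues r and r + m modulo 2m. -/
theorem hasSum_alternating {m : ℕ} (hm : 0 < m) (r : ℕ) :
    HasSum (fun k : ℕ => (-1 : ℝ) ^ k * (1 / ((k : ℝ) + r / m) ^ 2))
      ((m : ℝ) ^ 2 * (progSum (2 * m) r - progSum (2 * m) (r + m))) := by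
  have h1 := (hasSum_progSum (m := 2 * m) (by omega) r).mul_left ((m : ℝ) ^ 2)
  have h2 := (hasSum_progSum (m := 2 * m) (by omega) (r + m)).mul_left (-(m : ℝ) ^ 2)
  rw [mul_sub, sub_eq_add_neg, ← neg_mul]
  have hm' : (m : ℝ) ≠ 0 := by positivity
  have e : ∀ k : ℝ, 1 / (k + r / m) ^ 2 = (m : ℝ) ^ 2 * (1 / (m * k + r) ^ 2) := by
    intro k
    rw [show k + r / m = (m * k + r) / m by field_simp, div_pow, one_div_div, mul_one_div]
  refine HasSum.even_add_odd (h1.congr_fun fun k => ?_) (h2.congr_fun fun k => ?_)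
  · rw [e, pow_mul]; push_cast; norm_num; left; ring
  · rw [e, pow_succ, pow_mul]; push_cast; norm_num; left; ring

/-- A periodic coefficient lets the absolutely convergent series be regrouped by residue classes. -/
theorem dirichletL_two_eq {a : ℤ} {N : ℕ} [NeZero N] (c : ZMod N → ℤ)
    (hc : ∀ n : ℕ, 0 < n → kroneckerSymbol a n = c n) :
    dirichletL a 2 = ((∑ j : ZMod N, (c j : ℝ) * progSum N j.val : ℝ) : ℂ) := by
  have hN : 0 < N := NeZero.pos N
  have e : ∀ n : ℕ, LSeries.term (fun n => (kroneckerSymbol a n : ℂ)) 2 n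
      = (((c n : ℝ) * (1 / (n : ℝ) ^ 2) : ℝ) : ℂ) := by
    intro n
    -- At n = 0 both sides are 0, the right one because 1 / 0 ^ 2 = 0; this is why `hc` is required
    -- only for positive n.
    rcases Nat.eq_zero_or_pos n with rfl | hn
    · simp
    · rw [LSeries.term_of_ne_zero hn.ne', hc n hn]
      push_cast
      rw [show ((2 : ℂ)) = ((2 : ℕ) : ℂ) by norm_num, Complex.cpow_natCast]
      ring
  rw [dirichletL, LSeries]
  simp only [e]
  rw [← Complex.ofReal_tsum]
  congr 1
  have hs : Summable fun n : ℕ => (c n : ℝ) * (1 / (n : ℝ) ^ 2) := by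
    obtain ⟨B, hB⟩ := (Set.finite_range fun j : ZMod N => |(c j : ℝ)|).bddAbove
    refine .of_norm_bounded ((Real.summable_one_div_nat_pow.2 one_lt_two).mul_left B) fun n => ?_
    rw [norm_mul, Real.norm_eq_abs, Real.norm_of_nonneg (by positivity : 0 ≤ 1 / (n : ℝ) ^ 2)]
    gcongr
    exact hB ⟨n, rfl⟩
  rw [Nat.sumByResidueClasses hs N]
  refine Finset.sum_congr rfl fun j _ => ?_
  rw [progSum, ← tsum_mul_left]
  congr 1; funext k
  push_cast
  simp only [ZMod.natCast_val, ZMod.cast_id', id, ZMod.natCast_self, zero_mul, add_zero]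
  rw [add_comm (N * k : ℝ)]

theorem kroneckerSymbol_of_odd (a : ℤ) {n : ℕ} (hn : Odd n) :
    kroneckerSymbol a n = jacobiSym a n := by
  have : n.factorization 2 = 0 := Nat.factorization_eq_zero_of_not_dvd
    (by rw [← even_iff_two_dvd]; exact Nat.not_even_iff_odd.2 hn)
  simp [kroneckerSymbol, this]

theorem kroneckerSymbol_of_even {a : ℤ} (ha : ZMod.χ₈ (a : ZMod 8) = 0) {n : ℕ} (hn : Even n)
    (h0 : 0 < n) : kroneckerSymbol a n = 0 := by
  have : n.factorization 2 ≠ 0 :=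
    (Nat.prime_two.factorization_pos_of_dvd h0.ne' hn.two_dvd).ne'
  rw [kroneckerSymbol, ha, zero_pow this, zero_mul]

theorem kroneckerSymbol_neg_four {n : ℕ} (hn : 0 < n) :
    kroneckerSymbol (-4) n = ZMod.χ₄ (n : ZMod 4) := by
  rcases Nat.even_or_odd n with h | h
  · rw [kroneckerSymbol_of_even (by decide) h hn, ZMod.χ₄_nat_eq_if_mod_four,
      if_pos (Nat.even_iff.1 h)]
  · rw [kroneckerSymbol_of_odd _ h, show (-4 : ℤ) = -1 * 2 ^ 2 by norm_num, jacobiSym.mul_left,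
      jacobiSym.at_neg_one h, jacobiSym.sq_one' (show Int.gcd 2 n = 1 from Nat.coprime_two_left.2 h), mul_one]

theorem kroneckerSymbol_neg_eight {n : ℕ} (hn : 0 < n) :
    kroneckerSymbol (-8) n = ZMod.χ₈' (n : ZMod 8) := by
  rcases Nat.even_or_odd n with h | h
  · rw [kroneckerSymbol_of_even (by decide) h hn, ZMod.χ₈'_nat_eq_if_mod_eight,
      if_pos (Nat.even_iff.1 h)]
  · rw [kroneckerSymbol_of_odd _ h, show (-8 : ℤ) = -2 * 2 ^ 2 by norm_num, jacobiSym.mul_left,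
      jacobiSym.at_neg_two h, jacobiSym.sq_one' (show Int.gcd 2 n = 1 from Nat.coprime_two_left.2 h), mul_one]

/-- The supplement for -1 and the reciprocity sign for 3 both equal χ₄(m), so they cancel. -/
theorem jacobiSym_neg_three {m : ℕ} (hm : Odd m) : jacobiSym (-3) m = jacobiSym m 3 := by
  have h1 : jacobiSym (3 : ℕ) m = qrSign m 3 * jacobiSym (m : ℕ) 3 :=
    jacobiSym.quadratic_reciprocity' (by decide) hm
  rw [show (-3 : ℤ) = -1 * (3 : ℕ) by norm_num, jacobiSym.mul_left, jacobiSym.at_neg_one hm, h1,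
    qrSign, ← mul_assoc]
  have h2 : ZMod.χ₄ (m : ZMod 4) = 1 ∨ ZMod.χ₄ (m : ZMod 4) = -1 := by
    rw [ZMod.χ₄_nat_eq_if_mod_four, if_neg (by rw [Nat.odd_iff.1 hm]; norm_num)]
    split_ifs <;> simp
  rcases h2 with h | h
  · rw [h]; simp
  · rw [h]
    have : jacobiSym (-1) 3 = -1 := by norm_num
    rw [this]; simp

/-- The value χ₈(-3) = -1 at the prime 2 agrees with (2 / 3). After reciprocity for the odd part,
the power of 2 and the odd part recombine by multiplicativity into (n / 3). -/
theorem kroneckerSymbol_neg_three {n : ℕ} (hn : 0 < n) :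
    kroneckerSymbol (-3) n = jacobiSym ((n : ZMod 3).val : ℤ) 3 := by
  have h8 : ZMod.χ₈ ((-3 : ℤ) : ZMod 8) = -1 := by decide
  have h2 : jacobiSym 2 3 = -1 := by norm_num
  have hodd : Odd (n / 2 ^ n.factorization 2) := by
    rw [← Nat.not_even_iff_odd, even_iff_two_dvd]
    exact Nat.not_dvd_ordCompl Nat.prime_two hn.ne'
  rw [kroneckerSymbol, h8, jacobiSym_neg_three hodd, ← h2, ← jacobiSym.pow_left,
    ← jacobiSym.mul_left, ZMod.val_natCast]
  have : (2 : ℤ) ^ n.factorization 2 * ((n / 2 ^ n.factorization 2 : ℕ) : ℤ) = n := by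
    exact_mod_cast Nat.ordProj_mul_ordCompl_eq_self n 2
  rw [this]
  push_cast
  exact jacobiSym.mod_left _ _

theorem dirichletL_neg_four : dirichletL (-4) 2 = ((progSum 4 1 - progSum 4 3 : ℝ) : ℂ) := by
  rw [dirichletL_two_eq (N := 4) (fun j => ZMod.χ₄ j)
    fun n hn => kroneckerSymbol_neg_four hn]
  congr 1
  refine (Fin.sum_univ_four _).trans ?_
  have h1 : ZMod.χ₄ (0 : Fin 4) = 0 := by decide
  have h2 : ZMod.χ₄ (1 : Fin 4) = 1 := by decide
  have h3 : ZMod.χ₄ (2 : Fin 4) = 0 := by decide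
  have h4 : ZMod.χ₄ (3 : Fin 4) = -1 := by decide
  simp [h1, h2, h3, h4, ZMod.val, sub_eq_add_neg]

theorem dirichletL_neg_three : dirichletL (-3) 2 = ((progSum 3 1 - progSum 3 2 : ℝ) : ℂ) := by
  rw [dirichletL_two_eq (N := 3) (fun j => jacobiSym (j.val : ℤ) 3)
    fun n hn => kroneckerSymbol_neg_three hn]
  congr 1
  refine (Fin.sum_univ_three _).trans ?_
  have h1 : jacobiSym 0 3 = 0 := by norm_num
  have h2 : jacobiSym 1 3 = 1 := by norm_num
  have h3 : jacobiSym 2 3 = -1 := by norm_num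
  simp [h1, h2, h3, ZMod.val, sub_eq_add_neg]

theorem dirichletL_neg_eight : dirichletL (-8) 2
    = ((progSum 8 1 + progSum 8 3 - progSum 8 5 - progSum 8 7 : ℝ) : ℂ) := by
  rw [dirichletL_two_eq (N := 8) (fun j => ZMod.χ₈' j)
    fun n hn => kroneckerSymbol_neg_eight hn]
  congr 1
  refine (Fin.sum_univ_eight _).trans ?_
  have h0 : ZMod.χ₈' (0 : Fin 8) = 0 := by decide
  have h1 : ZMod.χ₈' (1 : Fin 8) = 1 := by decide
  have h2 : ZMod.χ₈' (2 : Fin 8) = 0 := by decide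
  have h3 : ZMod.χ₈' (3 : Fin 8) = 1 := by decide
  have h4 : ZMod.χ₈' (4 : Fin 8) = 0 := by decide
  have h5 : ZMod.χ₈' (5 : Fin 8) = -1 := by decide
  have h6 : ZMod.χ₈' (6 : Fin 8) = 0 := by decide
  have h7 : ZMod.χ₈' (7 : Fin 8) = -1 := by decide
  simp [h0, h1, h2, h3, h4, h5, h6, h7, ZMod.val]
  ring

/-- The difference between the logarithmic constant and `∑ Aₙ / n` for rational `a = r / m`. -/
theorem sub_tsum_frobA_div {m r : ℕ} (hr : 0 < r) (hrm : r < m) {l : ℝ}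
    (hl : Tendsto (frobD ((r / m : ℝ) * (1 - r / m))) atTop (𝓝 l)) :
    l - ∑' n : ℕ, frobA ((r / m : ℝ) * (1 - r / m)) n / n
      = Real.sin (Real.pi * (r / m)) / Real.pi * ((m : ℝ) ^ 2 *
        (progSum (2 * m) r - progSum (2 * m) (r + m)
        + (progSum (2 * m) (m - r) - progSum (2 * m) (2 * m - r)))) := by
  have hm : 0 < m := by omega
  have hm' : (0 : ℝ) < m := by positivity
  have ha : (r / m : ℝ) ∈ Ioo (0 : ℝ) 1 :=
    ⟨by positivity, by rw [div_lt_one hm']; exact_mod_cast hrm⟩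
  have h1 := (hasSum_alternating hm r).add (hasSum_alternating hm (m - r))
  have h2 := hl.sub (h1.tendsto_sum_nat.const_mul (Real.sin (Real.pi * (r / m)) / Real.pi))
  have h3 := tendsto_nhds_unique (tendsto_frobD_sub_alternating ha) (h2.congr fun K => by
    congr 2
    refine Finset.sum_congr rfl fun k _ => ?_
    rw [Nat.cast_sub hrm.le, sub_div, div_self hm'.ne', mul_add])
  rw [h3, show m - r + m = 2 * m - r by omega]
  ring

/-! ### Solutions of the Picard-Fuchs equation in the coordinate `x = z / μ` -/

theorem mul_mem_interval {μ x : ℝ} (hμ : μ ≠ 0) (hx : x ∈ Ioo (0 : ℝ) 1) : μ * x ∈ interval μ := by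
  rcases hμ.lt_or_gt with h | h
  · rw [interval, min_eq_right h.le, max_eq_left h.le]
    exact ⟨by nlinarith [hx.2], by nlinarith [hx.1]⟩
  · rw [interval, min_eq_left h.le, max_eq_right h.le]
    exact ⟨by nlinarith [hx.1], by nlinarith [hx.2]⟩

theorem div_mem_of_mem_interval {μ z : ℝ} (hz : z ∈ interval μ) :
    z / μ ∈ Ioo (0 : ℝ) 1 := by
  rcases lt_trichotomy μ 0 with h | h | h
  · rw [interval, min_eq_right h.le, max_eq_left h.le] at hz
    exact ⟨div_pos_of_neg_of_neg hz.2 h, by rw [div_lt_one_of_neg h]; exact hz.1⟩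
  · subst h; simp [interval] at hz
  · rw [interval, min_eq_left h.le, max_eq_right h.le] at hz
    exact ⟨div_pos hz.1 h, by rw [div_lt_one h]; exact hz.2⟩

theorem theta_comp_mul (μ : ℝ) (y : ℝ → ℂ) :
    theta (fun x => y (μ * x)) = fun x => theta y (μ * x) := by
  funext x
  simp only [theta, deriv_comp_mul_left, Complex.real_smul]
  push_cast; ring

theorem thetaAdd_comp_mul (a μ : ℝ) (y : ℝ → ℂ) :
    thetaAdd a (fun x => y (μ * x)) = fun x => thetaAdd a y (μ * x) := by
  funext x
  simp only [thetaAdd, theta_comp_mul]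

theorem hypergeometricOp_comp_mul (a₁ a₂ : ℝ) {μ : ℝ} (hμ : μ ≠ 0) (y : ℝ → ℂ) (x : ℝ) :
    hypergeometricOp a₁ a₂ 1 (fun x => y (μ * x)) x = hypergeometricOp a₁ a₂ μ y (μ * x) := by
  have : (μ : ℂ) ≠ 0 := by exact_mod_cast hμ
  simp only [hypergeometricOp, theta_comp_mul, thetaAdd_comp_mul]
  push_cast
  field_simp

theorem eventually_nhds_of_nhdsGT {P : ℝ → Prop} (h : ∀ᶠ x in 𝓝[>] (0 : ℝ), P x) :
    ∀ᶠ x in 𝓝[>] (0 : ℝ), ∀ᶠ y in 𝓝 x, P y := by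
  obtain ⟨u, hu, hP⟩ := mem_nhdsGT_iff_exists_Ioo_subset.1 h
  filter_upwards [Ioo_mem_nhdsGT hu] with x hx
  exact mem_of_superset (Ioo_mem_nhds hx.1 hx.2) hP

theorem eventuallyEq_deriv_of_analytic {Y : ℝ → ℂ} {e : ℂ → ℂ} (he : AnalyticAt ℂ e 0)
    (h : ∀ᶠ x : ℝ in 𝓝[>] 0, Y x = e x) : ∀ᶠ x : ℝ in 𝓝[>] 0, deriv Y x = deriv e x := by
  have hc : Tendsto (fun x : ℝ => (x : ℂ)) (𝓝[>] 0) (𝓝 0) := by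
    have := (Complex.continuous_ofReal.tendsto 0).mono_left (nhdsWithin_le_nhds (s := Ioi 0))
    simpa using this
  filter_upwards [eventually_nhds_of_nhdsGT h, hc.eventually he.eventually_analyticAt]
    with x hx hxa
  rw [Filter.EventuallyEq.deriv_eq hx]
  exact hxa.differentiableAt.hasDerivAt.comp_ofReal.deriv

theorem AnalyticAt.tendsto_ofReal {e : ℂ → ℂ} (he : AnalyticAt ℂ e 0) :
    Tendsto (fun x : ℝ => e x) (𝓝[>] 0) (𝓝 (e 0)) := by
  have hc : Tendsto (fun x : ℝ => (x : ℂ)) (𝓝[>] 0) (𝓝 0) := by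
    have := (Complex.continuous_ofReal.tendsto 0).mono_left (nhdsWithin_le_nhds (s := Ioi 0))
    simpa using this
  exact he.continuousAt.tendsto.comp hc

/-- `Y` is a primitive, with respect to `dx / x`, of a solution of the hypergeometric equation. -/
structure IsPrimSol (p : ℝ) (Y w q : ℝ → ℂ) : Prop where
  sol : IsSol p w q
  hasDerivAt : ∀ x ∈ Ioo (0 : ℝ) 1, HasDerivAt Y (w x / x) x

section
variable {p : ℝ} {Y w q Y' w' q' : ℝ → ℂ}

theorem IsPrimSol.sub (h : IsPrimSol p Y w q) (h' : IsPrimSol p Y' w' q') :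
    IsPrimSol p (fun x => Y x - Y' x) (fun x => w x - w' x) (fun x => q x - q' x) :=
  ⟨h.sol.sub h'.sol, fun x hx => ((h.hasDerivAt x hx).sub (h'.hasDerivAt x hx)).congr_deriv
    (sub_div _ _ _).symm⟩

theorem ofReal_ne_zero_of_mem {x : ℝ} (hx : x ∈ Ioo (0 : ℝ) 1) : (x : ℂ) ≠ 0 ∧ 1 - (x : ℂ) ≠ 0 := by
  refine ⟨by exact_mod_cast hx.1.ne', ?_⟩
  have := (one_sub_mem hx).1.ne'
  exact_mod_cast this

theorem IsSol.q_eq (h : IsSol p w q) {x : ℝ} (hx : x ∈ Ioo (0 : ℝ) 1) :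
    q x = x * (1 - x) * deriv w x := by
  obtain ⟨h0, h1⟩ := ofReal_ne_zero_of_mem hx
  rw [(h.deriv_w x hx).deriv, Complex.real_smul]
  push_cast
  field_simp

theorem IsPrimSol.w_eq (h : IsPrimSol p Y w q) {x : ℝ} (hx : x ∈ Ioo (0 : ℝ) 1) :
    w x = x * deriv Y x := by
  obtain ⟨h0, h1⟩ := ofReal_ne_zero_of_mem hx
  rw [(h.hasDerivAt x hx).deriv]
  field_simp

theorem IsPrimSol.exists_const (h : IsPrimSol p Y w q) (hw : ∀ x ∈ Ioo (0 : ℝ) 1, w x = 0) :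
    ∃ c, ∀ x ∈ Ioo (0 : ℝ) 1, Y x = c :=
  exists_const_of_hasDerivAt_zero fun x hx => by simpa [hw x hx] using h.hasDerivAt x hx

/-- A solution that is a power series near `0` solves the first order system with zero initial
values, hence vanishes. -/
theorem IsSol.eq_zero_of_analytic (hp : 0 < p) (hp' : p ≤ 1 / 4) (h : IsSol p w q) {e : ℂ → ℂ}
    (he : AnalyticAt ℂ e 0) (h0 : e 0 = 0) (hw : ∀ᶠ x : ℝ in 𝓝[>] 0, w x = e x) :
    ∀ x ∈ Ioo (0 : ℝ) 1, w x = 0 := by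
  have hmem : ∀ᶠ x : ℝ in 𝓝[>] 0, x ∈ Ioo (0 : ℝ) 1 := Ioo_mem_nhdsGT one_pos
  refine h.eq_zero hp hp' ?_ ?_
  · refine (h0 ▸ AnalyticAt.tendsto_ofReal he).congr' ?_
    filter_upwards [hw] with x hx using hx.symm
  · have hid : AnalyticAt ℂ (fun z : ℂ => z) 0 := analyticAt_id
    have ha : AnalyticAt ℂ (fun z => z * (1 - z) * deriv e z) 0 :=
      (hid.mul (analyticAt_const.sub hid)).mul he.deriv
    have := AnalyticAt.tendsto_ofReal ha
    simp only [zero_mul] at this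
    refine this.congr' ?_
    filter_upwards [eventuallyEq_deriv_of_analytic he hw, hmem] with x hx hx'
    rw [h.q_eq hx', hx]

theorem IsPrimSol.eq_zero_at_zero (hp : 0 < p) (hp' : p ≤ 1 / 4) (h : IsPrimSol p Y w q)
    {e : ℂ → ℂ} (he : AnalyticAt ℂ e 0) (h0 : e 0 = 0) (hY : ∀ᶠ x : ℝ in 𝓝[>] 0, Y x = e x) :
    ∀ x ∈ Ioo (0 : ℝ) 1, Y x = 0 := by
  have hmem : ∀ᶠ x : ℝ in 𝓝[>] 0, x ∈ Ioo (0 : ℝ) 1 := Ioo_mem_nhdsGT one_pos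
  have hid : AnalyticAt ℂ (fun z : ℂ => z) 0 := analyticAt_id
  have hw := h.sol.eq_zero_of_analytic hp hp' (hid.mul he.deriv) (by simp) (by
    filter_upwards [eventuallyEq_deriv_of_analytic he hY, hmem] with x hx hx'
    rw [h.w_eq hx', hx]; rfl)
  obtain ⟨c, hc⟩ := h.exists_const hw
  have hc0 : c = 0 := by
    refine tendsto_nhds_unique (tendsto_const_nhds.congr' ?_) (h0 ▸ AnalyticAt.tendsto_ofReal he)
    filter_upwards [hmem, hY] with x hx hx'
    rw [← hx', hc x hx]
  exact fun x hx => (hc x hx).trans hc0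

theorem deriv_reflect (Y : ℝ → ℂ) (x : ℝ) :
    deriv (fun t => Y (1 - t)) x = -deriv Y (1 - x) := by
  simpa using deriv_comp_const_sub (f := Y) 1 x

/-- At x = 1 the θ-derivative tends to -e'(0). So, unlike at 0, the linear coefficient must vanish
too: ν itself is analytic and zero at δ = 0. -/
theorem IsPrimSol.eq_zero_at_one (hp : 0 < p) (hp' : p ≤ 1 / 4) (h : IsPrimSol p Y w q)
    {e : ℂ → ℂ} (he : AnalyticAt ℂ e 0) (h0 : e 0 = 0) (h1 : deriv e 0 = 0)
    (hY : ∀ᶠ x : ℝ in 𝓝[>] 0, Y (1 - x) = e x) :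
    ∀ x ∈ Ioo (0 : ℝ) 1, Y x = 0 := by
  have hmem : ∀ᶠ x : ℝ in 𝓝[>] 0, x ∈ Ioo (0 : ℝ) 1 := Ioo_mem_nhdsGT one_pos
  have hid : AnalyticAt ℂ (fun z : ℂ => z) 0 := analyticAt_id
  have hw := h.sol.reflect.eq_zero_of_analytic hp hp' (e := fun z => -((1 - z) * deriv e z))
    ((analyticAt_const.sub hid).mul he.deriv).neg (by simp [h1]) (by
    filter_upwards [eventuallyEq_deriv_of_analytic (Y := fun x => Y (1 - x)) he hY, hmem]
      with x hx hx'
    rw [h.w_eq (one_sub_mem hx'), ← hx, deriv_reflect]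
    push_cast; ring)
  obtain ⟨c, hc⟩ := h.exists_const fun x hx => by
    simpa using hw (1 - x) (one_sub_mem hx)
  have hc0 : c = 0 := by
    refine tendsto_nhds_unique (tendsto_const_nhds.congr' ?_) (h0 ▸ AnalyticAt.tendsto_ofReal he)
    filter_upwards [hmem, hY] with x hx hx'
    rw [← hx', hc _ (one_sub_mem hx)]
  exact fun x hx => (hc x hx).trans hc0

/-- Bootstrapping: the first order system expresses w' and q' smoothly through q and w. -/
theorem IsSol.contDiffOn (h : IsSol p w q) (n : ℕ) :
    ContDiffOn ℝ n w (Ioo 0 1) ∧ ContDiffOn ℝ n q (Ioo 0 1) := by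
  induction n with
  | zero =>
    simp only [Nat.cast_zero, contDiffOn_zero]
    exact ⟨fun x hx => (h.deriv_w x hx).continuousAt.continuousWithinAt,
      fun x hx => (h.deriv_q x hx).continuousAt.continuousWithinAt⟩
  | succ n ih =>
    have hdw : DifferentiableOn ℝ w (Ioo 0 1) := fun x hx =>
      (h.deriv_w x hx).differentiableAt.differentiableWithinAt
    have hdq : DifferentiableOn ℝ q (Ioo 0 1) := fun x hx =>
      (h.deriv_q x hx).differentiableAt.differentiableWithinAt
    push_cast
    rw [contDiffOn_succ_iff_deriv_of_isOpen isOpen_Ioo, contDiffOn_succ_iff_deriv_of_isOpen isOpen_Ioo]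
    refine ⟨⟨hdw, by simp, ?_⟩, ⟨hdq, by simp, ?_⟩⟩
    · refine ContDiffOn.congr (f := fun x => (x * (1 - x))⁻¹ • q x) ?_
        fun x hx => (h.deriv_w x hx).deriv
      have hc : ContDiffOn ℝ n (fun x : ℝ => x * (1 - x)) (Ioo 0 1) := by fun_prop
      refine ContDiffOn.smul (hc.inv fun x hx => ?_) ih.2
      exact (mul_pos hx.1 (one_sub_mem hx).1).ne'
    · exact ContDiffOn.congr (ih.1.const_smul p) fun x hx => (h.deriv_q x hx).deriv

theorem theta_eqOn {y y' : ℝ → ℂ} {s : Set ℝ} (hs : IsOpen s) (h : EqOn y y' s) :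
    EqOn (theta y) (theta y') s := fun x hx => by
  simp only [theta]
  rw [Filter.EventuallyEq.deriv_eq (h.eventuallyEq_of_mem (hs.mem_nhds hx))]

theorem thetaAdd_eqOn {a : ℝ} {y y' : ℝ → ℂ} {s : Set ℝ} (hs : IsOpen s) (h : EqOn y y' s) :
    EqOn (thetaAdd a y) (thetaAdd a y') s := fun x hx => by
  simp only [thetaAdd, theta_eqOn hs h hx, h hx]

theorem hypergeometricOp_one_eq {a₁ a₂ : ℝ} (h1 : a₁ + a₂ = 1) {y : ℝ → ℂ} {x : ℝ}
    (hy : DifferentiableAt ℝ y x) (hy' : DifferentiableAt ℝ (theta y) x) :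
    hypergeometricOp a₁ a₂ 1 y x
      = (1 - x) * theta (theta y) x - x * theta y x - (a₁ * a₂ : ℝ) * x * y x := by
  have e : theta (thetaAdd a₂ y) x = theta (theta y) x + a₂ * theta y x := by
    have h2 := hy'.hasDerivAt.add (hy.hasDerivAt.const_mul (a₂ : ℂ))
    have h3 : deriv (thetaAdd a₂ y) x = _ := h2.deriv
    rw [theta, h3]
    simp only [theta]; ring
  have h1' : (a₁ : ℂ) + a₂ = 1 := by exact_mod_cast h1
  simp only [hypergeometricOp]
  rw [thetaAdd, e, thetaAdd]
  push_cast
  linear_combination -(x : ℂ) * theta y x * h1'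

theorem IsSol.hypergeometricOp_eq_zero {a₁ a₂ : ℝ} (h1 : a₁ + a₂ = 1)
    (h : IsSol (a₁ * a₂) w q) {x : ℝ} (hx : x ∈ Ioo (0 : ℝ) 1) :
    hypergeometricOp a₁ a₂ 1 w x = 0 := by
  have hth : EqOn (theta w) (fun x => (1 - (x : ℂ))⁻¹ * q x) (Ioo 0 1) := fun x hx => by
    obtain ⟨h0, h1⟩ := ofReal_ne_zero_of_mem hx
    simp only
    rw [h.q_eq hx, theta]
    field_simp
  obtain ⟨h0, h1'⟩ := ofReal_ne_zero_of_mem hx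
  have hd : HasDerivAt (fun x : ℝ => (1 - (x : ℂ))⁻¹ * q x) _ x :=
    (((hasDerivAt_id x).ofReal_comp.const_sub 1).fun_inv h1').mul (h.deriv_q x hx)
  have hd' := hd.congr_of_eventuallyEq (hth.eventuallyEq_of_mem (isOpen_Ioo.mem_nhds hx))
  rw [hypergeometricOp_one_eq h1 (h.deriv_w x hx).differentiableAt hd'.differentiableAt, hth hx]
  rw [theta, hd'.deriv, Complex.real_smul]
  simp only [id, Complex.ofReal_one]
  field_simp
  push_cast
  ring

/-- As a₁ + a₂ = 1, the operator is θ((1 - x) θw) - p x w up to rearrangement, so q = (1 - x) θw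
satisfies q' = p w. -/
theorem isSol_of_hypergeometricOp {a₁ a₂ : ℝ} (h1 : a₁ + a₂ = 1)
    (hw : ContDiffOn ℝ 2 w (Ioo 0 1)) (h : ∀ x ∈ Ioo (0 : ℝ) 1, hypergeometricOp a₁ a₂ 1 w x = 0) :
    IsSol (a₁ * a₂) w (fun x => (1 - x) * theta w x) := by
  have hd : ∀ x ∈ Ioo (0 : ℝ) 1, DifferentiableAt ℝ w x := fun x hx =>
    ((hw.differentiableOn (by norm_num)) x hx).differentiableAt (isOpen_Ioo.mem_nhds hx)
  have hdd : ContDiffOn ℝ 1 (deriv w) (Ioo 0 1) :=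
    hw.deriv_of_isOpen isOpen_Ioo (by norm_num)
  have hdd' : ∀ x ∈ Ioo (0 : ℝ) 1, DifferentiableAt ℝ (theta w) x := fun x hx => by
    have h2 : DifferentiableAt ℝ (deriv w) x :=
      ((hdd.differentiableOn (by norm_num)) x hx).differentiableAt (isOpen_Ioo.mem_nhds hx)
    exact (hasDerivAt_id x).ofReal_comp.differentiableAt.mul h2
  refine ⟨fun x hx => ?_, fun x hx => ?_⟩
  · obtain ⟨h0, h1'⟩ := ofReal_ne_zero_of_mem hx
    refine (hd x hx).hasDerivAt.congr_deriv ?_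
    rw [Complex.real_smul, theta]
    push_cast
    field_simp
  · obtain ⟨h0, h1'⟩ := ofReal_ne_zero_of_mem hx
    have h2 := ((hasDerivAt_id x).ofReal_comp.const_sub 1).mul (hdd' x hx).hasDerivAt
    refine h2.congr_deriv ?_
    have e := h x hx
    rw [hypergeometricOp_one_eq h1 (hd x hx) (hdd' x hx)] at e
    have e2 : theta (theta w) x = x * deriv (theta w) x := rfl
    rw [e2] at e
    rw [Complex.real_smul]
    simp only [id, Complex.ofReal_one]
    refine mul_left_cancel₀ h0 ?_
    linear_combination e

theorem isPrimSol_of_isPicardFuchsSolution {a₁ a₂ μ : ℝ} (hμ : μ ≠ 0) (h1 : a₁ + a₂ = 1)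
    {y : ℝ → ℂ} (h : IsPicardFuchsSolution a₁ a₂ μ y) :
    ∃ w q, IsPrimSol (a₁ * a₂) (fun x => y (μ * x)) w q := by
  have hY : ContDiffOn ℝ 3 (fun x => y (μ * x)) (Ioo 0 1) :=
    h.1.comp (by fun_prop) fun x hx => mul_mem_interval hμ hx
  have hd : ContDiffOn ℝ 2 (deriv fun x => y (μ * x)) (Ioo 0 1) :=
    hY.deriv_of_isOpen isOpen_Ioo (by norm_num)
  have hth : ContDiffOn ℝ 2 (theta fun x => y (μ * x)) (Ioo 0 1) := by
    refine ContDiffOn.mul ?_ hd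
    exact Complex.ofRealCLM.contDiff.contDiffOn
  refine ⟨_, _, isSol_of_hypergeometricOp h1 hth fun x hx => ?_, fun x hx => ?_⟩
  · rw [theta_comp_mul, hypergeometricOp_comp_mul _ _ hμ]
    exact h.2 _ (mul_mem_interval hμ hx)
  · obtain ⟨h0, -⟩ := ofReal_ne_zero_of_mem hx
    have := ((hY.differentiableOn (by norm_num)) x hx).differentiableAt (isOpen_Ioo.mem_nhds hx)
    refine this.hasDerivAt.congr_deriv ?_
    rw [theta]
    field_simp

theorem IsPrimSol.isPicardFuchsSolution {a₁ a₂ μ : ℝ} (hμ : μ ≠ 0) (h1 : a₁ + a₂ = 1)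
    (h : IsPrimSol (a₁ * a₂) Y w q) : IsPicardFuchsSolution a₁ a₂ μ (fun z => Y (z / μ)) := by
  have hY : ContDiffOn ℝ 3 Y (Ioo 0 1) := by
    rw [show (3 : WithTop ℕ∞) = 2 + 1 by norm_num, contDiffOn_succ_iff_deriv_of_isOpen isOpen_Ioo]
    refine ⟨fun x hx => (h.hasDerivAt x hx).differentiableAt.differentiableWithinAt, by simp, ?_⟩
    refine ContDiffOn.congr (f := fun x => x⁻¹ • w x) ?_ fun x hx => ?_
    · exact ContDiffOn.smul (contDiffOn_id.inv fun x hx => hx.1.ne') (h.sol.contDiffOn 2).1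
    · rw [(h.hasDerivAt x hx).deriv, Complex.real_smul, Complex.ofReal_inv, div_eq_inv_mul]
  refine ⟨hY.comp (by fun_prop) fun z hz => div_mem_of_mem_interval hz, fun z hz => ?_⟩
  have hx := div_mem_of_mem_interval hz
  have e : (fun x => (fun z => Y (z / μ)) (μ * x)) = Y := by
    funext x; simp only; rw [mul_div_cancel_left₀ _ hμ]
  have e2 := hypergeometricOp_comp_mul a₁ a₂ hμ (theta fun z => Y (z / μ)) (z / μ)
  rw [mul_div_cancel₀ _ hμ, ← theta_comp_mul, e] at e2
  rw [picardFuchsOp, ← e2]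
  have hth : EqOn (theta Y) w (Ioo 0 1) := fun x hx => (h.w_eq hx).symm
  have h2 := h.sol.hypergeometricOp_eq_zero h1 hx
  have hth3 := thetaAdd_eqOn (a := a₁) isOpen_Ioo (thetaAdd_eqOn (a := a₂) isOpen_Ioo hth)
  rw [← h2, hypergeometricOp, hypergeometricOp,
    theta_eqOn isOpen_Ioo (theta_eqOn isOpen_Ioo hth) hx, hth3 hx]

end

/-! ### The Frobenius bases at `0` and at the conifold point -/

theorem psum_nat_mul_div {c : ℕ → ℝ} (hc : PolyBdd c) {x : ℝ} (hx : ‖x‖ < 1) :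
    psum (fun n : ℕ => n * (c n / n)) x = psum c x - c 0 := by
  have h1 := hc.div_nat.nat_mul.hasSum_succ hx
  simp only [Nat.cast_zero, zero_mul, sub_zero] at h1
  refine h1.unique ((hc.hasSum_succ hx).congr_fun fun n => ?_)
  have : ((n + 1 : ℕ) : ℝ) ≠ 0 := by positivity
  field_simp

/-- Partial sums divide a series by 1 - x; the factor x appears because the sum over `range n` stops
at n - 1. -/
theorem one_sub_mul_psum_sum {c : ℕ → ℝ} (hc : PolyBdd c) {x : ℝ} (hx : ‖x‖ < 1) :
    (1 - x) * psum (fun n => ∑ k ∈ Finset.range n, c k) x = x * psum c x := by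
  have h : psum (fun n => ∑ k ∈ Finset.range n, c k) x
      = x * psum c x + x * psum (fun n => ∑ k ∈ Finset.range n, c k) x := by
    rw [← psum_shift hc hx, ← psum_shift hc.sum_range hx, ← psum_add hc.shift hc.sum_range.shift hx]
    congr 1
    funext n
    cases n with
    | zero => simp [shift]
    | succ n => simp only [shift]; rw [Finset.sum_range_succ, add_comm]
  linear_combination h

/-- The coefficients of `f₀`. -/
noncomputable def coeffF₀ (p : ℝ) (n : ℕ) : ℝ := frobA p n / n

/-- The coefficients of `f₁`. -/
noncomputable def coeffF₁ (p : ℝ) (n : ℕ) : ℝ := (frobG p n - coeffF₀ p n) / n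

/-- The coefficients of `ν`. -/
noncomputable def coeffNu (p : ℝ) (n : ℕ) : ℝ := (∑ k ∈ Finset.range n, frobA p k) / n

/-- The coefficients of the regular part of the logarithmic solution at the conifold point. -/
noncomputable def coeffCon (p : ℝ) (n : ℕ) : ℝ :=
  (∑ k ∈ Finset.range n, (frobG p k + frobA p k) - coeffNu p n) / n

/-- The Frobenius basis at `0`, in the coordinate `x = z / μ` and with `L = log μ`. -/
noncomputable def perZero (p : ℝ) (L : ℂ) (x : ℝ) : Fin 3 → ℂ :=
  ![1, Real.log x + L + (psum (coeffF₀ p) x : ℝ),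
    1 / 2 * (Real.log x + L) ^ 2 + (psum (coeffF₀ p) x : ℝ) * (Real.log x + L)
      + (psum (coeffF₁ p) x : ℝ)]

/-- The Frobenius basis at the conifold point, in the coordinate `x = z / μ`. -/
noncomputable def perCon (p : ℝ) (x : ℝ) : Fin 3 → ℂ :=
  ![1, (psum (coeffNu p) (1 - x) : ℝ),
    (psum (coeffNu p) (1 - x) * Real.log (1 - x) + psum (coeffCon p) (1 - x) : ℝ)]

section
variable {p : ℝ}

theorem polyBdd_coeffF₀ (hp : 0 < p) (hp' : p ≤ 1 / 4) : PolyBdd (coeffF₀ p) :=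
  (polyBdd_frobA hp hp').div_nat

theorem polyBdd_coeffF₁ (hp : 0 < p) (hp' : p ≤ 1 / 4) : PolyBdd (coeffF₁ p) :=
  ((polyBdd_frobG hp hp').sub (polyBdd_coeffF₀ hp hp')).div_nat

theorem polyBdd_coeffNu (hp : 0 < p) (hp' : p ≤ 1 / 4) : PolyBdd (coeffNu p) :=
  (polyBdd_frobA hp hp').sum_range.div_nat

theorem polyBdd_coeffCon (hp : 0 < p) (hp' : p ≤ 1 / 4) : PolyBdd (coeffCon p) :=
  (((polyBdd_frobG hp hp').add (polyBdd_frobA hp hp')).sum_range.sub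
    (polyBdd_coeffNu hp hp')).div_nat

theorem coeffF₀_zero (p : ℝ) : coeffF₀ p 0 = 0 := by simp [coeffF₀]
theorem coeffF₁_zero (p : ℝ) : coeffF₁ p 0 = 0 := by simp [coeffF₁]
theorem coeffNu_zero (p : ℝ) : coeffNu p 0 = 0 := by simp [coeffNu]
theorem coeffNu_one (p : ℝ) : coeffNu p 1 = 1 := by simp [coeffNu, frobA_zero]
theorem coeffCon_zero (p : ℝ) : coeffCon p 0 = 0 := by simp [coeffCon]
theorem coeffCon_one (p : ℝ) : coeffCon p 1 = 0 := by
  simp [coeffCon, coeffNu_one, frobA_zero, frobG_zero]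

theorem hasDerivAt_psum_coeffF₀ (hp : 0 < p) (hp' : p ≤ 1 / 4) {x : ℝ} (hx : x ∈ Ioo (0 : ℝ) 1) :
    HasDerivAt (psum (coeffF₀ p)) ((solF p x - 1) / x) x := by
  refine (hasDerivAt_psum' (polyBdd_coeffF₀ hp hp') (norm_lt_one_of_mem hx) hx.1.ne').congr_deriv ?_
  unfold coeffF₀
  rw [psum_nat_mul_div (polyBdd_frobA hp hp') (norm_lt_one_of_mem hx), frobA_zero, solF]

theorem hasDerivAt_psum_coeffF₁ (hp : 0 < p) (hp' : p ≤ 1 / 4) {x : ℝ} (hx : x ∈ Ioo (0 : ℝ) 1) :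
    HasDerivAt (psum (coeffF₁ p)) ((psum (frobG p) x - psum (coeffF₀ p) x) / x) x := by
  have hG := polyBdd_frobG hp hp'
  have h0 := polyBdd_coeffF₀ hp hp'
  refine (hasDerivAt_psum' (polyBdd_coeffF₁ hp hp') (norm_lt_one_of_mem hx) hx.1.ne').congr_deriv ?_
  unfold coeffF₁
  rw [psum_nat_mul_div (hG.sub h0) (norm_lt_one_of_mem hx), psum_sub hG h0 (norm_lt_one_of_mem hx)]
  simp [frobG_zero, coeffF₀_zero]

/-- In δ = 1 - x one has θ = -(1 - δ) d/dδ, so a primitive of F(δ) for dx / x has δ-derivative F(δ)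
/ (1 - δ) up to sign. This accounts for the partial sums and the division by n in the coefficients
of ν. -/
theorem hasDerivAt_psum_coeffNu (hp : 0 < p) (hp' : p ≤ 1 / 4) {x : ℝ} (hx : x ∈ Ioo (0 : ℝ) 1) :
    HasDerivAt (psum (coeffNu p)) (solF p x / (1 - x)) x := by
  have hA := polyBdd_frobA hp hp'
  refine (hasDerivAt_psum' (polyBdd_coeffNu hp hp') (norm_lt_one_of_mem hx) hx.1.ne').congr_deriv ?_
  have h := one_sub_mul_psum_sum hA (norm_lt_one_of_mem hx)
  have h0 := hx.1.ne'
  have h1 := (one_sub_mem hx).1.ne'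
  unfold coeffNu
  rw [psum_nat_mul_div hA.sum_range (norm_lt_one_of_mem hx)]
  simp only [Finset.range_zero, Finset.sum_empty, sub_zero, solF]
  rw [div_eq_div_iff h0 h1]
  linear_combination h

theorem hasDerivAt_psum_coeffCon (hp : 0 < p) (hp' : p ≤ 1 / 4) {x : ℝ} (hx : x ∈ Ioo (0 : ℝ) 1) :
    HasDerivAt (psum (coeffCon p))
      ((psum (frobG p) x + solF p x) / (1 - x) - psum (coeffNu p) x / x) x := by
  have hA := polyBdd_frobA hp hp'
  have hG := polyBdd_frobG hp hp'
  have hN := polyBdd_coeffNu hp hp'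
  have hn := norm_lt_one_of_mem hx
  refine (hasDerivAt_psum' (polyBdd_coeffCon hp hp') hn hx.1.ne').congr_deriv ?_
  have h := one_sub_mul_psum_sum (hG.add hA) hn
  rw [psum_add hG hA hn] at h
  have h0 := hx.1.ne'
  have h1 := (one_sub_mem hx).1.ne'
  unfold coeffCon
  rw [psum_nat_mul_div ((hG.add hA).sum_range.sub hN) hn, psum_sub (hG.add hA).sum_range hN hn]
  simp only [Finset.range_zero, Finset.sum_empty, sub_zero, solF, coeffNu_zero]
  field_simp
  linear_combination h

theorem isPrimSol_one (p : ℝ) : IsPrimSol p (fun _ => 1) (fun _ => 0) (fun _ => 0) :=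
  ⟨⟨fun x _ => by simpa using hasDerivAt_const x (0 : ℂ),
    fun x _ => by simpa using hasDerivAt_const x (0 : ℂ)⟩,
   fun x _ => by simpa using hasDerivAt_const x (1 : ℂ)⟩

theorem isPrimSol_perZero_one (hp : 0 < p) (hp' : p ≤ 1 / 4) (L : ℂ) :
    IsPrimSol p (fun x => perZero p L x 1) (fun x => (solF p x : ℂ)) (fun x => (solF' p x : ℂ)) := by
  refine ⟨(isSol_solF hp hp').ofReal, fun x hx => ?_⟩
  have h := ((Real.hasDerivAt_log hx.1.ne').ofReal_comp.add_const L).add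
    (hasDerivAt_psum_coeffF₀ hp hp' hx).ofReal_comp
  refine h.congr_deriv ?_
  obtain ⟨h0, -⟩ := ofReal_ne_zero_of_mem hx
  push_cast
  field_simp
  ring

theorem isPrimSol_perZero_two (hp : 0 < p) (hp' : p ≤ 1 / 4) (L : ℂ) :
    IsPrimSol p (fun x => perZero p L x 2) (fun x => (solU p x : ℂ) + L * (solF p x : ℂ))
      (fun x => (solU' p x : ℂ) + L * (solF' p x : ℂ)) := by
  refine ⟨(isSol_solU hp hp').ofReal.add ((isSol_solF hp hp').ofReal.const_smul L), fun x hx => ?_⟩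
  have hl := (Real.hasDerivAt_log hx.1.ne').ofReal_comp.add_const L
  have h := (((hl.pow 2).const_mul (1 / 2)).add
    ((hasDerivAt_psum_coeffF₀ hp hp' hx).ofReal_comp.mul hl)).add
    (hasDerivAt_psum_coeffF₁ hp hp' hx).ofReal_comp
  refine h.congr_deriv ?_
  obtain ⟨h0, -⟩ := ofReal_ne_zero_of_mem hx
  have e : psum (frobA p) x = solF p x := rfl
  simp only [solU, e]
  push_cast
  field_simp
  ring

theorem isPrimSol_perZero (hp : 0 < p) (hp' : p ≤ 1 / 4) (L : ℂ) (i : Fin 3) :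
    ∃ w q, IsPrimSol p (fun x => perZero p L x i) w q := by
  fin_cases i
  · exact ⟨_, _, isPrimSol_one p⟩
  · exact ⟨_, _, isPrimSol_perZero_one hp hp' L⟩
  · exact ⟨_, _, isPrimSol_perZero_two hp hp' L⟩

theorem isPrimSol_perCon_one (hp : 0 < p) (hp' : p ≤ 1 / 4) :
    IsPrimSol p (fun x => perCon p x 1) (fun x => ((-solF p (1 - x) : ℝ) : ℂ))
      (fun x => ((solF' p (1 - x) : ℝ) : ℂ)) := by
  refine ⟨?_, fun x hx => ?_⟩
  · simpa using ((isSol_solF hp hp').reflect.const_smul (-1 : ℝ)).ofReal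
  · have hx' := one_sub_mem hx
    have h := ((hasDerivAt_psum_coeffNu hp hp' hx').comp x
      ((hasDerivAt_id x).const_sub 1)).ofReal_comp
    refine h.congr_deriv ?_
    simp only [sub_sub_cancel]
    push_cast
    ring

/-- The solution to integrate is U + F rather than U: since ∫ log δ dδ = δ log δ - δ, adding F
removes the linear term and leaves an O(δ²) power series. -/
theorem isPrimSol_perCon_two (hp : 0 < p) (hp' : p ≤ 1 / 4) :
    IsPrimSol p (fun x => perCon p x 2) (fun x => ((-(solU p (1 - x) + solF p (1 - x)) : ℝ) : ℂ))
      (fun x => ((solU' p (1 - x) + solF' p (1 - x) : ℝ) : ℂ)) := by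
  refine ⟨?_, fun x hx => ?_⟩
  · simpa [add_comm] using (((isSol_solU hp hp').add (isSol_solF hp hp')).reflect.const_smul (-1 : ℝ)).ofReal
  · have hx' := one_sub_mem hx
    have h1 := ((hasDerivAt_psum_coeffNu hp hp' hx').mul (Real.hasDerivAt_log hx'.1.ne')).add
      (hasDerivAt_psum_coeffCon hp hp' hx')
    have h := (h1.comp x ((hasDerivAt_id x).const_sub 1)).ofReal_comp
    refine h.congr_deriv ?_
    have h0 := hx.1.ne'
    have h1' := hx'.1.ne'
    have e : psum (frobA p) (1 - x) = solF p (1 - x) := rfl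
    rw [← Complex.ofReal_div]
    congr 1
    simp only [sub_sub_cancel, solU, e]
    field_simp
    ring

theorem isPrimSol_perCon (hp : 0 < p) (hp' : p ≤ 1 / 4) (i : Fin 3) :
    ∃ w q, IsPrimSol p (fun x => perCon p x i) w q := by
  fin_cases i
  · exact ⟨_, _, isPrimSol_one p⟩
  · exact ⟨_, _, isPrimSol_perCon_one hp hp'⟩
  · exact ⟨_, _, isPrimSol_perCon_two hp hp'⟩

/-! ### The two bases in the coordinate z and their uniqueness -/

variable {a₁ a₂ μ : ℝ}

/-- As z / μ is positive, the principal logarithm splits without a jump; for negative μ its πi sits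
entirely in log μ. -/
theorem log_eq_of_mem_interval (hμ : μ ≠ 0) {z : ℝ} (hz : z ∈ interval μ) :
    Complex.log z = Real.log (z / μ) + Complex.log μ := by
  have hx := div_mem_of_mem_interval hz
  rw [← Complex.log_ofReal_mul hx.1 (by exact_mod_cast hμ)]
  congr 1
  rw [← Complex.ofReal_mul, div_mul_cancel₀ _ hμ]

theorem analyticAt_psum_div {c : ℕ → ℝ} (hc : PolyBdd c) (μ : ℝ) :
    AnalyticAt ℂ (fun z : ℂ => psum c (z / μ)) 0 := by
  have h1 : AnalyticAt ℂ (fun z : ℂ => z / μ) 0 := analyticAt_id.div_const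
  exact AnalyticAt.fun_comp (by simpa using analyticAt_psum hc (z := 0) (by simp)) h1

theorem psum_div_isBigO {c : ℕ → ℝ} (hc : PolyBdd c) (h0 : c 0 = 0) (μ : ℝ) :
    (fun z : ℂ => psum c (z / μ)) =O[𝓝 0] fun z => z := by
  have ht : Tendsto (fun z : ℂ => z / μ) (𝓝 0) (𝓝 0) := by
    have : Continuous fun z : ℂ => z / μ := by fun_prop
    simpa using this.tendsto 0
  refine ((psum_isBigO hc h0).comp_tendsto ht).trans ?_
  simp only [Function.comp_def, div_eq_inv_mul]
  exact isBigO_const_mul_self _ _ _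

theorem isFrobeniusBasisAtZero_perZero (hμ : μ ≠ 0) (h1 : a₁ + a₂ = 1) (hp : 0 < a₁ * a₂)
    (hp' : a₁ * a₂ ≤ 1 / 4) : IsFrobeniusBasisAtZero a₁ a₂ μ
      (fun z => perZero (a₁ * a₂) (Complex.log μ) (z / μ)) := by
  refine ⟨fun i => ?_, fun z => psum (coeffF₀ (a₁ * a₂)) (z / μ),
    fun z => psum (coeffF₁ (a₁ * a₂)) (z / μ), analyticAt_psum_div (polyBdd_coeffF₀ hp hp') μ,
    analyticAt_psum_div (polyBdd_coeffF₁ hp hp') μ,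
    psum_div_isBigO (polyBdd_coeffF₀ hp hp') (coeffF₀_zero _) μ,
    psum_div_isBigO (polyBdd_coeffF₁ hp hp') (coeffF₁_zero _) μ, ?_⟩
  · obtain ⟨w, q, h⟩ := isPrimSol_perZero hp hp' (Complex.log μ) i
    exact h.isPicardFuchsSolution hμ h1
  · filter_upwards [self_mem_nhdsWithin] with z hz
    rw [perZero, log_eq_of_mem_interval hμ hz, ← Complex.ofReal_div, psum_ofReal, psum_ofReal]

theorem isFrobeniusBasisAtConifold_perCon (hμ : μ ≠ 0) (h1 : a₁ + a₂ = 1) (hp : 0 < a₁ * a₂)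
    (hp' : a₁ * a₂ ≤ 1 / 4) :
    IsFrobeniusBasisAtConifold a₁ a₂ μ (fun z => perCon (a₁ * a₂) (z / μ)) := by
  have hN := polyBdd_coeffNu hp hp'
  have hE := polyBdd_coeffCon hp hp'
  refine ⟨fun i => ?_, psum (coeffNu (a₁ * a₂)), psum (coeffCon (a₁ * a₂)),
    analyticAt_psum hN (by simp), analyticAt_psum hE (by simp), ?_,
    psum_isBigO_sq hE (coeffCon_zero _) (coeffCon_one _), ?_⟩
  · obtain ⟨w, q, h⟩ := isPrimSol_perCon hp hp' i
    exact h.isPicardFuchsSolution hμ h1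
  · set d : ℕ → ℝ := fun n => if n = 1 then 1 else 0 with hd
    have hdb : PolyBdd d := .of_le 1 fun n => by simp only [hd]; split_ifs <;> simp
    have hds : ∀ z : ℂ, psum d z = z := fun z => by
      rw [psum, tsum_eq_single 1 (fun n hn => by simp [hd, hn])]
      simp [hd]
    have h := psum_isBigO_sq (hN.sub hdb) (by simp [coeffNu_zero, hd]) (by simp [coeffNu_one, hd])
    refine h.congr' ?_ EventuallyEq.rfl
    filter_upwards [Metric.ball_mem_nhds (0 : ℂ) one_pos] with z hz
    rw [psum_sub hN hdb (by simpa using hz), hds]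
  · filter_upwards [self_mem_nhdsWithin] with z hz δ hδ
    subst hδ
    rw [perCon, psum_ofReal, psum_ofReal]
    push_cast
    rfl

theorem tendsto_mul_interval (hμ : μ ≠ 0) :
    Tendsto (fun x : ℝ => μ * x) (𝓝[>] 0) (𝓝[interval μ] 0) := by
  refine tendsto_nhdsWithin_iff.2 ⟨?_, ?_⟩
  · have : Tendsto (fun x : ℝ => μ * x) (𝓝 0) (𝓝 (μ * 0)) := (continuous_const_mul μ).tendsto 0
    rw [mul_zero] at this
    exact this.mono_left nhdsWithin_le_nhds
  · filter_upwards [Ioo_mem_nhdsGT one_pos] with x hx using mul_mem_interval hμ hx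

theorem tendsto_mul_one_sub_interval (hμ : μ ≠ 0) :
    Tendsto (fun x : ℝ => μ * (1 - x)) (𝓝[>] 0) (𝓝[interval μ] μ) := by
  refine tendsto_nhdsWithin_iff.2 ⟨?_, ?_⟩
  · have : Tendsto (fun x : ℝ => μ * (1 - x)) (𝓝 0) (𝓝 (μ * (1 - 0))) :=
      (by fun_prop : Continuous fun x : ℝ => μ * (1 - x)).tendsto 0
    rw [sub_zero, mul_one] at this
    exact this.mono_left nhdsWithin_le_nhds
  · filter_upwards [Ioo_mem_nhdsGT one_pos] with x hx using
      mul_mem_interval hμ (one_sub_mem hx)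

theorem eq_zero_of_isBigO {f : ℂ → ℂ} (h : f =O[𝓝 0] fun z => z) : f 0 = 0 := by
  obtain ⟨C, hC⟩ := h.bound
  simpa using hC.self_of_nhds

theorem analyticAt_comp_mul {f : ℂ → ℂ} (hf : AnalyticAt ℂ f 0) (μ : ℝ) :
    AnalyticAt ℂ (fun z : ℂ => f (μ * z)) 0 := by
  have h1 : AnalyticAt ℂ (fun z : ℂ => μ * z) 0 := analyticAt_const.mul analyticAt_id
  exact AnalyticAt.fun_comp (by simpa using hf) h1

theorem IsFrobeniusBasisAtZero.unique {Φ Φ' : ℝ → Fin 3 → ℂ} (hμ : μ ≠ 0) (h1 : a₁ + a₂ = 1)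
    (hp : 0 < a₁ * a₂) (hp' : a₁ * a₂ ≤ 1 / 4) (h : IsFrobeniusBasisAtZero a₁ a₂ μ Φ)
    (h' : IsFrobeniusBasisAtZero a₁ a₂ μ Φ') {z : ℝ} (hz : z ∈ interval μ) : Φ z = Φ' z := by
  obtain ⟨f₀, f₁, hf₀, hf₁, h0, h1', hΦ⟩ := h.expansion
  obtain ⟨e₀, e₁, he₀, he₁, h0', h1'', hΦ'⟩ := h'.expansion
  have hev := (tendsto_mul_interval hμ).eventually (hΦ.and hΦ')
  have hmem : ∀ᶠ x : ℝ in 𝓝[>] 0, x ∈ Ioo (0 : ℝ) 1 := Ioo_mem_nhdsGT one_pos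
  have key : ∀ i : Fin 3, ∀ e : ℂ → ℂ, AnalyticAt ℂ e 0 → e 0 = 0 →
      (∀ᶠ x : ℝ in 𝓝[>] 0, Φ (μ * x) i - Φ' (μ * x) i = e (μ * x)) →
      ∀ x ∈ Ioo (0 : ℝ) 1, Φ (μ * x) i - Φ' (μ * x) i = 0 := by
    intro i e he he0 hY
    obtain ⟨w, q, hw⟩ := isPrimSol_of_isPicardFuchsSolution hμ h1 (h.solution i)
    obtain ⟨w', q', hw'⟩ := isPrimSol_of_isPicardFuchsSolution hμ h1 (h'.solution i)
    exact (hw.sub hw').eq_zero_at_zero hp hp' (analyticAt_comp_mul he μ) (by simpa using he0) hY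
  have k0 := key 0 (fun _ => 0) analyticAt_const rfl (by
    filter_upwards [hev] with x hx
    rw [hx.1, hx.2]; simp)
  have k1 := key 1 (fun z => f₀ z - e₀ z) (hf₀.sub he₀)
    (by simp [eq_zero_of_isBigO h0, eq_zero_of_isBigO h0']) (by
    filter_upwards [hev] with x hx
    rw [hx.1, hx.2]; simp)
  -- The logarithmic parts agree by `k1`, so the difference of the third components is analytic,
  -- namely f₁ - e₁.
  have k2 := key 2 (fun z => f₁ z - e₁ z) (hf₁.sub he₁)
    (by simp [eq_zero_of_isBigO h1', eq_zero_of_isBigO h1'']) (by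
    filter_upwards [hev, hmem] with x hx hx'
    have e := k1 x hx'
    rw [hx.1, hx.2] at e ⊢
    simp only [Matrix.cons_val] at e ⊢
    push_cast at e ⊢
    linear_combination Complex.log (μ * x) * e)
  have hx := div_mem_of_mem_interval hz
  have hzx : μ * (z / μ) = z := mul_div_cancel₀ z hμ
  funext i
  rw [← sub_eq_zero, ← hzx]
  fin_cases i
  · exact k0 _ hx
  · exact k1 _ hx
  · exact k2 _ hx

theorem IsFrobeniusBasisAtConifold.unique {Ψ Ψ' : ℝ → Fin 3 → ℂ} (hμ : μ ≠ 0) (h1 : a₁ + a₂ = 1)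
    (hp : 0 < a₁ * a₂) (hp' : a₁ * a₂ ≤ 1 / 4) (h : IsFrobeniusBasisAtConifold a₁ a₂ μ Ψ)
    (h' : IsFrobeniusBasisAtConifold a₁ a₂ μ Ψ') {z : ℝ} (hz : z ∈ interval μ) : Ψ z = Ψ' z := by
  obtain ⟨ν, g, hν, hg, h0, hg0, hΨ⟩ := h.expansion
  obtain ⟨ν', g', hν', hg', h0', hg0', hΨ'⟩ := h'.expansion
  have hev : ∀ᶠ x : ℝ in 𝓝[>] 0,
      Ψ (μ * (1 - x)) = ![1, ν x, ν x * Real.log x + g x] ∧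
      Ψ' (μ * (1 - x)) = ![1, ν' x, ν' x * Real.log x + g' x] := by
    filter_upwards [(tendsto_mul_one_sub_interval hμ).eventually (hΨ.and hΨ')] with x hx
    have e : x = 1 - μ * (1 - x) / μ := by field_simp; ring
    exact ⟨hx.1 x e, hx.2 x e⟩
  have hmem : ∀ᶠ x : ℝ in 𝓝[>] 0, x ∈ Ioo (0 : ℝ) 1 := Ioo_mem_nhdsGT one_pos
  have key : ∀ i : Fin 3, ∀ e : ℂ → ℂ, AnalyticAt ℂ e 0 → (e =O[𝓝 0] fun z => z ^ 2) →
      (∀ᶠ x : ℝ in 𝓝[>] 0, Ψ (μ * (1 - x)) i - Ψ' (μ * (1 - x)) i = e x) →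
      ∀ x ∈ Ioo (0 : ℝ) 1, Ψ (μ * x) i - Ψ' (μ * x) i = 0 := by
    intro i e he he0 hY
    obtain ⟨w, q, hw⟩ := isPrimSol_of_isPicardFuchsSolution hμ h1 (h.solution i)
    obtain ⟨w', q', hw'⟩ := isPrimSol_of_isPicardFuchsSolution hμ h1 (h'.solution i)
    have hd : HasDerivAt e 0 0 := by
      have h2 : e =O[𝓝 0] fun z => ‖z - 0‖ ^ 2 := by simpa using he0.norm_right
      simpa using (h2.hasFDerivAt (𝕜 := ℂ) one_lt_two).hasDerivAt
    refine (hw.sub hw').eq_zero_at_one hp hp' he ?_ hd.deriv hY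
    obtain ⟨C, hC⟩ := he0.bound
    simpa using hC.self_of_nhds
  have k0 := key 0 (fun _ => 0) analyticAt_const (isBigO_zero _ _) (by
    filter_upwards [hev] with x hx
    rw [hx.1, hx.2]; simp)
  have k1 := key 1 (fun z => ν z - ν' z) (hν.sub hν')
    ((h0.sub h0').congr_left fun z => by ring) (by
    filter_upwards [hev] with x hx
    rw [hx.1, hx.2]; simp)
  have k2 := key 2 (fun z => g z - g' z) (hg.sub hg') (hg0.sub hg0') (by
    filter_upwards [hev, hmem] with x hx hx'
    have e := k1 (1 - x) (one_sub_mem hx')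
    rw [hx.1, hx.2] at e ⊢
    simp only [Matrix.cons_val] at e ⊢
    linear_combination (Real.log x : ℂ) * e)
  have hx := div_mem_of_mem_interval hz
  have hzx : μ * (z / μ) = z := mul_div_cancel₀ z hμ
  funext i
  rw [← sub_eq_zero, ← hzx]
  fin_cases i
  · exact k0 _ hx
  · exact k1 _ hx
  · exact k2 _ hx

end

/-! ### The transition matrix -/

section
variable {p l C : ℝ}

theorem summable_coeffF₀ (hp : 0 < p) (hp' : p ≤ 1 / 4) : Summable (coeffF₀ p) :=
  summable_frobA_div hp hp'

/-- For n ≥ 1 the coefficient (Gₙ - Aₙ / n) / n equals Aₙ ((Dₙ - l) / n - 1 / n²) + l Aₙ / n, a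
Mellin term at s = 0 plus l times a coefficient of f₀. -/
theorem hasSum_coeffF₁ (hp : 0 < p) (hp' : p ≤ 1 / 4) (hl : Tendsto (frobD p) atTop (𝓝 l)) :
    HasSum (coeffF₁ p) (mellinReg p l 0 + l * ∑' n, coeffF₀ p n) := by
  have h1 := (summable_mellinTerm hp hp' hl (by norm_num : -(1 / 2) ≤ (0 : ℝ))).hasSum
  have h2 := ((hasSum_nat_add_iff' 1).2 (summable_coeffF₀ hp hp').hasSum).mul_left l
  simp only [Finset.sum_range_one, coeffF₀_zero, sub_zero] at h2
  refine (hasSum_nat_add_iff' (f := coeffF₁ p) 1).1 ?_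
  simp only [Finset.sum_range_one, coeffF₁_zero, sub_zero]
  refine (h1.add h2).congr_fun fun n => ?_
  have : ((n + 1 : ℕ) : ℝ) ≠ 0 := by positivity
  simp only [mellinTerm, coeffF₁, coeffF₀, frobG, add_zero]
  field_simp
  ring

theorem tendsto_log_one : Tendsto Real.log (𝓝[<] 1) (𝓝 0) := by
  have := (Real.continuousAt_log one_ne_zero).tendsto.mono_left (nhdsWithin_le_nhds (s := Iio 1))
  simpa using this

theorem tendsto_perZero_one (hp : 0 < p) (hp' : p ≤ 1 / 4) (L : ℂ) :
    Tendsto (fun x => perZero p L x 1) (𝓝[<] 1) (𝓝 (L + (∑' n, coeffF₀ p n : ℝ))) := by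
  have hl := tendsto_log_one.ofReal
  have h0 := (tendsto_psum_one (summable_coeffF₀ hp hp')).ofReal
  have h := (hl.add_const L).add h0
  simpa [perZero] using h

theorem tendsto_perZero_two (hp : 0 < p) (hp' : p ≤ 1 / 4)
    (hl : Tendsto (frobD p) atTop (𝓝 l)) (L : ℂ) :
    Tendsto (fun x => perZero p L x 2) (𝓝[<] 1)
      (𝓝 (1 / 2 * L ^ 2 + (∑' n, coeffF₀ p n : ℝ) * L
        + (mellinReg p l 0 + l * ∑' n, coeffF₀ p n : ℝ))) := by
  have hlog := tendsto_log_one.ofReal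
  have h0 := (tendsto_psum_one (summable_coeffF₀ hp hp')).ofReal
  have hs := hasSum_coeffF₁ hp hp' hl
  have h1 := (tendsto_psum_one hs.summable).ofReal
  rw [hs.tsum_eq] at h1
  have h := ((((hlog.add_const L).pow 2).const_mul (1 / 2)).add (h0.mul (hlog.add_const L))).add h1
  simpa [perZero] using h

theorem tendsto_perCon_one (hp : 0 < p) (hp' : p ≤ 1 / 4) :
    Tendsto (fun x => perCon p x 1) (𝓝[<] 1) (𝓝 0) := by
  have h := ((tendsto_psum_zero (polyBdd_coeffNu hp hp')).comp tendsto_one_sub_one).ofReal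
  simpa [coeffNu_zero, perCon] using h

theorem tendsto_perCon_two (hp : 0 < p) (hp' : p ≤ 1 / 4) :
    Tendsto (fun x => perCon p x 2) (𝓝[<] 1) (𝓝 0) := by
  have h := (((tendsto_log_mul_psum_zero (polyBdd_coeffNu hp hp') (coeffNu_zero p)).add
    (tendsto_psum_zero (polyBdd_coeffCon hp hp'))).comp tendsto_one_sub_one).ofReal
  simpa [coeffCon_zero, perCon, mul_comm] using h

/-- Equal θ-derivatives leave a constant, which is read off at the conifold point. -/
theorem IsPrimSol.eq_add_const {Y Y₁ Y₂ w w₁ w₂ q q₁ q₂ : ℝ → ℂ} {α β c c₁ c₂ : ℂ}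
    (h : IsPrimSol p Y w q) (h₁ : IsPrimSol p Y₁ w₁ q₁) (h₂ : IsPrimSol p Y₂ w₂ q₂)
    (hw : ∀ x ∈ Ioo (0 : ℝ) 1, w x = α * w₁ x + β * w₂ x)
    (hY : Tendsto Y (𝓝[<] 1) (𝓝 c)) (hY₁ : Tendsto Y₁ (𝓝[<] 1) (𝓝 c₁))
    (hY₂ : Tendsto Y₂ (𝓝[<] 1) (𝓝 c₂)) :
    ∀ x ∈ Ioo (0 : ℝ) 1, Y x - (α * Y₁ x + β * Y₂ x) = c - (α * c₁ + β * c₂) := by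
  obtain ⟨k, hk⟩ := exists_const_of_hasDerivAt_zero (h := fun x => Y x - (α * Y₁ x + β * Y₂ x))
    fun x hx => by
      refine ((h.hasDerivAt x hx).sub (((h₁.hasDerivAt x hx).const_mul α).add
        ((h₂.hasDerivAt x hx).const_mul β))).congr_deriv ?_
      rw [hw x hx]; ring
  have hlim := hY.sub ((hY₁.const_mul α).add (hY₂.const_mul β))
  have : k = c - (α * c₁ + β * c₂) := by
    refine tendsto_nhds_unique (tendsto_const_nhds.congr' ?_) hlim
    filter_upwards [Ioo_mem_nhdsLT one_pos] with x hx using (hk x hx).symm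
  intro x hx
  rw [hk x hx, this]

theorem solU_eq (hp : 0 < p) (hp' : p ≤ 1 / 4) (hC : 0 < C)
    (hA : Tendsto (fun n : ℕ => (n : ℝ) * frobA p n) atTop (𝓝 C))
    (hl : Tendsto (frobD p) atTop (𝓝 l)) {x : ℝ} (hx : x ∈ Ioo (0 : ℝ) 1) :
    solU p x = l * solF p x - solF p (1 - x) / C := by
  have h := solF_one_sub hp hp' hC hA hl hx
  field_simp
  linear_combination h

/-- The connection formula at 1 - x gives F(x) = C (l F(1 - x) - U(1 - x)). The coefficient is l + 1
instead of l because the third conifold period integrates U + F. -/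
theorem perZero_one_eq (hp : 0 < p) (hp' : p ≤ 1 / 4) (hC : 0 < C)
    (hA : Tendsto (fun n : ℕ => (n : ℝ) * frobA p n) atTop (𝓝 C))
    (hl : Tendsto (frobD p) atTop (𝓝 l)) (L : ℂ) {x : ℝ} (hx : x ∈ Ioo (0 : ℝ) 1) :
    perZero p L x 1 = C * (perCon p x 2 - (l + 1) * perCon p x 1)
      + (L + (∑' n, coeffF₀ p n : ℝ)) := by
  have h := (isPrimSol_perZero_one hp hp' L).eq_add_const (isPrimSol_perCon_one hp hp')
    (isPrimSol_perCon_two hp hp') (α := (-(C * (l + 1)) : ℝ)) (β := (C : ℝ)) (fun x hx => by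
      have e := solU_eq hp hp' hC hA hl (one_sub_mem hx)
      rw [sub_sub_cancel] at e
      rw [← Complex.ofReal_mul, ← Complex.ofReal_mul, ← Complex.ofReal_add]
      congr 1
      rw [e]
      field_simp
      ring)
    (tendsto_perZero_one hp hp' L) (tendsto_perCon_one hp hp') (tendsto_perCon_two hp hp') x hx
  push_cast at h ⊢
  linear_combination h

/-- By the connection formula U + L F = (l + L) F - F(1 - x) / C, a combination of the θ-derivatives
of the second period at 0 and of ν. -/
theorem perZero_two_eq (hp : 0 < p) (hp' : p ≤ 1 / 4) (hC : 0 < C)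
    (hA : Tendsto (fun n : ℕ => (n : ℝ) * frobA p n) atTop (𝓝 C))
    (hl : Tendsto (frobD p) atTop (𝓝 l)) (L : ℂ) {x : ℝ} (hx : x ∈ Ioo (0 : ℝ) 1) :
    perZero p L x 2 = (l + L) * (C * (perCon p x 2 - (l + 1) * perCon p x 1))
      + perCon p x 1 / C + (1 / 2 * L ^ 2 + (∑' n, coeffF₀ p n : ℝ) * L
        + (mellinReg p l 0 + l * ∑' n, coeffF₀ p n : ℝ)) := by
  have hC' : (C : ℂ) ≠ 0 := by exact_mod_cast hC.ne'
  have h := (isPrimSol_perZero_two hp hp' L).eq_add_const (isPrimSol_perZero_one hp hp' L)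
    (isPrimSol_perCon_one hp hp') (α := l + L) (β := 1 / C) (fun x hx => by
      have e := solU_eq hp hp' hC hA hl hx
      rw [e]
      push_cast
      ring)
    (tendsto_perZero_two hp hp' hl L) (tendsto_perZero_one hp hp' L) (tendsto_perCon_one hp hp')
    x hx
  rw [perZero_one_eq hp hp' hC hA hl L hx] at h
  push_cast at h ⊢
  linear_combination h

/-- The components of the Frobenius basis at the conifold point are linearly independent. -/
theorem perCon_independent (hp : 0 < p) (hp' : p ≤ 1 / 4) (hC : 0 < C)
    (hA : Tendsto (fun n : ℕ => (n : ℝ) * frobA p n) atTop (𝓝 C))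
    (hl : Tendsto (frobD p) atTop (𝓝 l)) {α β γ : ℂ}
    (h : ∀ x ∈ Ioo (0 : ℝ) 1, α + β * perCon p x 1 + γ * perCon p x 2 = 0) :
    α = 0 ∧ β = 0 ∧ γ = 0 := by
  have hmem : ∀ᶠ x : ℝ in 𝓝[<] 1, x ∈ Ioo (0 : ℝ) 1 := Ioo_mem_nhdsLT one_pos
  have hC' : (C : ℂ) ≠ 0 := by exact_mod_cast hC.ne'
  have hα : α = 0 := by
    have hlim := (((tendsto_perCon_one hp hp').const_mul β).const_add α).add
      ((tendsto_perCon_two hp hp').const_mul γ)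
    simp only [mul_zero, add_zero] at hlim
    refine (tendsto_nhds_unique (tendsto_const_nhds.congr' ?_) hlim).symm
    filter_upwards [hmem] with x hx using (h x hx).symm
  have hw : ∀ x ∈ Ioo (0 : ℝ) 1, γ / C * solF p x = (β + γ * (l + 1)) * solF p (1 - x) := by
    intro x hx
    obtain ⟨h0, -⟩ := ofReal_ne_zero_of_mem hx
    have hd := ((((isPrimSol_perCon_one hp hp').hasDerivAt x hx).const_mul β).const_add α).add
      (((isPrimSol_perCon_two hp hp').hasDerivAt x hx).const_mul γ)
    have hz : HasDerivAt (fun x => α + β * perCon p x 1 + γ * perCon p x 2) 0 x :=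
      (hasDerivAt_const x (0 : ℂ)).congr_of_eventuallyEq (by
        filter_upwards [isOpen_Ioo.mem_nhds hx] with y hy using h y hy)
    have e := hd.unique hz
    have e2 := solU_eq hp hp' hC hA hl (one_sub_mem hx)
    rw [sub_sub_cancel] at e2
    rw [e2] at e
    push_cast at e
    field_simp at e ⊢
    linear_combination e
  -- Differentiation left a linear relation between F(x) and F(1 - x); these are independent because
  -- their quotient tends to 0 at x = 1.
  have hγ : γ / C = 0 := by
    have hFt := tendsto_solF_one hp hp' hC hA
    have h1 : Tendsto (fun x => solF p (1 - x) / solF p x) (𝓝[<] 1) (𝓝 0) :=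
      ((tendsto_solF_zero hp hp').comp tendsto_one_sub_one).div_atTop hFt
    have h2 := (h1.ofReal).const_mul (β + γ * (l + 1))
    rw [Complex.ofReal_zero, mul_zero] at h2
    refine tendsto_nhds_unique (tendsto_const_nhds.congr' ?_) h2
    filter_upwards [hmem] with x hx
    have hF : (solF p x : ℂ) ≠ 0 := by exact_mod_cast (solF_pos hp hp' hx).ne'
    have e := hw x hx
    push_cast
    rw [mul_div_assoc', ← e, mul_div_cancel_right₀ _ hF]
  have hγ' : γ = 0 := by simpa [hC'] using hγ
  refine ⟨hα, ?_, hγ'⟩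
  have hx : (1 / 2 : ℝ) ∈ Ioo (0 : ℝ) 1 := by norm_num
  have e := hw _ hx
  have hF : (solF p (1 - 1 / 2) : ℂ) ≠ 0 := by
    exact_mod_cast (solF_pos hp hp' (one_sub_mem hx)).ne'
  simp only [hγ', zero_div, zero_mul, add_zero] at e
  exact (mul_eq_zero.1 e.symm).resolve_right hF

end

open Real Complex in
-- The number ε records the sign of μ: log μ = -l + πεi, with ε = 1 for negative and 0 for positive
-- μ. In the first row, l + L = πεi and σ = κε / 2 cancel both S and the logarithmic conifold
-- period; the remaining constant vanishes by the value of R, sin(πa) = h √κ / 2 and the formula for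
-- c₂ · J. In the third row, (2πi)² (L + S) = 4π² (l - S) + (ε / 2)(2πi)³ gives the L-value and the
-- shift s.
theorem gammaClassMatrix_mulVec_eq {D : ModelData} {ε l : ℝ} (ha : D.a₁ ∈ Ioo (0 : ℝ) 1)
    (hl : Tendsto (frobD (D.a₁ * (1 - D.a₁))) atTop (𝓝 l))
    (habs : Real.log |D.μ| = -l) (hκ : D.h * √D.κ = 2 * Real.sin (π * D.a₁))
    (hσ : D.σ = D.κ * ε / 2) (hs : D.s = ε / 2) (hc : D.c₂J = D.κ * (1 - 3 * ε ^ 2) - 12 / D.h ^ 2)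
    (hD : D.l = ((4 * π ^ 2 * (l - ∑' n : ℕ, frobA (D.a₁ * (1 - D.a₁)) n / n) : ℝ) : ℂ))
    {x : ℝ} (hx : x ∈ Ioo (0 : ℝ) 1) :
    (gammaClassMatrix D).mulVec (perZero (D.a₁ * (1 - D.a₁)) (-l + π * ε * I) x)
      = (transitionMatrix D).mulVec (perCon (D.a₁ * (1 - D.a₁)) x) := by
  set p := D.a₁ * (1 - D.a₁) with hpdef
  have hp : 0 < p := mul_pos ha.1 (sub_pos.2 ha.2)
  have hp' : p ≤ 1 / 4 := by nlinarith [sq_nonneg (D.a₁ - 1 / 2)]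
  have hpi := Real.pi_pos
  have hsin : 0 < Real.sin (π * D.a₁) :=
    Real.sin_pos_of_pos_of_lt_pi (mul_pos hpi ha.1) (by nlinarith [ha.2])
  have hA := tendsto_nat_mul_frobA D.a₁
  rw [← hpdef] at hA
  have hC : 0 < Real.sin (π * D.a₁) / π := by positivity
  have e1 := perZero_one_eq hp hp' hC hA hl (-l + π * ε * I) hx
  have e2 := perZero_two_eq hp hp' hC hA hl (-l + π * ε * I) hx
  have hreg := mellinReg_zero ha hl
  rw [← hpdef] at hreg
  have hh : (D.h : ℝ) ≠ 0 := fun h => by rw [h, zero_mul] at hκ; linarith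
  have hsq : √D.κ ≠ 0 := fun h => by rw [h, mul_zero] at hκ; linarith
  have hκ0 : 0 ≤ D.κ := by
    by_contra h
    exact hsq (Real.sqrt_eq_zero_of_nonpos (not_le.1 h).le)
  have hκsq : D.κ = √D.κ ^ 2 := (Real.sq_sqrt hκ0).symm
  have hsineq : Real.sin (π * D.a₁) = D.h * √D.κ / 2 := by linarith
  set k := √D.κ with hk
  set S := ∑' n, coeffF₀ p n with hS
  have hS' : ∑' n : ℕ, frobA p n / n = S := rfl
  rw [hS'] at hD
  rw [hreg] at e2
  rw [hsineq] at e1 e2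
  have hpi' : (π : ℂ) ≠ 0 := by exact_mod_cast hpi.ne'
  have hh' : (D.h : ℂ) ≠ 0 := by exact_mod_cast hh
  have hk' : (k : ℂ) ≠ 0 := by exact_mod_cast hsq
  have hI2 : I ^ 2 = -1 := Complex.I_sq
  have hI3 : I ^ 3 = -I := by rw [pow_succ, hI2]; ring
  have hI4 : I ^ 4 = 1 := by rw [pow_succ, hI3]; ring_nf; simp
  have hI5 : I ^ 5 = I := by rw [pow_succ, hI4, one_mul]
  have p0 : perZero p (-l + π * ε * I) x 0 = 1 := rfl
  have p0' : perCon p x 0 = 1 := rfl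
  have hI0 := Complex.I_ne_zero
  ext i
  fin_cases i
  · simp only [gammaClassMatrix, transitionMatrix, Matrix.mulVec, dotProduct, Fin.sum_univ_three, p0, p0', e1, e2,
      hσ, hs, hc, hD, habs, ← hk]
    simp
    rw [hκsq]
    push_cast
    field_simp
    ring_nf
    simp only [hI2]
    ring
  · simp [gammaClassMatrix, transitionMatrix, Matrix.mulVec, dotProduct, Fin.sum_univ_three, p0, p0']
  · simp only [gammaClassMatrix, transitionMatrix, Matrix.mulVec, dotProduct, Fin.sum_univ_three, p0, p0', e1, e2,
      hσ, hs, hc, hD, habs, ← hk]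
    simp
    field_simp
    ring_nf
    simp only [hI3, hI4, hI5]
    ring

/-- Both bases are determined on the interval, so it suffices to treat the explicit ones; uniqueness
of T is the linear independence of the conifold periods, row by row. -/
theorem transition_iff {D : ModelData} {ε l : ℝ} (ha : D.a₁ ∈ Ioo (0 : ℝ) 1)
    (ha₂ : D.a₂ = 1 - D.a₁) (hl : Tendsto (frobD (D.a₁ * (1 - D.a₁))) atTop (𝓝 l))
    (hμ : D.μ ≠ 0) (habs : Real.log |D.μ| = -l)
    (hlog : Complex.log D.μ = -l + Real.pi * ε * Complex.I)
    (hκ : D.h * √D.κ = 2 * Real.sin (Real.pi * D.a₁))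
    (hσ : D.σ = D.κ * ε / 2) (hs : D.s = ε / 2) (hc : D.c₂J = D.κ * (1 - 3 * ε ^ 2) - 12 / D.h ^ 2)
    (hD : D.l = ((4 * Real.pi ^ 2 * (l - ∑' n : ℕ, frobA (D.a₁ * (1 - D.a₁)) n / n) : ℝ) : ℂ)) :
    (∃ Φ, IsFrobeniusBasisAtZero D.a₁ D.a₂ D.μ Φ) ∧
    (∃ Ψ, IsFrobeniusBasisAtConifold D.a₁ D.a₂ D.μ Ψ) ∧
    ∀ Φ Ψ : ℝ → Fin 3 → ℂ, IsFrobeniusBasisAtZero D.a₁ D.a₂ D.μ Φ →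
      IsFrobeniusBasisAtConifold D.a₁ D.a₂ D.μ Ψ →
      ∀ T : Matrix (Fin 3) (Fin 3) ℂ,
        (∀ z ∈ interval D.μ, (gammaClassMatrix D).mulVec (Φ z) = T.mulVec (Ψ z)) ↔
          T = transitionMatrix D := by
  have hp : 0 < D.a₁ * D.a₂ := by rw [ha₂]; exact mul_pos ha.1 (sub_pos.2 ha.2)
  have hp' : D.a₁ * D.a₂ ≤ 1 / 4 := by rw [ha₂]; nlinarith [sq_nonneg (D.a₁ - 1 / 2)]
  have h1 : D.a₁ + D.a₂ = 1 := by rw [ha₂]; ring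
  have hZ := isFrobeniusBasisAtZero_perZero hμ h1 hp hp'
  have hW := isFrobeniusBasisAtConifold_perCon hμ h1 hp hp'
  refine ⟨⟨_, hZ⟩, ⟨_, hW⟩, fun Φ Ψ hΦ hΨ T => ?_⟩
  have key : ∀ x ∈ Ioo (0 : ℝ) 1, (gammaClassMatrix D).mulVec (perZero (D.a₁ * D.a₂)
      (Complex.log D.μ) x) = (transitionMatrix D).mulVec (perCon (D.a₁ * D.a₂) x) := by
    intro x hx
    rw [hlog, ha₂]
    exact gammaClassMatrix_mulVec_eq ha hl habs hκ hσ hs hc hD hx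
  constructor
  · intro hT
    have h0 : ∀ x ∈ Ioo (0 : ℝ) 1, (T - transitionMatrix D).mulVec (perCon (D.a₁ * D.a₂) x) = 0 := by
      intro x hx
      have hz := mul_mem_interval hμ hx
      have e := hT _ hz
      rw [hΦ.unique hμ h1 hp hp' hZ hz, hΨ.unique hμ h1 hp hp' hW hz] at e
      simp only [mul_div_cancel_left₀ x hμ] at e
      rw [Matrix.sub_mulVec, ← e, key x hx, sub_self]
    have hsin : 0 < Real.sin (Real.pi * D.a₁) :=
      Real.sin_pos_of_pos_of_lt_pi (mul_pos Real.pi_pos ha.1) (by nlinarith [ha.2, Real.pi_pos])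
    rw [← sub_eq_zero]
    ext i j
    have hA := tendsto_nat_mul_frobA D.a₁
    rw [← ha₂] at hA hl
    obtain ⟨k0, k1, k2⟩ := perCon_independent hp hp' (div_pos hsin Real.pi_pos) hA hl
      (α := (T - transitionMatrix D) i 0) (β := (T - transitionMatrix D) i 1)
      (γ := (T - transitionMatrix D) i 2) fun x hx => by
        have e := congrFun (h0 x hx) i
        rw [Matrix.mulVec, dotProduct, Fin.sum_univ_three,
          show perCon (D.a₁ * D.a₂) x 0 = 1 from rfl, mul_one] at e
        exact e
    fin_cases j
    · exact k0
    · exact k1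
    · exact k2
  · rintro rfl z hz
    rw [hΦ.unique hμ h1 hp hp' hZ hz, hΨ.unique hμ h1 hp hp' hW hz]
    exact key _ (div_mem_of_mem_interval hz)

/-! ### The six local models -/

theorem sub_tsum_frobA_half : 4 * Real.log 2 - ∑' n : ℕ, frobA (1 / 4) n / n
    = 8 / Real.pi * (progSum 4 1 - progSum 4 3) := by
  have e : (((1 : ℕ) : ℝ) / (2 : ℕ)) * (1 - (1 : ℕ) / (2 : ℕ)) = 1 / 4 := by norm_num
  have h := sub_tsum_frobA_div (m := 2) (r := 1) (by norm_num) (by norm_num)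
    (e.symm ▸ tendsto_frobD_half)
  rw [e, show Real.pi * (((1 : ℕ) : ℝ) / (2 : ℕ)) = Real.pi / 2 by push_cast; ring,
    Real.sin_pi_div_two] at h
  rw [h]
  norm_num
  ring

theorem sub_tsum_frobA_third : 3 * Real.log 3 - ∑' n : ℕ, frobA (2 / 9) n / n
    = 27 * √3 / (4 * Real.pi) * (progSum 3 1 - progSum 3 2) := by
  have e : (((1 : ℕ) : ℝ) / (3 : ℕ)) * (1 - (1 : ℕ) / (3 : ℕ)) = 2 / 9 := by norm_num
  have h := sub_tsum_frobA_div (m := 3) (r := 1) (by norm_num) (by norm_num)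
    (e.symm ▸ tendsto_frobD_third)
  rw [e, show Real.pi * (((1 : ℕ) : ℝ) / (3 : ℕ)) = Real.pi / 3 by push_cast; ring,
    Real.sin_pi_div_three] at h
  have h1 := progSum_split_two three_pos 1
  have h2 := progSum_split_two three_pos 2
  have h3 := progSum_scale two_pos 3 1
  have h4 := progSum_scale two_pos 3 2
  rw [h]
  norm_num at h1 h2 h3 h4 ⊢
  -- The even residues modulo 6 are 1/4 of the sums modulo 3; carrying the opposite sign, they
  -- change the factor 1 into 1 + 2/4.
  rw [show progSum 6 1 - progSum 6 4 + (progSum 6 2 - progSum 6 5)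
    = 3 / 2 * (progSum 3 1 - progSum 3 2) by linarith]
  ring

theorem sub_tsum_frobA_quarter : 6 * Real.log 2 - ∑' n : ℕ, frobA (3 / 16) n / n
    = 8 * √2 / Real.pi * (progSum 8 1 + progSum 8 3 - progSum 8 5 - progSum 8 7) := by
  have e : (((1 : ℕ) : ℝ) / (4 : ℕ)) * (1 - (1 : ℕ) / (4 : ℕ)) = 3 / 16 := by norm_num
  have h := sub_tsum_frobA_div (m := 4) (r := 1) (by norm_num) (by norm_num)
    (e.symm ▸ tendsto_frobD_quarter)
  rw [e, show Real.pi * (((1 : ℕ) : ℝ) / (4 : ℕ)) = Real.pi / 4 by push_cast; ring,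
    Real.sin_pi_div_four] at h
  rw [h]
  norm_num
  ring

theorem sub_tsum_frobA_sixth :
    4 * Real.log 2 + 3 * Real.log 3 - ∑' n : ℕ, frobA (5 / 36) n / n
      = 20 / Real.pi * (progSum 4 1 - progSum 4 3) := by
  have e : (((1 : ℕ) : ℝ) / (6 : ℕ)) * (1 - (1 : ℕ) / (6 : ℕ)) = 5 / 36 := by norm_num
  have h := sub_tsum_frobA_div (m := 6) (r := 1) (by norm_num) (by norm_num)
    (e.symm ▸ tendsto_frobD_sixth)
  rw [e, show Real.pi * (((1 : ℕ) : ℝ) / (6 : ℕ)) = Real.pi / 6 by push_cast; ring,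
    Real.sin_pi_div_six] at h
  have h1 := progSum_split_three four_pos 1
  have h2 := progSum_split_three four_pos 3
  have h3 := progSum_scale three_pos 4 1
  have h4 := progSum_scale three_pos 4 3
  rw [h]
  norm_num at h1 h2 h3 h4 ⊢
  -- This is L₋₄(2) without its Euler factor at 3: since χ₄(3) = -1, removing it multiplies by 1 +
  -- 1/9.
  rw [show progSum 12 1 - progSum 12 7 + (progSum 12 5 - progSum 12 11)
    = 10 / 9 * (progSum 4 1 - progSum 4 3) by linarith]
  ring

theorem log_ofReal_of_neg {x : ℝ} (hx : x < 0) :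
    Complex.log x = Real.log |x| + Real.pi * Complex.I := by
  rw [Complex.log, Complex.arg_ofReal_of_neg hx, Complex.norm_real, Real.norm_eq_abs]

open LocalDelPezzo in
theorem transition_iff_data (M : LocalDelPezzo) :
    (∃ Φ, IsFrobeniusBasisAtZero M.data.a₁ M.data.a₂ M.data.μ Φ) ∧
    (∃ Ψ, IsFrobeniusBasisAtConifold M.data.a₁ M.data.a₂ M.data.μ Ψ) ∧
    ∀ Φ Ψ : ℝ → Fin 3 → ℂ,
      IsFrobeniusBasisAtZero M.data.a₁ M.data.a₂ M.data.μ Φ →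
      IsFrobeniusBasisAtConifold M.data.a₁ M.data.a₂ M.data.μ Ψ →
      ∀ T : Matrix (Fin 3) (Fin 3) ℂ,
        (∀ z ∈ interval M.data.μ, (gammaClassMatrix M.data).mulVec (Φ z) = T.mulVec (Ψ z)) ↔
          T = transitionMatrix M.data := by
  have hpi : Real.pi ≠ 0 := Real.pi_ne_zero
  have hpi' : (Real.pi : ℂ) ≠ 0 := by exact_mod_cast hpi
  have p2 : (1 / 2 : ℝ) * (1 - 1 / 2) = 1 / 4 := by norm_num
  have p3 : (1 / 3 : ℝ) * (1 - 1 / 3) = 2 / 9 := by norm_num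
  have p4 : (1 / 4 : ℝ) * (1 - 1 / 4) = 3 / 16 := by norm_num
  have p6 : (1 / 6 : ℝ) * (1 - 1 / 6) = 5 / 36 := by norm_num
  have l2 : Real.log (1 / 2 ^ 4) = -(4 * Real.log 2) := by
    rw [one_div, Real.log_inv, Real.log_pow]; norm_num
  have l3 : Real.log (1 / 3 ^ 3) = -(3 * Real.log 3) := by
    rw [one_div, Real.log_inv, Real.log_pow]; norm_num
  have l4 : Real.log (1 / 2 ^ 6) = -(6 * Real.log 2) := by
    rw [one_div, Real.log_inv, Real.log_pow]; norm_num
  have l6 : Real.log (1 / (2 ^ 4 * 3 ^ 3)) = -(4 * Real.log 2 + 3 * Real.log 3) := by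
    rw [one_div, Real.log_inv, Real.log_mul (by norm_num) (by norm_num), Real.log_pow,
      Real.log_pow]; norm_num
  have s2 : Real.sin (Real.pi * (1 / 2)) = 1 := by
    rw [mul_one_div, Real.sin_pi_div_two]
  have s3 : Real.sin (Real.pi * (1 / 3)) = √3 / 2 := by
    rw [mul_one_div, Real.sin_pi_div_three]
  have s4 : Real.sin (Real.pi * (1 / 4)) = √2 / 2 := by
    rw [mul_one_div, Real.sin_pi_div_four]
  have s6 : Real.sin (Real.pi * (1 / 6)) = 1 / 2 := by
    rw [mul_one_div, Real.sin_pi_div_six]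
  have hneg : ∀ {x l : ℝ}, 0 < x → Real.log (1 / x) = -l → Real.log |-1 / x| = -l ∧
      Complex.log ((-1 / x : ℝ) : ℂ) = -l + Real.pi * (1 : ℝ) * Complex.I := by
    intro x l hx h
    have e : |-1 / x| = 1 / x := by rw [abs_div, abs_neg, abs_one, abs_of_pos hx]
    refine ⟨e ▸ h, ?_⟩
    rw [log_ofReal_of_neg (div_neg_of_neg_of_pos (by norm_num) hx), e, h]
    push_cast; ring
  cases M with
  | P1xP1 =>
    refine transition_iff (D := P1xP1.data) (ε := 0) (l := 4 * Real.log 2) ?_ ?_ ?_ ?_ ?_ ?_ ?_ ?_ ?_ ?_ ?_ <;>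
      simp only [LocalDelPezzo.data]
    · norm_num
    · norm_num
    · rw [p2]; exact tendsto_frobD_half
    · norm_num
    · rw [abs_of_pos (by norm_num), l2]
    · rw [← Complex.ofReal_log (by norm_num), l2]; push_cast; ring
    · rw [s2]; norm_num
    · norm_num
    · norm_num
    · norm_num
    · rw [p2, sub_tsum_frobA_half, dirichletL_neg_four]; push_cast; field_simp; ring
  | P2 =>
    obtain ⟨n1, n2⟩ := hneg (by norm_num) l3
    refine transition_iff (D := P2.data) (ε := 1) (l := 3 * Real.log 3) ?_ ?_ ?_ ?_ n1 n2 ?_ ?_ ?_ ?_ ?_ <;>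
      simp only [LocalDelPezzo.data]
    · norm_num
    · norm_num
    · rw [p3]; exact tendsto_frobD_third
    · norm_num
    · rw [s3, one_div, Real.sqrt_inv]
      have : √(3 : ℝ) ^ 2 = 3 := Real.sq_sqrt (by norm_num)
      field_simp
      push_cast
      linarith
    · norm_num
    · norm_num
    · rw [p3, sub_tsum_frobA_third, dirichletL_neg_three]; push_cast; field_simp
  | B5 =>
    obtain ⟨n1, n2⟩ := hneg (by norm_num) l2
    refine transition_iff (D := B5.data) (ε := 1) (l := 4 * Real.log 2) ?_ ?_ ?_ ?_ n1 n2 ?_ ?_ ?_ ?_ ?_ <;>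
      simp only [LocalDelPezzo.data]
    · norm_num
    · norm_num
    · rw [p2]; exact tendsto_frobD_half
    · norm_num
    · rw [s2, show (4 : ℝ) = 2 ^ 2 by norm_num, Real.sqrt_sq (by norm_num)]; norm_num
    · norm_num
    · norm_num
    · rw [p2, sub_tsum_frobA_half, dirichletL_neg_four]; push_cast; field_simp; ring
  | B6 =>
    obtain ⟨n1, n2⟩ := hneg (by norm_num) l3
    refine transition_iff (D := B6.data) (ε := 1) (l := 3 * Real.log 3) ?_ ?_ ?_ ?_ n1 n2 ?_ ?_ ?_ ?_ ?_ <;>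
      simp only [LocalDelPezzo.data]
    · norm_num
    · norm_num
    · rw [p3]; exact tendsto_frobD_third
    · norm_num
    · rw [s3]; push_cast; ring
    · norm_num
    · norm_num
    · rw [p3, sub_tsum_frobA_third, dirichletL_neg_three]; push_cast; field_simp
  | B7 =>
    obtain ⟨n1, n2⟩ := hneg (by norm_num) l4
    refine transition_iff (D := B7.data) (ε := 1) (l := 6 * Real.log 2) ?_ ?_ ?_ ?_ n1 n2 ?_ ?_ ?_ ?_ ?_ <;>
      simp only [LocalDelPezzo.data]
    · norm_num
    · norm_num
    · rw [p4]; exact tendsto_frobD_quarter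
    · norm_num
    · rw [s4]; push_cast; ring
    · norm_num
    · norm_num
    · rw [p4, sub_tsum_frobA_quarter, dirichletL_neg_eight]; push_cast; field_simp; ring
  | B8 =>
    obtain ⟨n1, n2⟩ := hneg (by norm_num) l6
    refine transition_iff (D := B8.data) (ε := 1) (l := 4 * Real.log 2 + 3 * Real.log 3)
      ?_ ?_ ?_ ?_ n1 n2 ?_ ?_ ?_ ?_ ?_ <;>
      simp only [LocalDelPezzo.data]
    · norm_num
    · norm_num
    · rw [p6]; exact tendsto_frobD_sixth
    · norm_num
    · rw [s6]; norm_num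
    · norm_num
    · norm_num
    · rw [p6, sub_tsum_frobA_sixth, dirichletL_neg_four]; push_cast; field_simp; ring

/-! ### The Legendre family -/

open MeasureTheory in
/-- The fundamental theorem of calculus for a function that is a constant multiple of a nonnegative
derivative: integrability is automatic. -/
theorem intervalIntegrable_and_integral_eq {a b fa fb : ℝ} {f g : ℝ → ℝ} {F : ℝ → ℂ} {c : ℂ}
    (hab : a < b) (hf : ∀ x ∈ Ioo a b, HasDerivAt f (g x) x) (hg : ∀ x ∈ Ioo a b, 0 ≤ g x)
    (hF : ∀ x ∈ Ioo a b, F x = c * g x)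
    (ha : Tendsto f (𝓝[>] a) (𝓝 fa)) (hb : Tendsto f (𝓝[<] b) (𝓝 fb)) :
    IntervalIntegrable F volume a b ∧ ∫ x in a..b, F x = c * (fb - fa : ℝ) := by
  have hc : ContinuousOn f (Ioo a b) := fun x hx => (hf x hx).continuousAt.continuousWithinAt
  have hint : IntegrableOn g (Ioc a b) := by
    refine intervalIntegral.integrableOn_deriv_of_nonneg
      (continuousOn_Icc_extendFrom_Ioo hc ha hb) (fun x hx => ?_) hg
    refine (hf x hx).congr_of_eventuallyEq ?_
    filter_upwards [isOpen_Ioo.mem_nhds hx] with y hy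
    exact extendFrom_extends hc y hy
  have hI : IntervalIntegrable F volume a b := by
    rw [intervalIntegrable_iff_integrableOn_Ioo_of_le hab.le]
    exact IntegrableOn.congr_fun (((hint.mono_set Ioo_subset_Ioc_self).ofReal (𝕜 := ℂ)).const_mul c)
      (fun x hx => (hF x hx).symm) measurableSet_Ioo
  refine ⟨hI, ?_⟩
  rw [intervalIntegral.integral_eq_sub_of_hasDerivAt_of_tendsto hab
    (f := fun x => c * (f x : ℂ)) (fun x hx => ?_) hI (ha.ofReal.const_mul c)
    (hb.ofReal.const_mul c)]
  · push_cast; ring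
  · rw [hF x hx]
    exact (hf x hx).ofReal_comp.const_mul c

theorem tendsto_div_nhdsGT_zero {μ : ℝ} (hμ : 0 < μ) :
    Tendsto (fun z : ℝ => z / μ) (𝓝[>] 0) (𝓝[>] 0) := by
  refine tendsto_nhdsWithin_iff.2 ⟨?_, ?_⟩
  · have : Tendsto (fun z : ℝ => z / μ) (𝓝 0) (𝓝 (0 / μ)) := (continuous_id.div_const μ).tendsto 0
    rw [zero_div] at this
    exact this.mono_left nhdsWithin_le_nhds
  · filter_upwards [self_mem_nhdsWithin] with x hx using div_pos hx hμ

theorem tendsto_div_nhdsLT_one {μ : ℝ} (hμ : 0 < μ) :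
    Tendsto (fun z : ℝ => z / μ) (𝓝[<] μ) (𝓝[<] 1) := by
  refine tendsto_nhdsWithin_iff.2 ⟨?_, ?_⟩
  · have : Tendsto (fun z : ℝ => z / μ) (𝓝 μ) (𝓝 (μ / μ)) := (continuous_id.div_const μ).tendsto μ
    rw [div_self hμ.ne'] at this
    exact this.mono_left nhdsWithin_le_nhds
  · filter_upwards [self_mem_nhdsWithin] with x hx using (div_lt_one hμ).2 hx

theorem hasDerivAt_comp_div {E : Type*} [NormedAddCommGroup E] [NormedSpace ℝ E] {Y : ℝ → E} {w : E}
    {μ z : ℝ} (h : HasDerivAt Y ((z / μ)⁻¹ • w) (z / μ)) (hμ : μ ≠ 0) :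
    HasDerivAt (fun z => Y (z / μ)) (z⁻¹ • w) z := by
  refine (h.scomp z ((hasDerivAt_id z).div_const μ)).congr_deriv ?_
  rw [smul_smul, inv_div, one_div]
  congr 1
  field_simp

section
variable {p l μ : ℝ}

theorem one_le_solF (hp : 0 < p) (hp' : p ≤ 1 / 4) {x : ℝ} (hx : x ∈ Ioo (0 : ℝ) 1) :
    1 ≤ solF p x := by
  have h := (polyBdd_frobA hp hp').hasSum (norm_lt_one_of_mem hx)
  have h1 : frobA p 0 • x ^ 0 ≤ solF p x := le_hasSum h 0 fun n _ =>
    smul_nonneg (frobA_pos hp n).le (pow_nonneg hx.1.le n)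
  simpa [frobA_zero] using h1

/-- Termwise Dₙ ≤ l; keeping the term n = 0, where D₀ = 0, gains the -1. This gives the integrand
for c₂ a constant sign, which yields its integrability. -/
theorem psum_frobG_le (hp : 0 < p) (hp' : p ≤ 1 / 4) (hl : Tendsto (frobD p) atTop (𝓝 l)) {x : ℝ}
    (hx : x ∈ Ioo (0 : ℝ) 1) : psum (frobG p) x ≤ l * (solF p x - 1) := by
  have hn := norm_lt_one_of_mem hx
  have h := (((polyBdd_frobA hp hp').hasSum hn).mul_left l).sub ((polyBdd_frobG hp hp').hasSum hn)
  have h1 := le_hasSum h 0 fun n _ => by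
    have := mul_nonneg (mul_nonneg (frobA_pos hp n).le (pow_nonneg hx.1.le n))
      (sub_nonneg.2 (frobD_le hp hp' hl n))
    simp only [smul_eq_mul, frobG]
    linarith
  simp only [frobA_zero, frobG_zero, pow_zero, smul_eq_mul, mul_one, sub_zero] at h1
  rw [solF]
  linarith

theorem tendsto_psum_coeffF₀_div_one (hp : 0 < p) (hp' : p ≤ 1 / 4) (hμ : 0 < μ) :
    Tendsto (fun z => psum (coeffF₀ p) (z / μ)) (𝓝[<] μ) (𝓝 (∑' n, coeffF₀ p n)) :=
  (tendsto_psum_one (summable_coeffF₀ hp hp')).comp (tendsto_div_nhdsLT_one hμ)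

theorem integral_solF_sub_one (hp : 0 < p) (hp' : p ≤ 1 / 4) (hμ : 0 < μ) {ω : ℝ → ℂ}
    (hω : ∀ z ∈ Ioo 0 μ, ω z = solF p (z / μ)) :
    IntervalIntegrable (fun z : ℝ => (ω z - 1) / (z : ℂ)) MeasureTheory.volume 0 μ ∧
      ∫ z in (0 : ℝ)..μ, (ω z - 1) / (z : ℂ) = (∑' n, coeffF₀ p n : ℝ) := by
  have hx : ∀ z ∈ Ioo 0 μ, z / μ ∈ Ioo (0 : ℝ) 1 := fun z hz =>
    ⟨div_pos hz.1 hμ, (div_lt_one hμ).2 hz.2⟩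
  have h := intervalIntegrable_and_integral_eq (c := 1) (F := fun z : ℝ => (ω z - 1) / (z : ℂ)) hμ
    (fun z hz => hasDerivAt_comp_div ((hasDerivAt_psum_coeffF₀ hp hp' (hx z hz)).congr_deriv
      (div_eq_inv_mul _ _)) hμ.ne')
    (fun z hz => smul_nonneg (inv_nonneg.2 hz.1.le) (sub_nonneg.2 (one_le_solF hp hp' (hx z hz))))
    (fun z hz => by
      rw [hω z hz, smul_eq_mul]; push_cast; rw [one_mul, div_eq_inv_mul])
    ((tendsto_psum_zero (polyBdd_coeffF₀ hp hp')).comp (tendsto_div_nhdsGT_zero hμ))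
    (tendsto_psum_coeffF₀_div_one hp hp' hμ)
  simpa [coeffF₀_zero] using h

theorem integral_solU_sub_log (hp : 0 < p) (hp' : p ≤ 1 / 4)
    (hl : Tendsto (frobD p) atTop (𝓝 l)) (hμ : 0 < μ) (hlμ : Real.log μ = -l) {ω : ℝ → ℂ}
    (hω : ∀ z ∈ Ioo 0 μ, ω z = solU p (z / μ) + Real.log μ * solF p (z / μ)) :
    IntervalIntegrable (fun z : ℝ => (ω z - (Real.log z : ℂ)) / (z : ℂ)) MeasureTheory.volume 0 μ ∧
      ∫ z in (0 : ℝ)..μ, (ω z - (Real.log z : ℂ)) / (z : ℂ) = mellinReg p l 0 := by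
  have hx : ∀ z ∈ Ioo 0 μ, z / μ ∈ Ioo (0 : ℝ) 1 := fun z hz =>
    ⟨div_pos hz.1 hμ, (div_lt_one hμ).2 hz.2⟩
  have hb₀ := polyBdd_coeffF₀ hp hp'
  have hb₁ := polyBdd_coeffF₁ hp hp'
  have hs := hasSum_coeffF₁ hp hp' hl
  have hd : ∀ x ∈ Ioo (0 : ℝ) 1, HasDerivAt
      (fun x => l * psum (coeffF₀ p) x - (Real.log x * psum (coeffF₀ p) x + psum (coeffF₁ p) x))
      (x⁻¹ • (l * (solF p x - 1) - psum (frobG p) x - Real.log x * (solF p x - 1))) x := by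
    intro x hx
    have h0 := hx.1.ne'
    have h1 := hasDerivAt_psum_coeffF₀ hp hp' hx
    refine ((h1.const_mul l).sub (((Real.hasDerivAt_log h0).mul h1).add
      (hasDerivAt_psum_coeffF₁ hp hp' hx))).congr_deriv ?_
    rw [smul_eq_mul]
    field_simp
    ring
  have hlim0 := ((tendsto_psum_zero hb₀).const_mul l).sub
    ((tendsto_log_mul_psum_zero hb₀ (coeffF₀_zero p)).add (tendsto_psum_zero hb₁))
  have hS := tendsto_psum_one (summable_coeffF₀ hp hp')
  have hlim1 := (hS.const_mul l).sub ((tendsto_log_one.mul hS).add (tendsto_psum_one hs.summable))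
  rw [hs.tsum_eq] at hlim1
  -- The integrand (log x - l)(F - 1) + ∑ Gₙ xⁿ, divided by z, is nonpositive, hence the constant -1
  -- in front of a nonnegative derivative.
  have h := intervalIntegrable_and_integral_eq (c := -1)
    (F := fun z : ℝ => (ω z - (Real.log z : ℂ)) / (z : ℂ)) hμ
    (fun z hz => hasDerivAt_comp_div (hd _ (hx z hz)) hμ.ne')
    (fun z hz => smul_nonneg (inv_nonneg.2 hz.1.le) ?_)
    (fun z hz => ?_)
    (hlim0.comp (tendsto_div_nhdsGT_zero hμ)) (hlim1.comp (tendsto_div_nhdsLT_one hμ))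
  · refine ⟨h.1, h.2.trans ?_⟩
    simp only [coeffF₀_zero, coeffF₁_zero]
    push_cast
    ring
  · have h1 := psum_frobG_le hp hp' hl (hx z hz)
    have h2 := mul_nonneg (neg_nonneg.2 (Real.log_nonpos (hx z hz).1.le (hx z hz).2.le))
      (sub_nonneg.2 (one_le_solF hp hp' (hx z hz)))
    linarith
  · have e : Real.log z = Real.log (z / μ) + Real.log μ := by
      rw [Real.log_div hz.1.ne' hμ.ne']; ring
    have e2 : psum (frobA p) (z / μ) = solF p (z / μ) := rfl
    rw [hω z hz, e, hlμ, solU, e2, smul_eq_mul]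
    push_cast
    rw [div_eq_inv_mul]
    ring

end

theorem frobA_quarter (n : ℕ) : frobA (1 / 4) n = (Nat.centralBinom n : ℝ) ^ 2 / 16 ^ n := by
  induction n with
  | zero => simp [frobA_zero]
  | succ n ih =>
    have h : ((n : ℝ) + 1) * Nat.centralBinom (n + 1) = 2 * (2 * n + 1) * Nat.centralBinom n := by
      exact_mod_cast Nat.succ_mul_centralBinom_succ n
    have h0 : ((n : ℝ) + 1) ^ 2 ≠ 0 := by positivity
    refine mul_left_cancel₀ h0 ?_
    have e : ((n : ℝ) + 1) ^ 2 * ((Nat.centralBinom (n + 1) : ℝ) ^ 2 / 16 ^ (n + 1))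
        = (((n : ℝ) + 1) * Nat.centralBinom (n + 1)) ^ 2 / 16 ^ (n + 1) := by ring
    rw [frobA_succ, ih, e, h]
    ring

theorem omega₁_eq (z : ℝ) : omega₁ z = solF (1 / 4) (z / (1 / 16)) := by
  rw [omega₁, solF, ← psum_ofReal, psum]
  congr 1
  funext n
  rw [frobA_quarter, Complex.real_smul]
  push_cast
  rw [show (z : ℂ) / (1 / 16) = 16 * z by ring, mul_pow]
  field_simp

theorem IsOmega₂.isSol {ω : ℝ → ℂ} (h : IsOmega₂ ω) :
    ∃ q, IsSol (1 / 4) (fun x => ω (1 / 16 * x)) q := by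
  have hμ : (1 / 16 : ℝ) ≠ 0 := by norm_num
  have := isSol_of_hypergeometricOp (a₁ := 1 / 2) (a₂ := 1 / 2) (by norm_num)
    (w := fun x => ω (1 / 16 * x))
    (h.contDiffOn.comp (by fun_prop) fun x hx => mul_mem_interval hμ hx) fun x hx => by
      rw [hypergeometricOp_comp_mul _ _ hμ]
      exact h.equation _ (mul_mem_interval hμ hx)
  rw [show (1 / 2 : ℝ) * (1 / 2) = 1 / 4 by norm_num] at this
  exact ⟨_, this⟩

theorem IsOmega₂.unique {ω ω' : ℝ → ℂ} (h : IsOmega₂ ω) (h' : IsOmega₂ ω') {z : ℝ}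
    (hz : z ∈ interval (1 / 16)) : ω z = ω' z := by
  have hμ : (1 / 16 : ℝ) ≠ 0 := by norm_num
  obtain ⟨q, hq⟩ := h.isSol
  obtain ⟨q', hq'⟩ := h'.isSol
  obtain ⟨g, hg, hg0, hω⟩ := h.expansion
  obtain ⟨g', hg', hg0', hω'⟩ := h'.expansion
  have key := (hq.sub hq').eq_zero_of_analytic (by norm_num) le_rfl
    (analyticAt_comp_mul (hg.sub hg') (1 / 16))
    (by simp [eq_zero_of_isBigO hg0, eq_zero_of_isBigO hg0']) (by
      filter_upwards [(tendsto_mul_interval hμ).eventually (hω.and hω')] with x hx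
      rw [hx.1, hx.2]
      simp) _ (div_mem_of_mem_interval hz)
  rw [mul_div_cancel₀ z hμ] at key
  exact sub_eq_zero.1 key

theorem isOmega₂_solU : IsOmega₂ fun z =>
    solU (1 / 4) (z / (1 / 16)) + Real.log (1 / 16) * solF (1 / 4) (z / (1 / 16)) := by
  have hp : (0 : ℝ) < 1 / 4 := by norm_num
  have hμ : (1 / 16 : ℝ) ≠ 0 := by norm_num
  have hsol := (isSol_solU hp le_rfl).ofReal.add
    ((isSol_solF hp le_rfl).ofReal.const_smul (Real.log (1 / 16) : ℂ))
  refine ⟨?_, fun z hz => ?_, fun z => psum (frobG (1 / 4)) (z / (1 / 16 : ℝ)),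
    analyticAt_psum_div (polyBdd_frobG hp le_rfl) _,
    psum_div_isBigO (polyBdd_frobG hp le_rfl) (frobG_zero _) _, ?_⟩
  · exact (hsol.contDiffOn 2).1.comp (by fun_prop : ContDiff ℝ 2 fun z : ℝ => z / (1 / 16)).contDiffOn
      fun z hz => div_mem_of_mem_interval hz
  · have e := hypergeometricOp_comp_mul (1 / 2) (1 / 2) hμ (fun z =>
      (solU (1 / 4) (z / (1 / 16)) : ℂ) + Real.log (1 / 16) * solF (1 / 4) (z / (1 / 16)))
      (z / (1 / 16))
    rw [mul_div_cancel₀ z hμ] at e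
    rw [← e]
    simp only [mul_div_cancel_left₀ _ hμ]
    rw [show (1 / 4 : ℝ) = 1 / 2 * (1 / 2) by norm_num] at hsol ⊢
    exact hsol.hypergeometricOp_eq_zero (by norm_num) (div_mem_of_mem_interval hz)
  · filter_upwards [self_mem_nhdsWithin] with z hz
    have hx := div_mem_of_mem_interval hz
    have hz0 : z ≠ 0 := fun h => by simp [h] at hx
    rw [omega₁_eq, ← Complex.ofReal_div, psum_ofReal, solU, Real.log_div hz0 hμ]
    have e2 : psum (frobA (1 / 4)) (z / (1 / 16)) = solF (1 / 4) (z / (1 / 16)) := rfl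
    rw [e2]
    push_cast
    ring

open MeasureTheory in
/-- Continuation of a primitive from the conifold point. -/
theorem integral_from_conifold {Y ω : ℝ → ℂ} {μ z : ℝ} {c : ℂ} (hz : z ∈ Ioo 0 μ)
    (hY : ∀ x ∈ Ioo 0 μ, HasDerivAt Y (ω x / x) x) (hlim : Tendsto Y (𝓝[<] μ) (𝓝 c))
    {k : ℝ → ℂ} (hk : ContinuousOn k (Ioi 0))
    (hint : IntervalIntegrable (fun x : ℝ => (ω x - k x) / (x : ℂ)) volume 0 μ) :
    IntervalIntegrable (fun x : ℝ => ω x / (x : ℂ)) volume μ z ∧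
      Y z = (∫ x in μ..z, ω x / (x : ℂ)) + c := by
  have hsub : uIcc z μ ⊆ uIcc 0 μ := by
    rw [uIcc_of_le hz.2.le, uIcc_of_le (hz.1.trans hz.2).le]
    exact Icc_subset_Icc_left hz.1.le
  -- The subtraction of k matters only at 0; between z and μ the function k(x) / x is continuous and
  -- can be added back.
  have h2 : IntervalIntegrable (fun x : ℝ => k x / (x : ℂ)) volume z μ := by
    refine ContinuousOn.intervalIntegrable ?_
    rw [uIcc_of_le hz.2.le]
    have hpos : ∀ x ∈ Icc z μ, 0 < x := fun x hx => hz.1.trans_le hx.1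
    refine (hk.mono hpos).div Complex.continuous_ofReal.continuousOn fun x hx => ?_
    exact_mod_cast (hpos x hx).ne'
  have h3 : IntervalIntegrable (fun x : ℝ => ω x / (x : ℂ)) volume z μ := by
    refine ((hint.mono_set hsub).add h2).congr ?_
    exact fun x _ => by ring
  refine ⟨h3.symm, ?_⟩
  have h := intervalIntegral.integral_eq_sub_of_hasDerivAt_of_tendsto hz.2
    (fun x hx => hY x ⟨hz.1.trans hx.1, hx.2⟩) h3
    ((hY z hz).continuousAt.tendsto.mono_left nhdsWithin_le_nhds) hlim
  rw [intervalIntegral.integral_symm, h]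
  ring

theorem legendre_periods {ω₂ : ℝ → ℂ} (h : IsOmega₂ ω₂) :
    IntervalIntegrable (fun z : ℝ => (omega₁ z - 1) / (z : ℂ)) MeasureTheory.volume 0 (1 / 16) ∧
    IntervalIntegrable (fun z : ℝ => (ω₂ z - (Real.log z : ℂ)) / (z : ℂ))
      MeasureTheory.volume 0 (1 / 16) ∧
    (∀ Φ, IsFrobeniusBasisAtZero (1 / 2) (1 / 2) (1 / 16) Φ → ∀ z ∈ interval (1 / 16),
      IntervalIntegrable (fun x : ℝ => omega₁ x / (x : ℂ)) MeasureTheory.volume (1 / 16) z ∧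
      IntervalIntegrable (fun x : ℝ => ω₂ x / (x : ℂ)) MeasureTheory.volume (1 / 16) z ∧
      Φ z = ![1,
        (∫ x in (1 / 16 : ℝ)..z, omega₁ x / (x : ℂ)) + c₁,
        (∫ x in (1 / 16 : ℝ)..z, ω₂ x / (x : ℂ)) + c₂ ω₂]) ∧
    c₁ = -(8 / (Real.pi : ℂ)) * dirichletL (-4) 2 ∧
    c₂ ω₂ = (Real.pi : ℂ) ^ 2 / 3 := by
  have hp : (0 : ℝ) < 1 / 4 := by norm_num
  have hμ : (0 : ℝ) < 1 / 16 := by norm_num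
  have hl := tendsto_frobD_half
  have hlog : Real.log (1 / 16) = -(4 * Real.log 2) := by
    rw [one_div, Real.log_inv, show (16 : ℝ) = 2 ^ 4 by norm_num, Real.log_pow]; norm_num
  have hI : interval (1 / 16) = Ioo 0 (1 / 16) := by
    rw [interval, min_eq_left hμ.le, max_eq_right hμ.le]
  have hω₂ : ∀ z ∈ Ioo (0 : ℝ) (1 / 16), ω₂ z = _ := fun z hz => h.unique isOmega₂_solU (hI ▸ hz)
  obtain ⟨i1, e1⟩ := integral_solF_sub_one hp le_rfl hμ fun z _ => omega₁_eq z
  obtain ⟨i2, e2⟩ := integral_solU_sub_log hp le_rfl hl hμ hlog hω₂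
  have hc₁ : c₁ = Real.log (1 / 16) + (∑' n, coeffF₀ (1 / 4) n : ℝ) := by rw [c₁, e1]
  have hc₂ : c₂ ω₂ = 1 / 2 * (Real.log (1 / 16) : ℂ) ^ 2
      + mellinReg (1 / 4) (4 * Real.log 2) 0 := by rw [c₂, e2]
  refine ⟨i1, i2, fun Φ hΦ z hz => ?_, ?_, ?_⟩
  · have hh : (1 / 2 : ℝ) * (1 / 2) = 1 / 4 := by norm_num
    have hZ := isFrobeniusBasisAtZero_perZero (a₁ := 1 / 2) (a₂ := 1 / 2) hμ.ne' (by norm_num)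
      (by norm_num) (by norm_num)
    have hu := hΦ.unique hμ.ne' (by norm_num) (by norm_num) (by norm_num) hZ hz
    rw [hh, ← Complex.ofReal_log hμ.le] at hu
    have hx : ∀ x ∈ Ioo (0 : ℝ) (1 / 16), x / (1 / 16) ∈ Ioo (0 : ℝ) 1 := fun x hx =>
      div_mem_of_mem_interval (hI ▸ hx)
    have hsm : ∀ {Y w q : ℝ → ℂ}, IsPrimSol (1 / 4) Y w q → ∀ x ∈ Ioo (0 : ℝ) (1 / 16),
        HasDerivAt (fun x => Y (x / (1 / 16))) (w (x / (1 / 16)) / x) x := fun hY x hx' =>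
      (hasDerivAt_comp_div ((hY.hasDerivAt _ (hx x hx')).congr_deriv (by
        rw [Complex.real_smul, Complex.ofReal_inv, div_eq_inv_mul])) hμ.ne').congr_deriv (by
        rw [Complex.real_smul, Complex.ofReal_inv]; exact (div_eq_inv_mul _ _).symm)
    have hz' : z ∈ Ioo (0 : ℝ) (1 / 16) := hI ▸ hz
    obtain ⟨j1, k1⟩ := integral_from_conifold (ω := omega₁) hz' (fun x hx => by
        rw [omega₁_eq x]
        exact hsm (isPrimSol_perZero_one hp le_rfl (Real.log (1 / 16))) x hx)
      ((tendsto_perZero_one hp le_rfl _).comp (tendsto_div_nhdsLT_one hμ))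
      (k := fun _ => 1) continuousOn_const i1
    obtain ⟨j2, k2⟩ := integral_from_conifold (ω := ω₂) hz' (fun x hx => by
        rw [hω₂ x hx]
        exact hsm (isPrimSol_perZero_two hp le_rfl (Real.log (1 / 16))) x hx)
      ((tendsto_perZero_two hp le_rfl hl _).comp (tendsto_div_nhdsLT_one hμ))
      (k := fun x => (Real.log x : ℂ))
      (Complex.continuous_ofReal.comp_continuousOn
        (Real.continuousOn_log.mono fun x hx => (ne_of_gt hx : x ≠ 0))) i2
    refine ⟨j1, j2, ?_⟩
    rw [hu]
    funext i
    fin_cases i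
    · rfl
    · refine k1.trans ?_
      simp [hc₁]
    · refine k2.trans ?_
      rw [hc₂, hlog]
      simp
      ring
  · have e := sub_tsum_frobA_half
    rw [hc₁, hlog, dirichletL_neg_four, ← Complex.ofReal_add,
      show -(4 * Real.log 2) + ∑' n, coeffF₀ (1 / 4) n = -(8 / Real.pi * (progSum 4 1 - progSum 4 3))
        by rw [← e]; simp only [coeffF₀]; ring]
    push_cast
    ring
  · have e := mellinReg_zero (a := 1 / 2) (l := 4 * Real.log 2) (by norm_num)
    rw [show (1 / 2 : ℝ) * (1 - 1 / 2) = 1 / 4 by norm_num, mul_one_div, Real.sin_pi_div_two] at e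
    rw [hc₂, e hl, hlog]
    push_cast
    ring

end LocalCY

open LocalCY in
theorem mainTheorem3 :
    (∀ M : LocalDelPezzo,
      (∃ Φ, IsFrobeniusBasisAtZero M.data.a₁ M.data.a₂ M.data.μ Φ) ∧
      (∃ Ψ, IsFrobeniusBasisAtConifold M.data.a₁ M.data.a₂ M.data.μ Ψ) ∧
      ∀ Φ Ψ : ℝ → Fin 3 → ℂ,
        IsFrobeniusBasisAtZero M.data.a₁ M.data.a₂ M.data.μ Φ →
        IsFrobeniusBasisAtConifold M.data.a₁ M.data.a₂ M.data.μ Ψ →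
        ∀ T : Matrix (Fin 3) (Fin 3) ℂ,
          (∀ z ∈ interval M.data.μ, (gammaClassMatrix M.data).mulVec (Φ z) = T.mulVec (Ψ z)) ↔
            T = transitionMatrix M.data) ∧
    (∃ ω₂, IsOmega₂ ω₂) ∧
    (∀ ω₂ : ℝ → ℂ, IsOmega₂ ω₂ →
      IntervalIntegrable (fun z : ℝ => (omega₁ z - 1) / (z : ℂ)) MeasureTheory.volume 0 (1 / 16) ∧
      IntervalIntegrable (fun z : ℝ => (ω₂ z - (Real.log z : ℂ)) / (z : ℂ))
        MeasureTheory.volume 0 (1 / 16) ∧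
      (∀ Φ, IsFrobeniusBasisAtZero (1 / 2) (1 / 2) (1 / 16) Φ → ∀ z ∈ interval (1 / 16),
        IntervalIntegrable (fun x : ℝ => omega₁ x / (x : ℂ)) MeasureTheory.volume (1 / 16) z ∧
        IntervalIntegrable (fun x : ℝ => ω₂ x / (x : ℂ)) MeasureTheory.volume (1 / 16) z ∧
        Φ z = ![1,
          (∫ x in (1 / 16 : ℝ)..z, omega₁ x / (x : ℂ)) + c₁,
          (∫ x in (1 / 16 : ℝ)..z, ω₂ x / (x : ℂ)) + c₂ ω₂]) ∧
      c₁ = -(8 / (Real.pi : ℂ)) * dirichletL (-4) 2 ∧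
      c₂ ω₂ = (Real.pi : ℂ) ^ 2 / 3) :=
  ⟨transition_iff_data, ⟨_, isOmega₂_solU⟩, fun _ h => legendre_periods h⟩
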